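/- Let $p$ be a prime, $n\ge 1$ an integer and $R$ a commutative $\mathbb F_p$-algebra. Let $W$ be the ring scheme of $p$-typical Witt vectors, with Frobenius $F$ and Verschiebung $V$, let $W_m(R)$ be the ring of Witt vectors of length $m$, and put $I_{n,R}=\ker(W_n(R)\to W_1(R)=R)$, $J_{n,R}=\ker(W_n(R)\to W_{n-1}(R))$. An $n$-truncated semidisplay over $R$ is a quadruple $\mathscr P=(P,Q,F,F_1)$, where $P$ is a finitely generated projective $W_n(R)$-module, $Q\subset P$ is a submodule, and $F:P\to P$, $F_1:Q\to P/J_{n,R}P$ are additive maps, semilinear with respect to the Frobenius, such that (i) $Q\supset I_{n,R}P$ and $P/Q$ is a projective $R$-module; (ii) $F_1(V(a)x)=a\cdot\bar F(x)$ for $a\in W(R)$, $x\in P$, where $\bar F(x)$ is the class of $F(x)$ in $P/J_{n,R}P$; (iii) $F(y)=pF_1(y)$ for $y\in Q$ (note that $p\,J_{n,R}=0$). For an $R$-algebra $T$ let $\hat W^{(F^n)}(T)$ be the set of $x\in W(T)$ with $F^n(x)=0$ and with almost all components equal to zero (then all components are nilpotent); it is a $W_n(T)$-module. Let $\mathbb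 G_a^{(F^n)}(T)=\{t\in T: t^{p^n}=0\}$. Put $$C^0_{\mathscr P}(T)=\hat W^{(F^n)}(T)\otimes_{W_n(R)}P,\qquad C^{-1}_{\mathscr P}(T)=\ker\bigl(C^0_{\mathscr P}(T)\to \mathbb G_a^{(F^n)}(T)\otimes_R (P/Q)\bigr),$$ the map being $a\otimes x\mapsto a_0\otimes\bar x$, where $a_0$ is the $0$-th component of $a$. Let $\Phi:C^{-1}_{\mathscr P}(T)\to C^0_{\mathscr P}(T)$ be the unique additive map such that $\Phi(V(a)\otimes x)=a\otimes F(x)$ for $a\in\hat W^{(F^n)}(T)$, $x\in P$, and $\Phi(a\otimes y)=F(a)\otimes F_1(y)$ for $a\in\hat W^{(F^n)}(T)$, $y\in Q$. Let $\mathfrak Z_{\mathscr P}$ be the functor $T\mapsto\operatorname{Coker}\bigl(1-\Phi:C^{-1}_{\mathscr P}(T)\to C^0_{\mathscr P}(T)\bigr)$ from $R$-algebras to abelian groups. For a functor $G$ from $R$-algebras to abelian groups let $G^*=\underline{\operatorname{Hom}}(G,\mathbb G_m)$ be its Cartier dual: $G^*(R')$ is the group of homomorphisms $G_{R'}\to\mathbb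 G_{m,R'}$ of functors on the category of $R'$-algebras. Let $\operatorname{Hom}_{W_n(R)}(P,W_{n,R})$ be the functor whose group of $R'$-points is the group of $W_n(R)$-linear maps $P\to W_n(R')$, for every $R$-algebra $R'$. Let $\langle\,,\rangle:\hat W^{(F^n)}\times W_n\to\mathbb G_m$ be the canonical pairing $\langle a,y\rangle=\lambda(a\tilde y)$, where $\tilde y$ is any Witt vector lifting $y$, $\lambda(z)=\prod_i E_p(z_i)$ and $E_p(X)=\exp\bigl(\sum_{j\ge 0}X^{p^j}/p^j\bigr)\in\mathbb Z_{(p)}[[X]]$ is the Artin–Hasse exponential. Proposition. Let $\mathscr P=(P,Q,F,F_1)$ be an $n$-truncated semidisplay over $R$, and let $R'$ be an $R$-algebra. (a) The projection $C^0_{\mathscr P}\to\mathfrak Z_{\mathscr P}$ induces an injective homomorphism $\mathfrak Z_{\mathscr P}^*(R')\to (C^0_{\mathscr P})^*(R')$, and the canonical pairing induces an isomorphism of groups $\operatorname{Hom}_{W_n(R)}(P,W_n(R'))\to (C^0_{\mathscr P})^*(R')$, under which $\eta$ corresponds to the character $a\otimes x\mapsto\langle a,\eta(x)\rangle$ (for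 $R'$-algebras $T$, $a\in\hat W^{(F^n)}(T)$, $x\in P$). In this way $\mathfrak Z_{\mathscr P}^*$ is a subgroup of $\operatorname{Hom}_{W_n(R)}(P,W_{n,R})$. (b) As such, it is equal to the subgroup $\underline{\operatorname{Hom}}(\mathscr P,\mathbf 1_{n,R})$: the subgroup $\mathfrak Z_{\mathscr P}^*(R')$ consists of those $W_n(R)$-linear maps $\eta:P\to W_n(R')$ for which $$\eta(F(x))=F(\eta(x))\ \text{ for all } x\in P,\qquad \eta(y)=V(\eta(F_1(y)))\ \text{ for all } y\in Q.$$ Here $\eta(F_1(y))$ is regarded as an element of $W_{n-1}(R')$, and $V:W_{n-1}(R')\to W_n(R')$. -/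

import Mathlib

universe u v w

set_option linter.unusedSectionVars false

namespace ZinkDual

/-! ### An auxiliary fact on Witt vectors -/


/-- Multiplication by a Teichmüller representative, in components. -/
theorem coeff_mul_teichmuller (p : ℕ) [hp : Fact p.Prime] {T : Type u} [CommRing T]
    (x : WittVector p T) (t : T) (i : ℕ) :
    (x * WittVector.teichmuller p t).coeff i = x.coeff i * t ^ p ^ i := by
  -- the case where `p` is invertible
  have key : ∀ (B : Type) [CommRing B] [Algebra ℚ B] (y : WittVector p B) (s : B),
      y * WittVector.teichmuller p s = WittVector.mk p fun j => y.coeff j * s ^ p ^ j := by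
    intro B _ _ y s
    have : Invertible (p : B) := by
      have h : IsUnit (algebraMap ℚ B p) :=
        (IsUnit.mk0 _ (Nat.cast_ne_zero.2 hp.out.ne_zero)).map _
      rw [map_natCast] at h
      exact h.invertible
    apply (WittVector.ghostMap.bijective_of_invertible p B).1
    ext k
    rw [map_mul]
    simp only [Pi.mul_apply, WittVector.ghostMap_apply, WittVector.ghostComponent_teichmuller]
    simp only [WittVector.ghostComponent_apply, aeval_wittPolynomial, Finset.sum_mul]
    refine Finset.sum_congr rfl fun j hj => ?_
    have hj' : j ≤ k := Nat.lt_succ_iff.1 (Finset.mem_range.1 hj)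
    rw [WittVector.coeff_mk, mul_pow, ← pow_mul, ← pow_add, Nat.add_sub_cancel' hj', mul_assoc]
  -- the universal case
  have key2 : ∀ (y : WittVector p (MvPolynomial (Option ℕ) ℤ)) (s : MvPolynomial (Option ℕ) ℤ),
      y * WittVector.teichmuller p s = WittVector.mk p fun j => y.coeff j * s ^ p ^ j := by
    intro y s
    apply WittVector.map_injective _
      (MvPolynomial.map_injective (σ := Option ℕ) (Int.castRingHom ℚ) Int.cast_injective)
    rw [map_mul, WittVector.map_teichmuller, key]
    ext j
    simp [WittVector.map_coeff]
  let f : MvPolynomial (Option ℕ) ℤ →+* T :=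
    (MvPolynomial.aeval (R := ℤ) fun o : Option ℕ => o.elim t x.coeff).toRingHom
  have h := congrArg (WittVector.map f)
    (key2 (WittVector.mk p fun j => MvPolynomial.X (some j)) (MvPolynomial.X none))
  rw [map_mul, WittVector.map_teichmuller] at h
  have hx : WittVector.map f (WittVector.mk p fun j => MvPolynomial.X (some j)) = x := by
    ext j
    simp [WittVector.map_coeff, f]
  rw [hx] at h
  have h2 := congrArg (fun z => WittVector.coeff z i) h
  simpa [WittVector.map_coeff, f] using h2


/-! ### The formal Witt group and its Frobenius kernels -/

/-- The property of a Witt vector `x ∈ W(T)` to belong to `Ŵ(T)`: all components of `x` are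
nilpotent and almost all of them are zero. -/
def IsFormal {p : ℕ} {T : Type u} [CommRing T] (x : WittVector p T) : Prop :=
  (∀ i, IsNilpotent (x.coeff i)) ∧ {i | x.coeff i ≠ 0}.Finite

section formal

variable {p : ℕ} [Fact p.Prime] {T : Type u} [CommRing T]

open Polynomial in
theorem finite_of_fg (z : WittVector p T) (S : Subalgebra T T[X]) (hS : S.toSubmodule.FG)
    (h : ∀ i, C (z.coeff i) * X ^ p ^ i ∈ S) : {i | z.coeff i ≠ 0}.Finite := by
  obtain ⟨s, hs⟩ := hS
  have hle : S.toSubmodule ≤ degreeLE T ((s.sup natDegree : ℕ) : WithBot ℕ) := by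
    rw [← hs, Submodule.span_le]
    intro f hf
    rw [SetLike.mem_coe, mem_degreeLE]
    exact degree_le_natDegree.trans (by exact_mod_cast Finset.le_sup (f := natDegree) hf)
  refine (Set.finite_Iic (s.sup natDegree)).subset fun i hi => ?_
  have h1 := mem_degreeLE.1 (hle (h i))
  rw [degree_C_mul_X_pow _ hi] at h1
  have h2 : p ^ i ≤ s.sup natDegree := by exact_mod_cast h1
  exact (Nat.lt_pow_self (Fact.out : p.Prime).one_lt).le.trans h2

theorem isNilpotent_coeff_iff (x : WittVector p T) : (∀ i, IsNilpotent (x.coeff i)) ↔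
    WittVector.map (Ideal.Quotient.mk (nilradical T)) x = 0 := by
  simp [WittVector.ext_iff, WittVector.map_coeff, Ideal.Quotient.eq_zero_iff_mem, mem_nilradical]

open Polynomial in
theorem adjoin_fg (s : Set T[X]) (hs : s.Finite) (h : ∀ f ∈ s, IsNilpotent f) :
    (Algebra.adjoin T s).toSubmodule.FG :=
  fg_adjoin_of_finite hs fun f hf => by
    obtain ⟨n, hn⟩ := h f hf
    exact IsIntegral.of_pow (n := n + 1) (by simp)
      (by rw [pow_succ, hn, zero_mul]; exact isIntegral_zero)

open Polynomial in
/-- The components of `[X] * x`, for `x` in the formal Witt group. -/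
def scaled (x : WittVector p T) : Set T[X] :=
  (fun i => C (x.coeff i) * X ^ p ^ i) '' {i | x.coeff i ≠ 0}

theorem IsFormal.scaled_finite {x : WittVector p T} (hx : IsFormal x) : (scaled x).Finite :=
  hx.2.image _

theorem IsFormal.scaled_nilpotent {x : WittVector p T} (hx : IsFormal x) :
    ∀ f ∈ scaled x, IsNilpotent f := by
  rintro _ ⟨i, -, rfl⟩
  exact (Commute.all _ _).isNilpotent_mul_right ((hx.1 i).map Polynomial.C)

open Polynomial in
theorem mem_adjoin_scaled (x : WittVector p T) (s : Set T[X]) (hs : scaled x ⊆ s) (i : ℕ) :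
    C (x.coeff i) * X ^ p ^ i ∈ Algebra.adjoin T s := by
  by_cases h : x.coeff i = 0
  · rw [h, C_0, zero_mul]; exact zero_mem _
  · exact Algebra.subset_adjoin (hs ⟨i, h, rfl⟩)

open Polynomial in
theorem peval_mem (S : Subalgebra T T[X]) {k : ℕ} (φ : MvPolynomial (Fin k × ℕ) ℤ)
    (f : Fin k → ℕ → T[X]) (h : ∀ a i, f a i ∈ S) : WittVector.peval φ f ∈ S := by
  unfold WittVector.peval
  induction φ using MvPolynomial.induction_on with
  | C c => simp
  | add φ ψ h₁ h₂ => rw [map_add]; exact add_mem h₁ h₂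
  | mul_X φ m h₁ => rw [map_mul, MvPolynomial.aeval_X]; exact mul_mem h₁ (h _ _)

theorem IsFormal.zero : IsFormal (0 : WittVector p T) :=
  ⟨fun i => by simp, by simp⟩

open Polynomial in
theorem coeff_map_C_mul (x : WittVector p T) (i : ℕ) :
    (WittVector.map (C : T →+* T[X]) x * WittVector.teichmuller p X).coeff i =
      C (x.coeff i) * X ^ p ^ i := by
  rw [coeff_mul_teichmuller, WittVector.map_coeff]

theorem IsFormal.add {x y : WittVector p T} (hx : IsFormal x) (hy : IsFormal y) :
    IsFormal (x + y) := by
  refine ⟨?_, ?_⟩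
  · rw [isNilpotent_coeff_iff, map_add, (isNilpotent_coeff_iff x).1 hx.1,
      (isNilpotent_coeff_iff y).1 hy.1, add_zero]
  · refine finite_of_fg _ (Algebra.adjoin T (scaled x ∪ scaled y))
      (adjoin_fg _ (hx.scaled_finite.union hy.scaled_finite) ?_) fun i => ?_
    · rintro f (hf | hf)
      exacts [hx.scaled_nilpotent f hf, hy.scaled_nilpotent f hf]
    · rw [← coeff_map_C_mul, map_add, add_mul, WittVector.add_coeff]
      apply peval_mem
      intro a j
      fin_cases a
      · simpa [coeff_map_C_mul] using mem_adjoin_scaled x (scaled x ∪ scaled y) Set.subset_union_left j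
      · simpa [coeff_map_C_mul] using mem_adjoin_scaled y (scaled x ∪ scaled y) Set.subset_union_right j

theorem IsFormal.mul (w : WittVector p T) {x : WittVector p T} (hx : IsFormal x) :
    IsFormal (w * x) := by
  refine ⟨?_, ?_⟩
  · rw [isNilpotent_coeff_iff, map_mul, (isNilpotent_coeff_iff x).1 hx.1, mul_zero]
  · refine finite_of_fg _ (Algebra.adjoin T (scaled x))
      (adjoin_fg _ hx.scaled_finite hx.scaled_nilpotent) fun i => ?_
    rw [← coeff_map_C_mul, map_mul, mul_assoc, WittVector.mul_coeff]
    apply peval_mem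
    intro a j
    fin_cases a
    · simpa [WittVector.map_coeff] using
        Subalgebra.algebraMap_mem (Algebra.adjoin T (scaled x)) (w.coeff j)
    · simpa [coeff_map_C_mul] using mem_adjoin_scaled x _ subset_rfl j

end formal

/-- The ideal `Ŵ^(Fⁿ)(T) = Ker(Fⁿ : Ŵ(T) → Ŵ(T))` of `W(T)`. -/
def hatWIdeal (p : ℕ) [Fact p.Prime] (n : ℕ) (T : Type u) [CommRing T] :
    Ideal (WittVector p T) where
  carrier := {x | IsFormal x ∧ WittVector.frobenius^[n] x = 0}
  zero_mem' := ⟨IsFormal.zero, by simp⟩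
  add_mem' := fun {x y} hx hy => ⟨hx.1.add hy.1, by simp [hx.2, hy.2]⟩
  smul_mem' := fun w x hx => ⟨hx.1.mul w, by simp [hx.2]⟩

/-- The group `Ŵ^(Fⁿ)(T)`. -/
abbrev HatW (p : ℕ) [Fact p.Prime] (n : ℕ) (T : Type u) [CommRing T] : Type u :=
  hatWIdeal p n T

/-! ### Truncated Witt vectors -/

section truncated

variable {p : ℕ} [Fact p.Prime] {n : ℕ} {R : Type u} {S : Type v} [CommRing R] [CommRing S]

/-- The ring homomorphism `W_n(R) → W_n(S)` induced by a ring homomorphism `f : R → S`. -/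
noncomputable def truncMap (p : ℕ) [Fact p.Prime] (n : ℕ) (f : R →+* S) :
    TruncatedWittVector p n R →+* TruncatedWittVector p n S :=
  have key : ∀ a : WittVector p R, TruncatedWittVector.mk p
      (fun i => f ((WittVector.truncate n a).coeff i)) =
        WittVector.truncate n (WittVector.map f a) := fun a => by
    ext i
    simp [WittVector.map_coeff]
  have h1 : TruncatedWittVector.mk p
      (fun i => f ((1 : TruncatedWittVector p n R).coeff i)) = 1 := by
    rw [← map_one (WittVector.truncate n), key, map_one, map_one]
  have hmul : ∀ x y : TruncatedWittVector p n R,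
      TruncatedWittVector.mk p (fun i => f ((x * y).coeff i)) =
        TruncatedWittVector.mk p (fun i => f (x.coeff i)) *
          TruncatedWittVector.mk p (fun i => f (y.coeff i)) := fun x y => by
    obtain ⟨a, rfl⟩ := WittVector.truncate_surjective p n R x
    obtain ⟨b, rfl⟩ := WittVector.truncate_surjective p n R y
    rw [← map_mul (WittVector.truncate n), key, key, key, map_mul, map_mul]
  have h0 : TruncatedWittVector.mk p
      (fun i => f ((0 : TruncatedWittVector p n R).coeff i)) = 0 := by
    rw [← map_zero (WittVector.truncate n), key, map_zero, map_zero]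
  have hadd : ∀ x y : TruncatedWittVector p n R,
      TruncatedWittVector.mk p (fun i => f ((x + y).coeff i)) =
        TruncatedWittVector.mk p (fun i => f (x.coeff i)) +
          TruncatedWittVector.mk p (fun i => f (y.coeff i)) := fun x y => by
    obtain ⟨a, rfl⟩ := WittVector.truncate_surjective p n R x
    obtain ⟨b, rfl⟩ := WittVector.truncate_surjective p n R y
    rw [← map_add (WittVector.truncate n), key, key, key, map_add, map_add]
  { toFun := fun x => TruncatedWittVector.mk p fun i => f (x.coeff i)
    map_one' := h1
    map_mul' := hmul
    map_zero' := h0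
    map_add' := hadd }

theorem truncMap_truncate (f : R →+* S) (a : WittVector p R) :
    truncMap p n f (WittVector.truncate n a) = WittVector.truncate n (WittVector.map f a) := by
  ext i
  simp [truncMap, WittVector.map_coeff]

/-- The Frobenius `F : W_n(R) → W_n(R)` of an `𝔽_p`-algebra `R`, induced by `F : W(R) → W(R)`. -/
noncomputable def truncF (x : TruncatedWittVector p n R) : TruncatedWittVector p n R :=
  WittVector.truncate n (WittVector.frobenius x.out)

/-- The Verschiebung `V : W_{n-1}(R) → W_n(R)`, induced by `V : W(R) → W(R)`. -/
noncomputable def truncV (x : TruncatedWittVector p (n - 1) R) : TruncatedWittVector p n R :=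
  WittVector.truncate n (WittVector.verschiebung x.out)

theorem natCast_eq_zero (p : ℕ) [Fact p.Prime] (R : Type u) [CommRing R] [Algebra (ZMod p) R]
    (T : Type v) [CommRing T] [Algebra R T] : (p : T) = 0 := by
  have h : (p : R) = 0 := by
    rw [← map_natCast (algebraMap (ZMod p) R) p, CharP.cast_eq_zero, map_zero]
  rw [← map_natCast (algebraMap R T) p, h, map_zero]

theorem coeff_frobenius (hR : (p : R) = 0) (a : WittVector p R) (i : ℕ) :
    (WittVector.frobenius a).coeff i = a.coeff i ^ p := by
  rw [WittVector.coeff_frobenius, WittVector.frobeniusPoly]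
  simp [hR]

theorem coeff_iterate_frobenius (hR : (p : R) = 0) (a : WittVector p R) (k i : ℕ) :
    (WittVector.frobenius^[k] a).coeff i = a.coeff i ^ p ^ k := by
  induction k with
  | zero => simp
  | succ k ih => rw [Function.iterate_succ_apply', coeff_frobenius hR, ih, ← pow_mul, pow_succ]

theorem truncF_truncate (hR : (p : R) = 0) (a : WittVector p R) :
    truncF (WittVector.truncate n a) = WittVector.truncate n (WittVector.frobenius a) := by
  ext i
  rw [truncF, WittVector.coeff_truncate, WittVector.coeff_truncate, coeff_frobenius hR,
    coeff_frobenius hR, TruncatedWittVector.coeff_out, WittVector.coeff_truncate]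

theorem truncV_truncate (a : WittVector p R) :
    truncV (WittVector.truncate (n - 1) a) =
      WittVector.truncate n (WittVector.verschiebung a) := by
  ext ⟨i, hi⟩
  rw [truncV, WittVector.coeff_truncate, WittVector.coeff_truncate]
  cases i with
  | zero => simp
  | succ i =>
    have h : i < n - 1 := by omega
    have h2 := TruncatedWittVector.coeff_out (WittVector.truncate (n - 1) a) ⟨i, h⟩
    rw [WittVector.verschiebung_coeff_add_one, WittVector.verschiebung_coeff_add_one]
    simpa using h2

theorem truncF_add (hR : (p : R) = 0) (x y : TruncatedWittVector p n R) :
    truncF (x + y) = truncF x + truncF y := by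
  obtain ⟨a, rfl⟩ := WittVector.truncate_surjective p n R x
  obtain ⟨b, rfl⟩ := WittVector.truncate_surjective p n R y
  rw [← map_add, truncF_truncate hR, truncF_truncate hR, truncF_truncate hR, map_add, map_add]

theorem truncV_add (x y : TruncatedWittVector p (n - 1) R) :
    truncV (x + y) = truncV x + truncV y := by
  obtain ⟨a, rfl⟩ := WittVector.truncate_surjective p (n - 1) R x
  obtain ⟨b, rfl⟩ := WittVector.truncate_surjective p (n - 1) R y
  rw [← map_add, truncV_truncate, truncV_truncate, truncV_truncate, map_add, map_add]

/-- The restriction `W_n(R) → W_{n-1}(R)`. -/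
noncomputable def truncRestrict (p : ℕ) [Fact p.Prime] (n : ℕ) (R : Type u) [CommRing R] :
    TruncatedWittVector p n R →+* TruncatedWittVector p (n - 1) R :=
  TruncatedWittVector.truncate (Nat.sub_le n 1)

/-- The epimorphism `W_n(R) → W_1(R) = R`, i.e., the `0`-th component. -/
noncomputable def truncHead (p : ℕ) [Fact p.Prime] (n : ℕ) [NeZero n] (R : Type u) [CommRing R] :
    TruncatedWittVector p n R →+* R :=
  have key : ∀ a : WittVector p R, (WittVector.truncate n a).coeff 0 = a.coeff 0 := fun a => by
    rw [WittVector.coeff_truncate, Fin.val_zero]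
  have h1 : (1 : TruncatedWittVector p n R).coeff 0 = 1 := by
    rw [← map_one (WittVector.truncate n), key, WittVector.one_coeff_zero]
  have hmul : ∀ x y : TruncatedWittVector p n R,
      (x * y).coeff 0 = x.coeff 0 * y.coeff 0 := fun x y => by
    obtain ⟨a, rfl⟩ := WittVector.truncate_surjective p n R x
    obtain ⟨b, rfl⟩ := WittVector.truncate_surjective p n R y
    rw [← map_mul (WittVector.truncate n), key, key, key, WittVector.mul_coeff_zero]
  have hadd : ∀ x y : TruncatedWittVector p n R,
      (x + y).coeff 0 = x.coeff 0 + y.coeff 0 := fun x y => by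
    obtain ⟨a, rfl⟩ := WittVector.truncate_surjective p n R x
    obtain ⟨b, rfl⟩ := WittVector.truncate_surjective p n R y
    rw [← map_add (WittVector.truncate n), key, key, key, WittVector.add_coeff_zero]
  { toFun := fun x => x.coeff 0
    map_one' := h1
    map_mul' := hmul
    map_zero' := TruncatedWittVector.coeff_zero p n R 0
    map_add' := hadd }

theorem truncHead_truncate [NeZero n] (a : WittVector p R) :
    truncHead p n R (WittVector.truncate n a) = a.coeff 0 := by
  change (WittVector.truncate n a).coeff 0 = a.coeff 0
  rw [WittVector.coeff_truncate, Fin.val_zero]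

theorem truncHead_surjective [NeZero n] : Function.Surjective (truncHead p n R) := fun r =>
  ⟨WittVector.truncate n (WittVector.teichmuller p r), by
    rw [truncHead_truncate, WittVector.teichmuller_coeff_zero]⟩

/-- The ideal `I_{n,R} = Ker(W_n(R) → W_1(R))`. -/
noncomputable def idealI (p : ℕ) [Fact p.Prime] (n : ℕ) [NeZero n] (R : Type u) [CommRing R] :
    Ideal (TruncatedWittVector p n R) :=
  RingHom.ker (truncHead p n R)

/-- The ideal `J_{n,R} = Ker(W_n(R) → W_{n-1}(R))`. -/
noncomputable def idealJ (p : ℕ) [Fact p.Prime] (n : ℕ) (R : Type u) [CommRing R] :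
    Ideal (TruncatedWittVector p n R) :=
  RingHom.ker (truncRestrict p n R)

end truncated

/-! ### `Ŵ^(Fⁿ)(T)` as a module over truncated Witt vectors -/

section module

variable {p : ℕ} [Fact p.Prime] {n : ℕ} {T : Type u} [CommRing T]

/-- The action of `W(T)` on `Ŵ^(Fⁿ)(T)` factors through `W_n(T)`. -/
theorem smul_eq_of_truncate_eq {c d : WittVector p T}
    (h : WittVector.truncate n c = WittVector.truncate n d) (a : HatW p n T) :
    c • a = d • a := by
  have h1 : ∀ i < n, (c - d).coeff i = 0 := by
    rw [← WittVector.mem_ker_truncate, RingHom.mem_ker, map_sub, h, sub_self]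
  rw [← sub_eq_zero, ← sub_smul]
  ext1
  change (c - d) * (a : WittVector p T) = 0
  rw [WittVector.eq_iterate_verschiebung h1, WittVector.iterate_verschiebung_mul_left, a.2.2,
    mul_zero]
  exact Function.iterate_fixed (map_zero _) n

/-- The action of `W_n(T)` on `Ŵ^(Fⁿ)(T)`, induced by multiplication in `W(T)`. -/
noncomputable def hatSMul (y : TruncatedWittVector p n T) (a : HatW p n T) : HatW p n T :=
  y.out • a

theorem hatSMul_truncate (c : WittVector p T) (a : HatW p n T) :
    hatSMul (WittVector.truncate n c) a = c • a :=
  smul_eq_of_truncate_eq (TruncatedWittVector.truncateFun_out _) a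

variable {R : Type v} [CommRing R] [Algebra R T]

/-- `Ŵ^(Fⁿ)(T)` is a `W_n(R)`-module for every `R`-algebra `T`. -/
noncomputable instance : Module (TruncatedWittVector p n R) (HatW p n T) :=
  letI _act : Module (TruncatedWittVector p n T) (HatW p n T) :=
    letI : SMul (TruncatedWittVector p n T) (HatW p n T) := ⟨hatSMul⟩
    Function.Surjective.moduleLeft (WittVector.truncate n)
      (WittVector.truncate_surjective p n T) hatSMul_truncate
  Module.compHom (HatW p n T) (truncMap p n (algebraMap R T))

theorem truncate_smul (c : WittVector p R) (a : HatW p n T) :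
    WittVector.truncate n c • a = WittVector.map (algebraMap R T) c • a := by
  change hatSMul (truncMap p n (algebraMap R T) (WittVector.truncate n c)) a = _
  rw [truncMap_truncate, hatSMul_truncate]

theorem coe_truncate_smul (c : WittVector p R) (a : HatW p n T) :
    ((WittVector.truncate n c • a : HatW p n T) : WittVector p T) =
      WittVector.map (algebraMap R T) c * a := by
  rw [truncate_smul]; rfl

theorem IsFormal.map {T' : Type v} [CommRing T'] (f : T →+* T') {x : WittVector p T}
    (hx : IsFormal x) : IsFormal (WittVector.map f x) :=
  ⟨fun i => by rw [WittVector.map_coeff]; exact (hx.1 i).map f,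
    hx.2.subset fun i hi h => hi (by rw [WittVector.map_coeff, h, map_zero])⟩

theorem map_iterate_frobenius {T' : Type u} [CommRing T'] (f : T →+* T') (k : ℕ)
    (x : WittVector p T) : WittVector.map f (WittVector.frobenius^[k] x) =
      WittVector.frobenius^[k] (WittVector.map f x) := by
  induction k with
  | zero => rfl
  | succ k ih =>
    rw [Function.iterate_succ_apply', Function.iterate_succ_apply', ← ih]
    exact WittVector.IsPoly.map (WittVector.frobenius_isPoly p) f _

/-- Functoriality of `Ŵ^(Fⁿ)(T)` in the `R`-algebra `T`. -/
noncomputable def hatMap {T' : Type u} [CommRing T'] [Algebra R T'] (f : T →ₐ[R] T') :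
    HatW p n T →ₗ[TruncatedWittVector p n R] HatW p n T' where
  toFun a := ⟨WittVector.map (f : T →+* T') a, a.2.1.map _, by
    rw [← map_iterate_frobenius, a.2.2, map_zero]⟩
  map_add' a b := by ext1; exact map_add _ _ _
  map_smul' r a := by
    obtain ⟨c, rfl⟩ := WittVector.truncate_surjective p n R r
    ext1
    refine Eq.trans ?_ (coe_truncate_smul c _).symm
    refine (congrArg (WittVector.map (f : T →+* T')) (coe_truncate_smul c a)).trans ?_
    rw [map_mul]
    congr 1
    ext i
    simp [WittVector.map_coeff]

/-- The group `𝔾_a^(Fⁿ)(T) = {t | t ^ pⁿ = 0}`, as an `R`-submodule of the `R`-algebra `T`. -/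
def gaKer (p : ℕ) [Fact p.Prime] (n : ℕ) (R : Type v) [CommRing R] [Algebra (ZMod p) R]
    (T : Type u) [CommRing T] [Algebra R T] : Submodule R T where
  carrier := {t | t ^ p ^ n = 0}
  zero_mem' := by simp [(Fact.out : p.Prime).ne_zero]
  add_mem' := fun {s t} hs ht => by
    have hp := natCast_eq_zero p R T
    rcases subsingleton_or_nontrivial T with h | h
    · exact Subsingleton.elim _ _
    · have : CharP T p := (CharP.charP_iff_prime_eq_zero Fact.out).2 hp
      change (s + t) ^ p ^ n = 0
      rw [add_pow_char_pow, hs, ht, add_zero]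
  smul_mem' := fun r t ht => by
    change (r • t) ^ p ^ n = 0
    rw [smul_pow, ht, smul_zero]

end module

/-! ### Truncated semidisplays -/

/-- If `M` is a module over `W_n(R)` and `N ⊇ I_{n,R} M`, then `M / N` is a module over
`W_n(R) / I_{n,R} = R`. -/
@[reducible]
noncomputable def quotModule (p : ℕ) [Fact p.Prime] (n : ℕ) [NeZero n] {R : Type u} [CommRing R]
    {M : Type v} [AddCommGroup M] [Module (TruncatedWittVector p n R) M]
    (N : Submodule (TruncatedWittVector p n R) M)
    (h : idealI p n R • (⊤ : Submodule (TruncatedWittVector p n R) M) ≤ N) : Module R (M ⧸ N) :=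
  letI : SMul R (M ⧸ N) :=
    ⟨fun r x => WittVector.truncate n (WittVector.teichmuller p r) • x⟩
  Function.Surjective.moduleLeft (truncHead p n R) truncHead_surjective fun a x => by
    obtain ⟨m, rfl⟩ := N.mkQ_surjective x
    change WittVector.truncate n (WittVector.teichmuller p (truncHead p n R a)) • N.mkQ m =
      a • N.mkQ m
    rw [← sub_eq_zero, ← sub_smul, ← map_smul, Submodule.mkQ_apply, Submodule.Quotient.mk_eq_zero]
    refine h (Submodule.smul_mem_smul ?_ trivial)
    rw [idealI, RingHom.mem_ker, map_sub, truncHead_truncate, WittVector.teichmuller_coeff_zero,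
      sub_self]

theorem quotModule_smul (p : ℕ) [Fact p.Prime] (n : ℕ) [NeZero n] {R : Type u} [CommRing R]
    {M : Type v} [AddCommGroup M] [Module (TruncatedWittVector p n R) M]
    (N : Submodule (TruncatedWittVector p n R) M)
    (h : idealI p n R • (⊤ : Submodule (TruncatedWittVector p n R) M) ≤ N)
    (a : TruncatedWittVector p n R) (x : M ⧸ N) :
    letI := quotModule p n N h
    truncHead p n R a • x = a • x := by
  obtain ⟨m, rfl⟩ := N.mkQ_surjective x
  change WittVector.truncate n (WittVector.teichmuller p (truncHead p n R a)) • N.mkQ m =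
    a • N.mkQ m
  rw [← sub_eq_zero, ← sub_smul, ← map_smul, Submodule.mkQ_apply, Submodule.Quotient.mk_eq_zero]
  refine h (Submodule.smul_mem_smul ?_ trivial)
  rw [idealI, RingHom.mem_ker, map_sub, truncHead_truncate, WittVector.teichmuller_coeff_zero,
    sub_self]

/-- An `n`-truncated semidisplay `(P, Q, F, F₁)` over the `𝔽_p`-algebra `R`. -/
structure Semidisplay (p : ℕ) [Fact p.Prime] (n : ℕ) [NeZero n] (R : Type u) [CommRing R]
    [Algebra (ZMod p) R] (P : Type v) [AddCommGroup P] [Module (TruncatedWittVector p n R) P] where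
  /-- `P` is a finitely generated projective `W_n(R)`-module. -/
  finite : Module.Finite (TruncatedWittVector p n R) P
  projective : Module.Projective (TruncatedWittVector p n R) P
  /-- The submodule `Q ⊆ P`. -/
  Q : Submodule (TruncatedWittVector p n R) P
  /-- `P / Q` is a projective module over `W_n(R) / I_{n,R} = R`. -/
  ideal_smul_le : idealI p n R • (⊤ : Submodule (TruncatedWittVector p n R) P) ≤ Q
  projective_quotient : @Module.Projective R _ (P ⧸ Q) _ (quotModule p n Q ideal_smul_le)
  /-- The `F`-semilinear map `F : P → P`. -/
  F : P →+ P
  F_smul : ∀ (a : TruncatedWittVector p n R) (x : P), F (a • x) = truncF a • F x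
  /-- The `F`-semilinear map `F₁ : Q → P / J_{n,R} P`. -/
  F₁ : Q →+ P ⧸ (idealJ p n R • (⊤ : Submodule (TruncatedWittVector p n R) P))
  F₁_smul : ∀ (a : TruncatedWittVector p n R) (y : Q), F₁ (a • y) = truncF a • F₁ y
  /-- `F₁(V(a) x) = a F(x)` in `P / J_{n,R} P`, for `a ∈ W(R)` and `x ∈ P`. -/
  F₁_verschiebung : ∀ (a : WittVector p R) (x : P) (y : Q),
    (y : P) = WittVector.truncate n (WittVector.verschiebung a) • x →
      F₁ y = WittVector.truncate n a • Submodule.Quotient.mk (F x)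
  /-- `F(y) = p F₁(y)` for `y ∈ Q`; here `p : P / J_{n,R} P → P` is induced by `p : P → P`. -/
  F_eq : ∀ (y : Q) (z : P), Submodule.Quotient.mk z = F₁ y → F y = p • z

namespace Semidisplay

variable {p : ℕ} [Fact p.Prime] {n : ℕ} [NeZero n] {R : Type u} [CommRing R] [Algebra (ZMod p) R]
  {P : Type v} [AddCommGroup P] [Module (TruncatedWittVector p n R) P]
  (D : Semidisplay p n R P)

/-- The quotient `P / Q`. -/
def Tangent : Type v := P ⧸ D.Q

noncomputable instance : AddCommGroup D.Tangent := inferInstanceAs (AddCommGroup (P ⧸ D.Q))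

/-- The `R`-module structure on `P / Q`. -/
noncomputable instance : Module R D.Tangent := quotModule p n D.Q D.ideal_smul_le

/-- The projection `P → P / Q`. -/
noncomputable def toTangent : P →+ D.Tangent := D.Q.mkQ.toAddMonoidHom

theorem toTangent_surjective : Function.Surjective D.toTangent := D.Q.mkQ_surjective

theorem toTangent_smul (a : TruncatedWittVector p n R) (x : P) :
    D.toTangent (a • x) = truncHead p n R a • D.toTangent x :=
  (map_smul D.Q.mkQ a x).trans (quotModule_smul p n D.Q D.ideal_smul_le a (D.Q.mkQ x)).symm

theorem toTangent_eq_zero {x : P} : D.toTangent x = 0 ↔ x ∈ D.Q :=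
  Submodule.Quotient.mk_eq_zero D.Q

open TensorProduct

variable (T : Type u) [CommRing T] [Algebra R T]

/-- The group `C⁰(T) = Ŵ^(Fⁿ)(T) ⊗_{W_n(R)} P`. -/
abbrev C0 (_ : Semidisplay p n R P) (T : Type u) [CommRing T] [Algebra R T] : Type (max u v) :=
  HatW p n T ⊗[TruncatedWittVector p n R] P

/-- The `0`-th component map `Ŵ^(Fⁿ)(T) → 𝔾_a^(Fⁿ)(T)`. -/
noncomputable def headGa (p : ℕ) [Fact p.Prime] (n : ℕ) (R : Type u) [CommRing R]
    [Algebra (ZMod p) R] (T : Type u) [CommRing T] [Algebra R T] : HatW p n T →+ gaKer p n R T where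
  toFun a := ⟨(a : WittVector p T).coeff 0, by
    have h := congrArg (fun z => WittVector.coeff z 0) a.2.2
    simp only [coeff_iterate_frobenius (natCast_eq_zero p R T), WittVector.zero_coeff] at h
    exact h⟩
  map_zero' := by ext1; exact WittVector.zero_coeff p T 0
  map_add' a b := by ext1; exact WittVector.add_coeff_zero _ _

theorem headGa_smul (r : TruncatedWittVector p n R) (a : HatW p n T) :
    headGa p n R T (r • a) = truncHead p n R r • headGa p n R T a := by
  obtain ⟨c, rfl⟩ := WittVector.truncate_surjective p n R r
  ext1
  change ((WittVector.truncate n c • a : HatW p n T) : WittVector p T).coeff 0 =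
    truncHead p n R (WittVector.truncate n c) • (a : WittVector p T).coeff 0
  rw [coe_truncate_smul, WittVector.mul_coeff_zero, truncHead_truncate, WittVector.map_coeff,
    Algebra.smul_def]

/-- The map `π : C⁰(T) → 𝔾_a^(Fⁿ)(T) ⊗_R (P / Q)`, `a ⊗ x ↦ a₀ ⊗ x̄`. -/
noncomputable def proj : D.C0 T →+ gaKer p n R T ⊗[R] D.Tangent :=
  liftAddHom
    (AddMonoidHom.mk'
      (fun a => AddMonoidHom.mk' (fun x => headGa p n R T a ⊗ₜ[R] D.toTangent x)
        fun x y => by rw [map_add, tmul_add])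
      fun a b => by ext x; exact (congrArg (· ⊗ₜ[R] _) (map_add _ a b)).trans (add_tmul _ _ _))
    fun r a x => by
      change headGa p n R T (r • a) ⊗ₜ[R] D.toTangent x =
        headGa p n R T a ⊗ₜ[R] D.toTangent (r • x)
      rw [headGa_smul, toTangent_smul, smul_tmul]

theorem proj_tmul (a : HatW p n T) (x : P) :
    D.proj T (a ⊗ₜ x) = headGa p n R T a ⊗ₜ[R] D.toTangent x := rfl

/-- The subgroup `C⁻¹(T) = Ker π` of `C⁰(T)`. -/
noncomputable def Cneg1 : AddSubgroup (D.C0 T) := (D.proj T).ker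


/-- The defining properties of the map `Φ : C⁻¹(T) → C⁰(T)`: `Φ(V(a) ⊗ x) = a ⊗ F(x)` for
`x ∈ P`, and `Φ(a ⊗ y) = F(a) ⊗ F₁(y)` for `y ∈ Q`, where `F(a) ⊗ F₁(y)` is `F(a) ⊗ z` for any
representative `z ∈ P` of `F₁(y)`. -/
structure IsZinkPhi (Φ : D.Cneg1 T →+ D.C0 T) : Prop where
  verschiebung : ∀ (a b : HatW p n T) (x : P) (c : D.Cneg1 T),
    (b : WittVector p T) = WittVector.verschiebung (a : WittVector p T) →
      (c : D.C0 T) = b ⊗ₜ x → Φ c = a ⊗ₜ D.F x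
  frobenius : ∀ (a b : HatW p n T) (y : D.Q) (z : P) (c : D.Cneg1 T),
    (b : WittVector p T) = WittVector.frobenius (a : WittVector p T) →
      Submodule.Quotient.mk z = D.F₁ y → (c : D.C0 T) = a ⊗ₜ (y : P) → Φ c = b ⊗ₜ z

section construction

variable {T}

theorem exists_verschiebung (hp : (p : T) = 0) (b : HatW p n T)
    (hb : (b : WittVector p T).coeff 0 = 0) :
    ∃ a : HatW p n T, (b : WittVector p T) = WittVector.verschiebung (a : WittVector p T) := by
  refine ⟨⟨(b : WittVector p T).shift 1, ⟨fun i => b.2.1.1 _, ?_⟩, ?_⟩, ?_⟩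
  · exact b.2.1.2.preimage (f := fun i => 1 + i) (fun i _ j _ h => by simpa using h)
  · ext i
    have h := congrArg (fun z => WittVector.coeff z (1 + i)) b.2.2
    simp only [coeff_iterate_frobenius hp, WittVector.zero_coeff] at h
    rw [coeff_iterate_frobenius hp, WittVector.shift_coeff, h, WittVector.zero_coeff]
  · ext i
    cases i with
    | zero => rw [hb, WittVector.verschiebung_coeff_zero]
    | succ i => rw [WittVector.verschiebung_coeff_add_one, WittVector.shift_coeff, add_comm]

theorem isFormal_verschiebung {x : WittVector p T} (hx : IsFormal x) :
    IsFormal (WittVector.verschiebung x) := by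
  refine ⟨fun i => ?_, ?_⟩
  · cases i with
    | zero => simp
    | succ i => exact hx.1 i
  · refine ((hx.2.image (· + 1)).insert 0).subset fun i hi => ?_
    cases i with
    | zero => simp
    | succ i => exact Or.inr ⟨i, hi, rfl⟩

/-- The map `V` on `Ŵ^(Fⁿ)(T)`. -/
noncomputable def hatV (hp : (p : T) = 0) (a : HatW p n T) : HatW p n T :=
  ⟨WittVector.verschiebung (a : WittVector p T), isFormal_verschiebung a.2.1, by
    ext i
    rw [coeff_iterate_frobenius hp]
    cases i with
    | zero => simp [(Fact.out : p.Prime).ne_zero]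
    | succ i =>
      rw [WittVector.verschiebung_coeff_add_one, ← coeff_iterate_frobenius hp, a.2.2]
      simp⟩

/-- The map `F` on `Ŵ^(Fⁿ)(T)`. -/
noncomputable def hatF (hp : (p : T) = 0) (a : HatW p n T) : HatW p n T :=
  ⟨WittVector.frobenius (a : WittVector p T),
    ⟨fun i => by
      rw [coeff_frobenius hp]
      exact (a.2.1.1 i).pow_of_pos (Fact.out : p.Prime).ne_zero,
    a.2.1.2.subset fun i hi h => hi (by
      rw [coeff_frobenius hp, h, zero_pow (Fact.out : p.Prime).ne_zero])⟩, by
    rw [← Function.iterate_succ_apply, Function.iterate_succ_apply', a.2.2, map_zero]⟩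

/-- The Teichmüller representative of an element of `𝔾_a^(Fⁿ)(T)`. -/
noncomputable def hatTeich (hp : (p : T) = 0) (t : gaKer p n R T) : HatW p n T :=
  ⟨WittVector.teichmuller p (t : T),
    ⟨fun i => by
      cases i with
      | zero => exact ⟨_, t.2⟩
      | succ i => rw [WittVector.teichmuller_coeff_pos p _ _ i.succ_pos]; exact IsNilpotent.zero,
    (Set.finite_singleton 0).subset fun i hi => by
      cases i with
      | zero => rfl
      | succ i => exact absurd (WittVector.teichmuller_coeff_pos p _ _ i.succ_pos) hi⟩, by
    ext i
    rw [coeff_iterate_frobenius hp]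
    cases i with
    | zero => exact Eq.trans (show (t : T) ^ p ^ n = 0 from t.2) (WittVector.zero_coeff p T 0).symm
    | succ i =>
      rw [WittVector.teichmuller_coeff_pos p _ _ i.succ_pos, WittVector.zero_coeff,
        zero_pow (pow_ne_zero _ (Fact.out : p.Prime).ne_zero)]⟩

variable (T) in
/-- Generators of `C⁻¹(T)`. -/
def gens : Set (D.C0 T) :=
  {c | (∃ (a b : HatW p n T) (x : P),
      (b : WittVector p T) = WittVector.verschiebung (a : WittVector p T) ∧ c = b ⊗ₜ x) ∨
    ∃ (a : HatW p n T) (y : D.Q), c = a ⊗ₜ (y : P)}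

theorem tmul_mem_closure_of_coeff (b : HatW p n T) (hb : (b : WittVector p T).coeff 0 = 0)
    (x : P) : (b ⊗ₜ x : D.C0 T) ∈ AddSubgroup.closure (D.gens T) := by
  obtain ⟨a, ha⟩ := exists_verschiebung (natCast_eq_zero p R T) b hb
  exact AddSubgroup.subset_closure (Or.inl ⟨a, b, x, ha, rfl⟩)

theorem tmul_mem_closure_of_mem (a : HatW p n T) (y : P) (hy : y ∈ D.Q) :
    (a ⊗ₜ y : D.C0 T) ∈ AddSubgroup.closure (D.gens T) :=
  AddSubgroup.subset_closure (Or.inr ⟨a, ⟨y, hy⟩, rfl⟩)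

theorem gens_subset : D.gens T ⊆ D.Cneg1 T := by
  rintro c (⟨a, b, x, h, rfl⟩ | ⟨a, y, rfl⟩)
  · change D.proj T _ = 0
    have : headGa p n R T b = 0 := by
      ext1
      change (b : WittVector p T).coeff 0 = 0
      rw [h, WittVector.verschiebung_coeff_zero]
    rw [proj_tmul, this, zero_tmul]
  · change D.proj T _ = 0
    rw [proj_tmul, D.toTangent_eq_zero.2 y.2, tmul_zero]

/-- The class of `[t] ⊗ x`, modulo the subgroup generated by `gens`. -/
noncomputable def teichClass (t : gaKer p n R T) (x : P) :
    D.C0 T ⧸ AddSubgroup.closure (D.gens T) :=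
  QuotientAddGroup.mk (hatTeich (natCast_eq_zero p R T) t ⊗ₜ x)

theorem teichClass_eq (a : HatW p n T) (t : gaKer p n R T)
    (h : (a : WittVector p T).coeff 0 = t) (x y : P) (hxy : x - y ∈ D.Q) :
    (QuotientAddGroup.mk (a ⊗ₜ x : D.C0 T) : D.C0 T ⧸ AddSubgroup.closure (D.gens T)) =
      D.teichClass t y := by
  rw [teichClass, QuotientAddGroup.eq_iff_sub_mem]
  have : (a ⊗ₜ x : D.C0 T) - hatTeich (natCast_eq_zero p R T) t ⊗ₜ y =
      (a - hatTeich (natCast_eq_zero p R T) t) ⊗ₜ x +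
        hatTeich (natCast_eq_zero p R T) t ⊗ₜ (x - y) := by
    rw [sub_tmul, tmul_sub]; abel
  rw [this]
  refine add_mem (D.tmul_mem_closure_of_coeff _ ?_ x) (D.tmul_mem_closure_of_mem _ _ hxy)
  have h2 := map_sub (WittVector.constantCoeff (p := p) (R := T)) (a : WittVector p T)
    (hatTeich (natCast_eq_zero p R T) t : HatW p n T)
  refine h2.trans ?_
  change (a : WittVector p T).coeff 0 - (WittVector.teichmuller p (t : T)).coeff 0 = 0
  rw [h, WittVector.teichmuller_coeff_zero, sub_self]

/-- A section of `P → P / Q`. -/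
noncomputable def sect : D.Tangent → P := Function.surjInv D.toTangent_surjective

theorem sub_sect_mem (x : P) (b : D.Tangent) (h : D.toTangent x = b) : x - D.sect b ∈ D.Q := by
  rw [← D.toTangent_eq_zero, map_sub, h, sect, Function.surjInv_eq D.toTangent_surjective, sub_self]

theorem toTangent_sect (b : D.Tangent) : D.toTangent (D.sect b) = b := Function.surjInv_eq _ _

theorem ker_le_closure (c : D.C0 T) (hc : D.proj T c = 0) :
    c ∈ AddSubgroup.closure (D.gens T) := by
  have hp := natCast_eq_zero p R T
  have hteich : ∀ t : gaKer p n R T,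
      ((hatTeich hp t : HatW p n T) : WittVector p T).coeff 0 = t := fun t => rfl
  let ψ : gaKer p n R T ⊗[R] D.Tangent →+ D.C0 T ⧸ AddSubgroup.closure (D.gens T) :=
    liftAddHom
      (AddMonoidHom.mk'
        (fun t => AddMonoidHom.mk' (fun b => D.teichClass t (D.sect b)) fun b b' => by
          rw [← D.teichClass_eq (hatTeich hp t) t (hteich t) (D.sect b + D.sect b')
            (D.sect (b + b')) (D.sub_sect_mem _ _ (by
              rw [map_add, toTangent_sect, toTangent_sect]))]
          rw [tmul_add]
          rfl)
        fun t t' => by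
          ext b
          change D.teichClass (t + t') (D.sect b) =
            D.teichClass t (D.sect b) + D.teichClass t' (D.sect b)
          rw [← D.teichClass_eq (hatTeich hp t + hatTeich hp t') (t + t')
            (by exact WittVector.add_coeff_zero _ _) (D.sect b) (D.sect b) (by simp)]
          rw [add_tmul]
          rfl)
      fun r t b => by
        obtain ⟨s, rfl⟩ := truncHead_surjective (p := p) (n := n) r
        change D.teichClass (truncHead p n R s • t) (D.sect b) =
          D.teichClass t (D.sect (truncHead p n R s • b))
        rw [← D.teichClass_eq (s • hatTeich hp t) (truncHead p n R s • t)
            (congrArg Subtype.val (headGa_smul T s (hatTeich hp t))) (D.sect b) (D.sect b)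
            (by simp),
          ← D.teichClass_eq (hatTeich hp t) t (hteich t) (s • D.sect b)
            (D.sect (truncHead p n R s • b)) (D.sub_sect_mem _ _ (by
              rw [toTangent_smul, toTangent_sect])), smul_tmul]
  have hψ : ∀ d : D.C0 T, ψ (D.proj T d) = QuotientAddGroup.mk d := fun d => by
    induction d using TensorProduct.induction_on with
    | zero => rw [map_zero, map_zero]; rfl
    | add d d' h h' => rw [map_add, map_add, h, h']; rfl
    | tmul a x =>
      exact (D.teichClass_eq a (headGa p n R T a) rfl x _ (D.sub_sect_mem x _ rfl)).symm
  rw [← QuotientAddGroup.eq_zero_iff, ← hψ, hc, map_zero]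

theorem hatF_add (hp : (p : T) = 0) (a b : HatW p n T) : hatF hp (a + b) = hatF hp a + hatF hp b :=
  Subtype.ext (map_add _ _ _)

theorem map_frobenius (f : R →+* T) (w : WittVector p R) :
    WittVector.map f (WittVector.frobenius w) = WittVector.frobenius (WittVector.map f w) :=
  map_iterate_frobenius f 1 w

theorem hatF_smul (hp : (p : T) = 0) (r : TruncatedWittVector p n R) (a : HatW p n T) :
    hatF hp (r • a) = truncF r • hatF hp a := by
  obtain ⟨c, rfl⟩ := WittVector.truncate_surjective p n R r
  have hR : (p : R) = 0 := natCast_eq_zero p R R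
  refine Subtype.ext ?_
  rw [truncF_truncate hR, coe_truncate_smul]
  refine (congrArg WittVector.frobenius (coe_truncate_smul c a)).trans ?_
  rw [map_mul, map_frobenius]
  rfl

/-- `F(a)` is killed by `J_{n,R}`. -/
theorem smul_hatF (hp : (p : T) = 0) {j : TruncatedWittVector p n R} (hj : j ∈ idealJ p n R)
    (a : HatW p n T) : j • hatF hp a = 0 := by
  obtain ⟨c, rfl⟩ := WittVector.truncate_surjective p n R j
  rw [idealJ, RingHom.mem_ker, truncRestrict, TruncatedWittVector.truncate_wittVector_truncate,
    ← RingHom.mem_ker, WittVector.mem_ker_truncate] at hj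
  refine Subtype.ext ?_
  rw [coe_truncate_smul]
  have h1 : ∀ i < n - 1, (WittVector.map (algebraMap R T) c).coeff i = 0 := fun i hi => by
    rw [WittVector.map_coeff, hj i hi, map_zero]
  change WittVector.map (algebraMap R T) c * WittVector.frobenius (a : WittVector p T) = 0
  rw [WittVector.eq_iterate_verschiebung h1, WittVector.iterate_verschiebung_mul_left,
    ← Function.iterate_succ_apply, Nat.succ_eq_add_one, Nat.sub_add_cancel (NeZero.one_le), a.2.2,
    mul_zero]
  exact Function.iterate_fixed (map_zero _) _

theorem hatF_tmul_eq (hp : (p : T) = 0) (a : HatW p n T) {z z' : P}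
    (h : (Submodule.Quotient.mk z : P ⧸ (idealJ p n R • (⊤ : Submodule
      (TruncatedWittVector p n R) P))) = Submodule.Quotient.mk z') :
    (hatF hp a ⊗ₜ z : HatW p n T ⊗[TruncatedWittVector p n R] P) = hatF hp a ⊗ₜ z' := by
  rw [Submodule.Quotient.eq] at h
  rw [← sub_eq_zero, ← tmul_sub]
  refine Submodule.smul_induction_on h (fun j hj x _ => ?_) fun x y hx hy => ?_
  · rw [← smul_tmul, smul_hatF hp hj, zero_tmul]
  · rw [tmul_add, hx, hy, add_zero]

/-- Representatives of `F₁(y)`. -/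
noncomputable def liftF₁ (y : D.Q) : P := Function.surjInv (Submodule.mkQ_surjective _) (D.F₁ y)

theorem mk_liftF₁ (y : D.Q) : Submodule.Quotient.mk (D.liftF₁ y) = D.F₁ y :=
  Function.surjInv_eq (Submodule.mkQ_surjective _) _

/-- The map `Ŵ^(Fⁿ)(T) ⊗ Q → C⁰(T)`, `a ⊗ y ↦ F(a) ⊗ F₁(y)`. -/
noncomputable def phi₂ (hp : (p : T) = 0) :
    HatW p n T ⊗[TruncatedWittVector p n R] D.Q →+ D.C0 T :=
  liftAddHom
    (AddMonoidHom.mk'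
      (fun a => AddMonoidHom.mk' (fun y => hatF hp a ⊗ₜ D.liftF₁ y) fun y y' => by
        rw [← tmul_add]
        apply hatF_tmul_eq
        rw [mk_liftF₁, map_add, Submodule.Quotient.mk_add, mk_liftF₁, mk_liftF₁])
      fun a b => by
        ext y
        exact (congrArg (· ⊗ₜ _) (hatF_add hp a b)).trans (add_tmul _ _ _))
    fun r a y => by
      change hatF hp (r • a) ⊗ₜ D.liftF₁ y = hatF hp a ⊗ₜ D.liftF₁ (r • y)
      rw [hatF_smul, smul_tmul]
      apply hatF_tmul_eq
      rw [mk_liftF₁, Submodule.Quotient.mk_smul, mk_liftF₁, F₁_smul]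

/-- The kernel of the `0`-th component map on `Ŵ^(Fⁿ)(T)`. -/
def hatKer (p : ℕ) [Fact p.Prime] (n : ℕ) (R : Type u) [CommRing R] (T : Type u)
    [CommRing T] [Algebra R T] : Submodule (TruncatedWittVector p n R) (HatW p n T) where
  carrier := {a | (a : WittVector p T).coeff 0 = 0}
  zero_mem' := WittVector.zero_coeff p T 0
  add_mem' := fun {a b} ha hb => by
    refine (WittVector.add_coeff_zero (a : WittVector p T) b).trans ?_
    rw [show (a : WittVector p T).coeff 0 = 0 from ha,
      show (b : WittVector p T).coeff 0 = 0 from hb, add_zero]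
  smul_mem' := fun r a ha => by
    obtain ⟨c, rfl⟩ := WittVector.truncate_surjective p n R r
    refine (congrArg (fun z => WittVector.coeff z 0) (coe_truncate_smul c a)).trans ?_
    rw [WittVector.mul_coeff_zero, show (a : WittVector p T).coeff 0 = 0 from ha, mul_zero]

/-- The inverse of `V`. -/
noncomputable def vInv (hp : (p : T) = 0) (b : hatKer p n R T) : HatW p n T :=
  (exists_verschiebung hp b.1 b.2).choose

theorem verschiebung_vInv (hp : (p : T) = 0) (b : hatKer p n R T) :
    WittVector.verschiebung (vInv hp b : WittVector p T) = (b : HatW p n T) :=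
  (exists_verschiebung hp b.1 b.2).choose_spec.symm

theorem vInv_eq (hp : (p : T) = 0) (b : hatKer p n R T) (a : HatW p n T)
    (h : ((b : HatW p n T) : WittVector p T) = WittVector.verschiebung (a : WittVector p T)) :
    vInv hp b = a :=
  Subtype.ext (WittVector.verschiebung_injective p T (by rw [verschiebung_vInv, h]))

theorem vInv_add (hp : (p : T) = 0) (b b' : hatKer p n R T) :
    vInv hp (b + b') = vInv hp b + vInv hp b' := by
  apply vInv_eq
  refine Eq.trans ?_ (map_add _ _ _).symm
  rw [verschiebung_vInv, verschiebung_vInv]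
  rfl

theorem vInv_smul (hp : (p : T) = 0) (r : TruncatedWittVector p n R) (b : hatKer p n R T) :
    vInv hp (r • b) = truncF r • vInv hp b := by
  obtain ⟨c, rfl⟩ := WittVector.truncate_surjective p n R r
  have hR : (p : R) = 0 := natCast_eq_zero p R R
  apply vInv_eq
  rw [truncF_truncate hR, coe_truncate_smul, map_frobenius, mul_comm,
    WittVector.verschiebung_mul_frobenius, verschiebung_vInv, mul_comm]
  exact coe_truncate_smul c (b : HatW p n T)

/-- The map `V(a) ⊗ x ↦ a ⊗ F(x)`. -/
noncomputable def phi₁ (hp : (p : T) = 0) :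
    hatKer p n R T ⊗[TruncatedWittVector p n R] P →+ D.C0 T :=
  liftAddHom
    (AddMonoidHom.mk'
      (fun b => AddMonoidHom.mk' (fun x => vInv hp b ⊗ₜ D.F x) fun x x' => by
        rw [map_add, tmul_add])
      fun b b' => by
        ext x
        exact (congrArg (· ⊗ₜ _) (vInv_add hp b b')).trans (add_tmul _ _ _))
    fun r b x => by
      change vInv hp (r • b) ⊗ₜ D.F x = vInv hp b ⊗ₜ D.F (r • x)
      rw [vInv_smul, F_smul, smul_tmul]

/-- There is an endomorphism of `P` that is the identity modulo `Q` and maps `Q` to `I_{n,R} P`. -/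
theorem exists_endo : ∃ e : P →ₗ[TruncatedWittVector p n R] P, (∀ x, x - e x ∈ D.Q) ∧
    ∀ y ∈ D.Q, e y ∈ idealI p n R • (⊤ : Submodule (TruncatedWittVector p n R) P) := by
  have := D.projective
  let mQ : Module R (P ⧸ D.Q) := quotModule p n D.Q D.ideal_smul_le
  let mI : Module R (P ⧸ (idealI p n R • (⊤ : Submodule (TruncatedWittVector p n R) P))) :=
    quotModule p n _ le_rfl
  have hQ : ∀ (a : TruncatedWittVector p n R) (x : P ⧸ D.Q), truncHead p n R a • x = a • x :=
    quotModule_smul p n D.Q D.ideal_smul_le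
  have hI : ∀ (a : TruncatedWittVector p n R)
      (x : P ⧸ (idealI p n R • (⊤ : Submodule (TruncatedWittVector p n R) P))),
        truncHead p n R a • x = a • x :=
    quotModule_smul p n _ le_rfl
  have hproj : Module.Projective R (P ⧸ D.Q) := D.projective_quotient
  let f₀ := Submodule.factor D.ideal_smul_le
  let f : (P ⧸ (idealI p n R • (⊤ : Submodule (TruncatedWittVector p n R) P))) →ₗ[R] P ⧸ D.Q :=
    { toFun := f₀
      map_add' := map_add f₀
      map_smul' := fun r x => by
        obtain ⟨a, rfl⟩ := truncHead_surjective (p := p) (n := n) r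
        rw [hI, RingHom.id_apply, hQ, map_smul] }
  have hf : Function.Surjective f := Submodule.factor_surjective D.ideal_smul_le
  obtain ⟨s, hs⟩ := Module.projective_lifting_property f LinearMap.id hf
  let s₀ : (P ⧸ D.Q) →ₗ[TruncatedWittVector p n R]
      (P ⧸ (idealI p n R • (⊤ : Submodule (TruncatedWittVector p n R) P))) :=
    { toFun := s
      map_add' := map_add s
      map_smul' := fun a x => by rw [← hQ, map_smul, hI, RingHom.id_apply] }
  obtain ⟨e, he⟩ := Module.projective_lifting_property
    (idealI p n R • (⊤ : Submodule (TruncatedWittVector p n R) P)).mkQ (s₀ ∘ₗ D.Q.mkQ)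
    (Submodule.mkQ_surjective _)
  have he' : ∀ x, (Submodule.Quotient.mk (e x) :
      P ⧸ (idealI p n R • (⊤ : Submodule (TruncatedWittVector p n R) P))) =
      s (Submodule.Quotient.mk x) := fun x => LinearMap.congr_fun he x
  refine ⟨e, fun x => ?_, fun y hy => ?_⟩
  · have h1 := LinearMap.congr_fun hs (Submodule.Quotient.mk x)
    rw [LinearMap.comp_apply, ← he'] at h1
    exact (Submodule.Quotient.eq D.Q).1 h1.symm
  · rw [← Submodule.Quotient.mk_eq_zero, he', (Submodule.Quotient.mk_eq_zero D.Q).2 hy, map_zero]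

theorem exists_preimage (hp : (p : T) = 0) (a : HatW p n T) (m : P)
    (hm : m ∈ idealI p n R • (⊤ : Submodule (TruncatedWittVector p n R) P)) :
    ∃ u : hatKer p n R T ⊗[TruncatedWittVector p n R] P,
      LinearMap.rTensor P (hatKer p n R T).subtype u = a ⊗ₜ m ∧
        ∀ (z : P) (q : D.Q), (q : P) = m → Submodule.Quotient.mk z = D.F₁ q →
          D.phi₁ hp u = hatF hp a ⊗ₜ z := by
  suffices H : m ∈ D.Q ∧ ∃ u : hatKer p n R T ⊗[TruncatedWittVector p n R] P,
      LinearMap.rTensor P (hatKer p n R T).subtype u = a ⊗ₜ m ∧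
        ∀ (z : P) (q : D.Q), (q : P) = m → Submodule.Quotient.mk z = D.F₁ q →
          D.phi₁ hp u = hatF hp a ⊗ₜ z from H.2
  refine Submodule.smul_induction_on hm (fun i hi x hx => ?_) fun m m' h h' => ?_
  · refine ⟨D.ideal_smul_le (Submodule.smul_mem_smul hi hx), ?_⟩
    obtain ⟨c, rfl⟩ := WittVector.truncate_surjective p n R i
    rw [idealI, RingHom.mem_ker, truncHead_truncate] at hi
    obtain ⟨w, rfl⟩ : ∃ w, c = WittVector.verschiebung w :=
      ⟨c.shift 1, by
        ext j
        cases j with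
        | zero => rw [hi, WittVector.verschiebung_coeff_zero]
        | succ j =>
          rw [WittVector.verschiebung_coeff_add_one, WittVector.shift_coeff, add_comm]⟩
    have hb : WittVector.truncate n (WittVector.verschiebung w) • a ∈ hatKer p n R T := by
      refine (congrArg (fun z => WittVector.coeff z 0) (coe_truncate_smul _ a)).trans ?_
      rw [WittVector.mul_coeff_zero, WittVector.map_coeff, WittVector.verschiebung_coeff_zero,
        map_zero, zero_mul]
    refine ⟨⟨_, hb⟩ ⊗ₜ x, ?_, fun z q hq hz => ?_⟩
    · rw [LinearMap.rTensor_tmul, Submodule.subtype_apply, smul_tmul]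
    · have h1 : vInv hp (⟨_, hb⟩ : hatKer p n R T) = WittVector.truncate n w • hatF hp a := by
        apply vInv_eq
        rw [coe_truncate_smul, coe_truncate_smul, WittVector.map_verschiebung]
        exact (WittVector.verschiebung_mul_frobenius _ _).symm
      change vInv hp (⟨_, hb⟩ : hatKer p n R T) ⊗ₜ D.F x = _
      rw [h1, smul_tmul]
      apply hatF_tmul_eq
      rw [hz, D.F₁_verschiebung w x q hq, Submodule.Quotient.mk_smul]
  · obtain ⟨hm, u, hu, hu'⟩ := h
    obtain ⟨hm', v, hv, hv'⟩ := h'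
    refine ⟨add_mem hm hm', u + v, ?_, fun z q hq hz => ?_⟩
    · rw [map_add, hu, hv, tmul_add]
    · rw [map_add, hu' (D.liftF₁ ⟨m, hm⟩) ⟨m, hm⟩ rfl (D.mk_liftF₁ _),
        hv' (D.liftF₁ ⟨m', hm'⟩) ⟨m', hm'⟩ rfl (D.mk_liftF₁ _), ← tmul_add]
      apply hatF_tmul_eq
      rw [Submodule.Quotient.mk_add, mk_liftF₁, mk_liftF₁, hz, ← map_add]
      congr 1
      exact Subtype.ext hq.symm

theorem IsZinkPhi.unique {Ψ Ψ' : D.Cneg1 T →+ D.C0 T} (h : D.IsZinkPhi T Ψ)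
    (h' : D.IsZinkPhi T Ψ') : Ψ = Ψ' := by
  have hp := natCast_eq_zero p R T
  have hle : AddSubgroup.closure (D.gens T) ≤ D.Cneg1 T :=
    (AddSubgroup.closure_le _).2 D.gens_subset
  have key : ∀ c (hc : c ∈ AddSubgroup.closure (D.gens T)),
      Ψ ⟨c, hle hc⟩ = Ψ' ⟨c, hle hc⟩ := fun c hc => by
    induction hc using AddSubgroup.closure_induction with
    | mem c hc =>
      rcases hc with ⟨a, b, x, hab, hc⟩ | ⟨a, y, hc⟩
      · rw [h.verschiebung a b x _ hab hc, h'.verschiebung a b x _ hab hc]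
      · rw [h.frobenius a (hatF hp a) y _ _ rfl (D.mk_liftF₁ y) hc,
          h'.frobenius a (hatF hp a) y _ _ rfl (D.mk_liftF₁ y) hc]
    | zero => exact (map_zero Ψ).trans (map_zero Ψ').symm
    | add x y hx hy h₁ h₂ =>
      have e₁ := map_add Ψ ⟨x, hle hx⟩ ⟨y, hle hy⟩
      have e₂ := map_add Ψ' ⟨x, hle hx⟩ ⟨y, hle hy⟩
      rw [h₁, h₂] at e₁
      exact e₁.trans e₂.symm
    | neg x hx h₁ =>
      have e₁ := map_neg Ψ ⟨x, hle hx⟩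
      have e₂ := map_neg Ψ' ⟨x, hle hx⟩
      rw [h₁] at e₁
      exact e₁.trans e₂.symm
  ext ⟨c, hc⟩
  exact key c (D.ker_le_closure c hc)

/-- The map `Φ` exists and is uniquely determined by its defining properties. -/
theorem existsUnique_phi (T : Type u) [CommRing T] [Algebra R T] :
    ∃! Φ : D.Cneg1 T →+ D.C0 T, D.IsZinkPhi T Φ := by
  have hp := natCast_eq_zero p R T
  have := D.projective
  obtain ⟨e, he, heQ⟩ := D.exists_endo
  let d : P →ₗ[TruncatedWittVector p n R] D.Q :=
    (LinearMap.id - e).codRestrict D.Q fun x => he x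
  let ι := LinearMap.rTensor P (hatKer p n R T).subtype
  let ι' : hatKer p n R T ⊗[TruncatedWittVector p n R] P →+ D.C0 T := ι.toAddMonoidHom
  let rng : AddSubgroup (D.C0 T) :=
    AddMonoidHom.range (G := hatKer p n R T ⊗[TruncatedWittVector p n R] P) ι'
  have hι : Function.Injective ι :=
    Module.Flat.rTensor_preserves_injective_linearMap _ (Submodule.injective_subtype _)
  have hV : ∀ (a b : HatW p n T) (x : P),
      (b : WittVector p T) = WittVector.verschiebung (a : WittVector p T) →
      ∃ u, ι u = b ⊗ₜ e x ∧ D.phi₁ hp u = a ⊗ₜ D.F (e x) := fun a b x h => by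
    have hb : b ∈ hatKer p n R T := by
      change (b : WittVector p T).coeff 0 = 0
      rw [h, WittVector.verschiebung_coeff_zero]
    refine ⟨(⟨b, hb⟩ : hatKer p n R T) ⊗ₜ e x, rfl, ?_⟩
    change vInv hp (⟨b, hb⟩ : hatKer p n R T) ⊗ₜ D.F (e x) = _
    rw [vInv_eq hp _ a h]
  have hmem : ∀ c : D.Cneg1 T, LinearMap.lTensor (HatW p n T) e c ∈ rng := by
    rintro ⟨c, hc⟩
    refine AddSubgroup.closure_induction (p := fun c _ =>
      LinearMap.lTensor (HatW p n T) e c ∈ rng) ?_ ?_ ?_ ?_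
      (D.ker_le_closure c hc)
    · rintro c (⟨a, b, x, h, rfl⟩ | ⟨a, y, rfl⟩)
      · obtain ⟨u, hu, -⟩ := hV a b x h
        exact ⟨u, hu⟩
      · obtain ⟨u, hu, -⟩ := D.exists_preimage hp a (e y) (heQ y y.2)
        exact ⟨u, hu⟩
    · rw [map_zero]; exact zero_mem _
    · intro c c' _ _ h h'; rw [map_add]; exact add_mem h h'
    · intro c _ h; rw [map_neg]; exact neg_mem h
  let κ : D.Cneg1 T →+ rng :=
    ((LinearMap.lTensor (HatW p n T) e).toAddMonoidHom.comp (D.Cneg1 T).subtype).codRestrict _ hmem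
  let τ := (AddMonoidHom.ofInjective (G := hatKer p n R T ⊗[TruncatedWittVector p n R] P) (f := ι') hι).symm
  have hτ : ∀ (c : D.Cneg1 T) u, ι u = LinearMap.lTensor (HatW p n T) e c → τ (κ c) = u := by
    intro c u h
    rw [AddEquiv.symm_apply_eq]
    exact Subtype.ext h.symm
  refine existsUnique_of_exists_of_unique ?_ fun Ψ Ψ' h h' => h.unique D h'
  refine ⟨((D.phi₂ hp).comp ((LinearMap.lTensor (HatW p n T) d).toAddMonoidHom.comp
    (D.Cneg1 T).subtype)) + ((D.phi₁ hp).comp (τ.toAddMonoidHom.comp κ)), ⟨?_, ?_⟩⟩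
  · intro a b x c hab hc
    obtain ⟨u, hu, hu'⟩ := hV a b x hab
    have h1 : τ (κ c) = u := hτ c u (by rw [hu, hc]; rfl)
    change D.phi₂ hp (LinearMap.lTensor (HatW p n T) d c) + D.phi₁ hp (τ (κ c)) = _
    rw [h1, hu', hc]
    change hatF hp b ⊗ₜ D.liftF₁ (d x) + _ = _
    have h2 : hatF hp b = p • a := by
      refine Subtype.ext ?_
      change WittVector.frobenius (b : WittVector p T) = _
      rw [hab, WittVector.frobenius_verschiebung, mul_comm, ← nsmul_eq_mul]
      rfl
    have h3 := D.F_eq (d x) (D.liftF₁ (d x)) (D.mk_liftF₁ _)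
    have h4 : ((d x : D.Q) : P) = x - e x := rfl
    rw [h2, ← Nat.cast_smul_eq_nsmul (TruncatedWittVector p n R), smul_tmul,
      Nat.cast_smul_eq_nsmul, ← h3, h4, ← tmul_add, map_sub, sub_add_cancel]
  · intro a b y z c hab hz hc
    obtain ⟨u, hu, hu'⟩ := D.exists_preimage hp a (e y) (heQ y y.2)
    have h1 : τ (κ c) = u := hτ c u (by rw [hu, hc]; rfl)
    have hey : e y ∈ D.Q := D.ideal_smul_le (heQ y y.2)
    change D.phi₂ hp (LinearMap.lTensor (HatW p n T) d c) + D.phi₁ hp (τ (κ c)) = _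
    rw [h1, hu' (D.liftF₁ ⟨e y, hey⟩) ⟨e y, hey⟩ rfl (D.mk_liftF₁ _), hc]
    change hatF hp a ⊗ₜ D.liftF₁ (d y) + _ = _
    have hb : b = hatF hp a := Subtype.ext hab
    rw [← tmul_add, hb]
    apply hatF_tmul_eq
    rw [Submodule.Quotient.mk_add, mk_liftF₁, mk_liftF₁, hz, ← map_add]
    congr 1
    refine Subtype.ext ?_
    change (y : P) - e y + e y = y
    exact sub_add_cancel _ _

end construction

/-- The map `Φ : C⁻¹(T) → C⁰(T)`. -/
noncomputable def phi (T : Type u) [CommRing T] [Algebra R T] : D.Cneg1 T →+ D.C0 T :=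
  (D.existsUnique_phi T).choose

theorem isZinkPhi_phi (T : Type u) [CommRing T] [Algebra R T] : D.IsZinkPhi T (D.phi T) :=
  (D.existsUnique_phi T).choose_spec.1

/-- The map `1 - Φ : C⁻¹(T) → C⁰(T)`. -/
noncomputable def oneSubPhi (T : Type u) [CommRing T] [Algebra R T] : D.Cneg1 T →+ D.C0 T :=
  (D.Cneg1 T).subtype - D.phi T

/-- The group `𝔷(T) = Coker(1 - Φ : C⁻¹(T) → C⁰(T))`. -/
abbrev Zink (T : Type u) [CommRing T] [Algebra R T] : Type (max u v) :=
  D.C0 T ⧸ (D.oneSubPhi T).range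

/-- Functoriality of `C⁰(T)` in `T`. -/
noncomputable def C0map {T T' : Type u} [CommRing T] [Algebra R T] [CommRing T'] [Algebra R T']
    (f : T →ₐ[R] T') : D.C0 T →+ D.C0 T' :=
  (LinearMap.rTensor P (hatMap (n := n) f)).toAddMonoidHom

theorem C0map_tmul {T T' : Type u} [CommRing T] [Algebra R T] [CommRing T'] [Algebra R T']
    (f : T →ₐ[R] T') (a : HatW p n T) (x : P) : D.C0map f (a ⊗ₜ x) = hatMap f a ⊗ₜ x := rfl

theorem phi_natural {T T' : Type u} [CommRing T] [Algebra R T] [CommRing T'] [Algebra R T']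
    (f : T →ₐ[R] T') (c : D.Cneg1 T) : ∃ c' : D.Cneg1 T', (c' : D.C0 T') = D.C0map f c ∧
      D.phi T' c' = D.C0map f (D.phi T c) := by
  have hp := natCast_eq_zero p R T
  have hp' := natCast_eq_zero p R T'
  have hle : AddSubgroup.closure (D.gens T) ≤ D.Cneg1 T :=
    (AddSubgroup.closure_le _).2 D.gens_subset
  suffices key : ∀ (c : D.C0 T) (hc : c ∈ AddSubgroup.closure (D.gens T)),
      ∃ c' : D.Cneg1 T', (c' : D.C0 T') = D.C0map f c ∧
        D.phi T' c' = D.C0map f (D.phi T ⟨c, hle hc⟩) from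
    key c (D.ker_le_closure c.1 c.2)
  intro c hc
  induction hc using AddSubgroup.closure_induction with
  | mem c hc =>
    rcases hc with ⟨a, b, x, hab, hc⟩ | ⟨a, y, hc⟩
    · have h1 : ((hatMap f b : HatW p n T') : WittVector p T') =
          WittVector.verschiebung ((hatMap f a : HatW p n T') : WittVector p T') := by
        change WittVector.map (f : T →+* T') (b : WittVector p T) = _
        rw [hab, WittVector.map_verschiebung]
        rfl
      have h3 : D.C0map f c = hatMap f b ⊗ₜ x := by rw [hc, C0map_tmul]
      have h2 : D.C0map f c ∈ D.gens T' := Or.inl ⟨_, _, x, h1, h3⟩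
      refine ⟨⟨_, D.gens_subset h2⟩, rfl, ?_⟩
      rw [(D.isZinkPhi_phi T').verschiebung _ _ x _ h1 h3,
        (D.isZinkPhi_phi T).verschiebung a b x _ hab hc, C0map_tmul]
    · have h1 : ((hatMap f (hatF hp a) : HatW p n T') : WittVector p T') =
          WittVector.frobenius ((hatMap f a : HatW p n T') : WittVector p T') :=
        map_iterate_frobenius (f : T →+* T') 1 (a : WittVector p T)
      have h3 : D.C0map f c = hatMap f a ⊗ₜ (y : P) := by rw [hc, C0map_tmul]
      have h2 : D.C0map f c ∈ D.gens T' := Or.inr ⟨hatMap f a, y, h3⟩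
      refine ⟨⟨_, D.gens_subset h2⟩, rfl, ?_⟩
      rw [(D.isZinkPhi_phi T').frobenius _ _ y _ _ h1 (D.mk_liftF₁ y) h3,
        (D.isZinkPhi_phi T).frobenius a (hatF hp a) y _ _ rfl (D.mk_liftF₁ y) hc, C0map_tmul]
  | zero =>
    refine ⟨0, (map_zero _).symm, ?_⟩
    rw [map_zero, show (⟨0, hle (zero_mem _)⟩ : D.Cneg1 T) = 0 from rfl, map_zero, map_zero]
  | add x y hx hy h₁ h₂ =>
    obtain ⟨x', hx', hx''⟩ := h₁
    obtain ⟨y', hy', hy''⟩ := h₂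
    refine ⟨x' + y', ?_, ?_⟩
    · rw [map_add, ← hx', ← hy']; rfl
    · rw [map_add, hx'', hy'', ← map_add, ← map_add]; rfl
  | neg x hx h₁ =>
    obtain ⟨x', hx', hx''⟩ := h₁
    refine ⟨-x', ?_, ?_⟩
    · rw [map_neg, ← hx']; rfl
    · rw [map_neg, hx'', ← map_neg, ← map_neg]; rfl

theorem range_le_comap {T T' : Type u} [CommRing T] [Algebra R T] [CommRing T'] [Algebra R T']
    (f : T →ₐ[R] T') :
    (D.oneSubPhi T).range ≤ (D.oneSubPhi T').range.comap (D.C0map f) := by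
  rintro _ ⟨c, rfl⟩
  obtain ⟨c', h, h'⟩ := D.phi_natural f c
  refine ⟨c', ?_⟩
  change (c' : D.C0 T') - D.phi T' c' = D.C0map f ((c : D.C0 T) - D.phi T c)
  rw [map_sub, h, h']

end Semidisplay

/-! ### Commutative group functors and their Cartier duals -/

/-- A functor from commutative `R`-algebras to abelian groups. -/
structure GroupFunctor (R : Type u) [CommRing R] where
  /-- The group of `T`-points. -/
  obj : ∀ (T : Type u) [CommRing T] [Algebra R T], Type w
  group : ∀ (T : Type u) [CommRing T] [Algebra R T], AddCommGroup (obj T)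
  /-- The map on points induced by a homomorphism of algebras. -/
  map : ∀ {T T' : Type u} [CommRing T] [Algebra R T] [CommRing T'] [Algebra R T'],
    (T →ₐ[R] T') → (obj T →+ obj T')
  map_id : ∀ {T : Type u} [CommRing T] [Algebra R T], map (AlgHom.id R T) = AddMonoidHom.id (obj T)
  map_comp : ∀ {T T' T'' : Type u} [CommRing T] [Algebra R T] [CommRing T'] [Algebra R T']
    [CommRing T''] [Algebra R T''] (g : T' →ₐ[R] T'') (f : T →ₐ[R] T'),
    map (g.comp f) = (map g).comp (map f)

namespace GroupFunctor

instance {R : Type u} [CommRing R] (G : GroupFunctor.{u, w} R) (T : Type u) [CommRing T]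
    [Algebra R T] : AddCommGroup (G.obj T) := G.group T

variable {R : Type u} [CommRing R]

/-- The group of `R'`-points of the Cartier dual `Hom(G, 𝔾_m)` of a commutative group functor `G`
over `R`, i.e., the group of homomorphisms `G_{R'} → 𝔾_{m, R'}` of functors on the category of
`R'`-algebras. -/
@[ext]
structure CartierDual (G : GroupFunctor.{u, w} R) (R' : Type u) [CommRing R'] [Algebra R R'] where
  /-- The homomorphism on `T`-points, for an `R'`-algebra `T` (which is an `R`-algebra via `R'`). -/
  app : ∀ (T : Type u) [CommRing T] [Algebra R T] [Algebra R' T] [IsScalarTower R R' T],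
    G.obj T →+ Additive Tˣ
  natural : ∀ (T T' : Type u) [CommRing T] [Algebra R T] [Algebra R' T] [IsScalarTower R R' T]
    [CommRing T'] [Algebra R T'] [Algebra R' T'] [IsScalarTower R R' T'] (f : T →ₐ[R'] T')
    (c : G.obj T), ((app T' (G.map (f.restrictScalars R) c)).toMul : T') = f (app T c).toMul

namespace CartierDual

variable {G H : GroupFunctor.{u, w} R} {R' : Type u} [CommRing R'] [Algebra R R']

instance : Zero (G.CartierDual R') := ⟨⟨fun _ => 0, fun _ _ => by intros; simp⟩⟩

instance : Add (G.CartierDual R') :=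
  ⟨fun χ ψ => ⟨fun T => χ.app T + ψ.app T, fun T T' => by
    intros; simp [χ.natural T T', ψ.natural T T']⟩⟩

instance : Neg (G.CartierDual R') :=
  ⟨fun χ => ⟨fun T => -χ.app T, fun T T' => by
    intro _ _ _ _ _ _ _ _ f c
    have h : (χ.app T' (G.map (f.restrictScalars R) c)).toMul =
      Units.map (f : T →* T') (χ.app T c).toMul := Units.ext (χ.natural T T' f c)
    simp [h]⟩⟩

/-- Characters are added (i.e., multiplied) pointwise. -/
instance : AddCommGroup (G.CartierDual R') where
  add_assoc χ ψ ω := by ext1; funext T _ _ _ _; exact add_assoc (χ.app T) (ψ.app T) (ω.app T)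
  zero_add χ := by ext1; funext T _ _ _ _; exact zero_add (χ.app T)
  add_zero χ := by ext1; funext T _ _ _ _; exact add_zero (χ.app T)
  nsmul := nsmulRec
  zsmul := zsmulRec
  neg_add_cancel χ := by ext1; funext T _ _ _ _; exact neg_add_cancel (χ.app T)
  add_comm χ ψ := by ext1; funext T _ _ _ _; exact add_comm (χ.app T) (ψ.app T)

end CartierDual

/-- A homomorphism of commutative group functors. -/
structure Hom (G H : GroupFunctor.{u, w} R) where
  /-- The homomorphism on `T`-points. -/
  app : ∀ (T : Type u) [CommRing T] [Algebra R T], G.obj T →+ H.obj T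
  natural : ∀ (T T' : Type u) [CommRing T] [Algebra R T] [CommRing T'] [Algebra R T']
    (f : T →ₐ[R] T') (c : G.obj T), app T' (G.map f c) = H.map f (app T c)

/-- The homomorphism of Cartier duals induced by a homomorphism of group functors. -/
def Hom.dual {G H : GroupFunctor.{u, w} R} (q : G.Hom H) (R' : Type u) [CommRing R']
    [Algebra R R'] : H.CartierDual R' →+ G.CartierDual R' where
  toFun χ := ⟨fun T => (χ.app T).comp (q.app T), fun T T' => by
    intro _ _ _ _ _ _ _ _ f c
    change ((χ.app T' (q.app T' _)).toMul : T') = f (χ.app T (q.app T c)).toMul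
    rw [q.natural, χ.natural]⟩
  map_zero' := by ext1; rfl
  map_add' _ _ := by ext1; rfl

end GroupFunctor

namespace Semidisplay

variable {p : ℕ} [Fact p.Prime] {n : ℕ} [NeZero n] {R : Type u} [CommRing R] [Algebra (ZMod p) R]
  {P : Type v} [AddCommGroup P] [Module (TruncatedWittVector p n R) P]
  (D : Semidisplay p n R P)

open TensorProduct

theorem C0map_id {T : Type u} [CommRing T] [Algebra R T] :
    D.C0map (AlgHom.id R T) = AddMonoidHom.id (D.C0 T) := by
  ext c
  induction c using TensorProduct.induction_on with
  | zero => rw [map_zero, map_zero]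
  | add c c' h h' => rw [map_add, map_add, h, h']
  | tmul a x =>
    rw [C0map_tmul, AddMonoidHom.id_apply]
    congr 1

theorem C0map_comp {T T' T'' : Type u} [CommRing T] [Algebra R T] [CommRing T'] [Algebra R T']
    [CommRing T''] [Algebra R T''] (g : T' →ₐ[R] T'') (f : T →ₐ[R] T') :
    D.C0map (g.comp f) = (D.C0map g).comp (D.C0map f) := by
  ext c
  induction c using TensorProduct.induction_on with
  | zero => rw [map_zero, map_zero]
  | add c c' h h' => rw [map_add, map_add, h, h']
  | tmul a x =>
    rw [AddMonoidHom.comp_apply, C0map_tmul, C0map_tmul, C0map_tmul]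
    congr 1

/-- The group functor `C⁰ = Ŵ^(Fⁿ) ⊗_{W_n(R)} P`. -/
noncomputable def C0functor : GroupFunctor.{u, max u v} R where
  obj T := D.C0 T
  group _ _ _ := inferInstance
  map f := D.C0map f
  map_id := D.C0map_id
  map_comp g f := D.C0map_comp g f

/-- The group functor `𝔷 = Coker(1 - Φ : C⁻¹ → C⁰)`. -/
noncomputable def zinkFunctor : GroupFunctor.{u, max u v} R where
  obj T := D.Zink T
  group _ _ _ := inferInstance
  map f := QuotientAddGroup.map _ _ (D.C0map f) (D.range_le_comap f)
  map_id := by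
    intro T _ _
    ext c
    exact congrArg QuotientAddGroup.mk (DFunLike.congr_fun D.C0map_id c)
  map_comp g f := by
    ext c
    exact congrArg QuotientAddGroup.mk (DFunLike.congr_fun (D.C0map_comp g f) c)

/-- The projection `C⁰ → 𝔷`. -/
noncomputable def toZink : D.C0functor.Hom D.zinkFunctor where
  app T _ _ := QuotientAddGroup.mk' (D.oneSubPhi T).range
  natural _ _ _ _ _ _ _ _ := rfl

end Semidisplay

/-! ### The Artin–Hasse exponential and the canonical pairing -/

section artinHasse

open PowerSeries

variable (p : ℕ) [hp : Fact p.Prime]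

open Classical in
/-- The power series `∑_{j ≥ 0} X ^ (p ^ j) / p ^ j`. -/
noncomputable def ahExponent : PowerSeries ℚ :=
  PowerSeries.mk fun k => if ∃ j, k = p ^ j then (k : ℚ)⁻¹ else 0

/-- The Artin–Hasse exponential `exp (∑_{j ≥ 0} X ^ (p ^ j) / p ^ j)`. -/
noncomputable def artinHasse : PowerSeries ℚ :=
  (PowerSeries.exp ℚ).subst (ahExponent p)

theorem hasSubst_ahExponent : HasSubst (ahExponent p) := by
  apply HasSubst.of_constantCoeff_zero'
  rw [← coeff_zero_eq_constantCoeff_apply, ahExponent, coeff_mk]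
  split_ifs <;> simp

theorem constantCoeff_artinHasse : constantCoeff (artinHasse p) = 1 := by
  have h := constantCoeff_subst_eq_zero (a := ahExponent p) (by
    rw [← PowerSeries.constantCoeff, ← coeff_zero_eq_constantCoeff_apply, ahExponent, coeff_mk]
    split_ifs <;> simp) (PowerSeries.exp ℚ - 1) (by simp)
  rw [subst_sub (hasSubst_ahExponent p)] at h
  have h1 : (1 : PowerSeries ℚ).subst (ahExponent p) = 1 := by
    rw [← coe_substAlgHom (hasSubst_ahExponent p), map_one]
  rw [h1] at h
  have h2 : constantCoeff (artinHasse p - 1) = 0 := h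
  rw [map_sub, map_one, sub_eq_zero] at h2
  exact h2

theorem derivative_artinHasse :
    d⁄dX ℚ (artinHasse p) = artinHasse p * d⁄dX ℚ (ahExponent p) := by
  rw [artinHasse, derivative_subst (hasSubst_ahExponent p), derivative_exp]

theorem expand_ahExponent : expand p hp.out.ne_zero (ahExponent p) =
    (p : PowerSeries ℚ) * (ahExponent p - X) := by
  have hp0 : (p : ℚ) ≠ 0 := Nat.cast_ne_zero.2 hp.out.ne_zero
  ext k
  rw [coeff_expand, ← map_natCast (C (R := ℚ)), coeff_C_mul, map_sub, coeff_X, ahExponent, coeff_mk,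
    coeff_mk]
  by_cases hk : p ∣ k
  · obtain ⟨m, rfl⟩ := hk
    rw [if_pos (dvd_mul_right _ _), Nat.mul_div_cancel_left _ hp.out.pos]
    have h1 : p * m ≠ 1 := fun h => hp.out.one_lt.ne' (Nat.eq_one_of_mul_eq_one_right h)
    have h2 : (∃ j, p * m = p ^ j) ↔ ∃ j, m = p ^ j := by
      constructor
      · rintro ⟨j, hj⟩
        cases j with
        | zero => exact absurd hj (by simpa using h1)
        | succ j =>
          exact ⟨j, Nat.eq_of_mul_eq_mul_left hp.out.pos (by rw [hj, pow_succ, mul_comm])⟩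
      · rintro ⟨j, rfl⟩
        exact ⟨j + 1, by rw [pow_succ, mul_comm]⟩
    rw [if_neg h1, sub_zero]
    by_cases h : ∃ j, m = p ^ j
    · rw [if_pos h, if_pos (h2.2 h)]
      push_cast
      rw [mul_inv, ← mul_assoc, mul_inv_cancel₀ hp0, one_mul]
    · rw [if_neg h, if_neg fun h' => h (h2.1 h'), mul_zero]
  · rw [if_neg hk]
    by_cases h1 : k = 1
    · subst h1
      rw [if_pos ⟨0, by simp⟩, if_pos rfl]
      simp
    · rw [if_neg h1, if_neg]
      · simp
      · rintro ⟨j, rfl⟩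
        cases j with
        | zero => exact h1 (pow_zero p)
        | succ j => exact hk (dvd_pow_self p j.succ_ne_zero)

theorem eq_zero_of_derivative (A W : PowerSeries ℚ) (h0 : constantCoeff W = 0)
    (h : d⁄dX ℚ W = W * A) : W = 0 := by
  ext k
  induction k using Nat.strong_induction_on with
  | _ k ih =>
    cases k with
    | zero => simpa using h0
    | succ k =>
      have h1 := congrArg (coeff k) h
      rw [coeff_derivative, coeff_mul, Finset.sum_eq_zero] at h1
      · have h2 : ((k : ℚ) + 1) ≠ 0 := by positivity
        simpa [h2] using h1
      · rintro ⟨i, j⟩ hij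
        have h3 := Finset.HasAntidiagonal.mem_antidiagonal.1 hij
        rw [ih i (by simp only at h3; omega), map_zero, zero_mul]

/-- `E(X) ^ p = E(X ^ p) * exp (p X)`. -/
theorem artinHasse_pow : artinHasse p ^ p =
    expand p hp.out.ne_zero (artinHasse p) * (PowerSeries.exp ℚ) ^ p := by
  rw [← sub_eq_zero]
  have hX : HasSubst (X ^ p : PowerSeries ℚ) := HasSubst.X_pow hp.out.ne_zero
  have h1 : (p : PowerSeries ℚ) * d⁄dX ℚ (ahExponent p) =
      expand p hp.out.ne_zero (d⁄dX ℚ (ahExponent p)) * d⁄dX ℚ (X ^ p : PowerSeries ℚ) + p := by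
    have h2 := congrArg (d⁄dX ℚ) (expand_ahExponent p)
    rw [expand_apply, derivative_subst hX, ← expand_apply p hp.out.ne_zero, Derivation.leibniz,
      map_sub, derivative_X] at h2
    rw [h2]
    simp
    ring
  have hpow : ∀ f : PowerSeries ℚ, d⁄dX ℚ (f ^ p) = p * f ^ (p - 1) * d⁄dX ℚ f := fun f => by
    rw [Derivation.leibniz_pow]
    simp [mul_assoc]
  have hE : d⁄dX ℚ (expand p hp.out.ne_zero (artinHasse p)) =
      expand p hp.out.ne_zero (artinHasse p) *
        expand p hp.out.ne_zero (d⁄dX ℚ (ahExponent p)) * d⁄dX ℚ (X ^ p : PowerSeries ℚ) := by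
    rw [← map_mul, ← derivative_artinHasse, expand_apply, derivative_subst hX, expand_apply]
  have hpp : ∀ f : PowerSeries ℚ, f ^ (p - 1) * f = f ^ p := fun f =>
    pow_sub_one_mul hp.out.ne_zero f
  apply eq_zero_of_derivative (p * d⁄dX ℚ (ahExponent p))
  · rw [map_sub, map_mul, map_pow, map_pow, constantCoeff_expand, constantCoeff_artinHasse,
      constantCoeff_exp]
    simp
  · rw [map_sub, Derivation.leibniz, hpow, hpow, derivative_exp, derivative_artinHasse, sub_mul,
      hE]
    simp only [smul_eq_mul]
    congr 1
    · rw [← hpp]; ring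
    · rw [h1, ← hpp (PowerSeries.exp ℚ)]; ring

/-- The `p`-integral rational numbers. -/
noncomputable def pInt : Subring ℚ := (PadicInt.subring p).comap (Rat.castHom ℚ_[p])

variable {p} in
/-- A `p`-integral rational number, as a `p`-adic integer. -/
noncomputable def toPadicInt (x : ℚ) (hx : x ∈ pInt p) : ℤ_[p] := ⟨(x : ℚ_[p]), hx⟩

variable {p} in
theorem algebraMap_toPadicInt (x : ℚ) (hx : x ∈ pInt p) :
    algebraMap ℤ_[p] ℚ_[p] (toPadicInt x hx) = Rat.castHom ℚ_[p] x := rfl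

theorem pow_div_factorial (k : ℕ) (hk : k ≠ 0) :
    ∃ z ∈ pInt p, (p : ℚ) ^ k / (k.factorial : ℚ) = p * z := by
  have hp0 : (p : ℚ) ≠ 0 := Nat.cast_ne_zero.2 hp.out.ne_zero
  have hf : (k.factorial : ℚ) ≠ 0 := Nat.cast_ne_zero.2 k.factorial_ne_zero
  refine ⟨(p : ℚ) ^ (k - 1) / (k.factorial : ℚ), ?_, ?_⟩
  · change ‖(((p : ℚ) ^ (k - 1) / (k.factorial : ℚ) : ℚ) : ℚ_[p])‖ ≤ 1
    rw [Padic.eq_padicNorm, padicNorm.eq_zpow_of_nonzero (div_ne_zero (pow_ne_zero _ hp0) hf),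
      padicValRat.div (pow_ne_zero _ hp0) hf, padicValRat.pow, padicValRat.self hp.out.one_lt,
      padicValRat.of_nat]
    have h1 := padicValNat_factorial_lt_of_ne_zero p hk
    have h2 : (1 : ℚ) ≤ p := by exact_mod_cast hp.out.one_le
    have h3 := zpow_le_one_of_nonpos₀ h2
      (n := -(((k - 1 : ℕ) : ℤ) * 1 - (padicValNat p k.factorial : ℤ))) (by omega)
    exact_mod_cast h3
  · obtain ⟨k, rfl⟩ := Nat.exists_eq_succ_of_ne_zero hk
    rw [Nat.succ_sub_one, pow_succ]
    field_simp

theorem coeff_exp_pow (k : ℕ) (hk : k ≠ 0) :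
    ∃ z ∈ pInt p, coeff k (PowerSeries.exp ℚ ^ p) = p * z := by
  obtain ⟨z, hz, h⟩ := pow_div_factorial p k hk
  refine ⟨z, hz, ?_⟩
  rw [← h, exp_pow_eq_rescale_exp, coeff_rescale, coeff_exp]
  simp [div_eq_mul_inv]

/-- For a polynomial `f` with `p`-integral coefficients, `f(X) ^ p ≡ f(X ^ p)` modulo `p`. -/
theorem coeff_pow_sub_coeff_expand (f : Polynomial ℚ) (hf : ∀ i, f.coeff i ∈ pInt p) (k : ℕ) :
    ∃ z ∈ pInt p, (f ^ p).coeff k - (Polynomial.expand ℚ p f).coeff k = p * z := by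
  let g : Polynomial ℤ_[p] := ∑ i ∈ f.support, Polynomial.monomial i (toPadicInt (f.coeff i) (hf i))
  have hg : g.map (algebraMap ℤ_[p] ℚ_[p]) = f.map (Rat.castHom ℚ_[p]) := by
    conv_rhs => rw [f.as_sum_support]
    rw [Polynomial.map_sum, Polynomial.map_sum]
    refine Finset.sum_congr rfl fun i _ => ?_
    rw [Polynomial.map_monomial, Polynomial.map_monomial, algebraMap_toPadicInt]
  have h1 : (g ^ p - Polynomial.expand ℤ_[p] p g).map PadicInt.toZMod = 0 := by
    rw [Polynomial.map_sub, Polynomial.map_pow, Polynomial.map_expand, ZMod.expand_card, sub_self]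
  have h2 : (g ^ p - Polynomial.expand ℤ_[p] p g).coeff k ∈ RingHom.ker (PadicInt.toZMod (p := p)) := by
    rw [RingHom.mem_ker, ← Polynomial.coeff_map, h1, Polynomial.coeff_zero]
  rw [PadicInt.ker_toZMod, PadicInt.maximalIdeal_eq_span_p, Ideal.mem_span_singleton'] at h2
  obtain ⟨z, hz⟩ := h2
  have hp0 : (p : ℚ) ≠ 0 := Nat.cast_ne_zero.2 hp.out.ne_zero
  have hp0' : (p : ℚ_[p]) ≠ 0 := Nat.cast_ne_zero.2 hp.out.ne_zero
  have h3 : (z : ℚ_[p]) * p = (((f ^ p).coeff k - (Polynomial.expand ℚ p f).coeff k : ℚ) : ℚ_[p]) := by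
    have h4 : (f ^ p - Polynomial.expand ℚ p f).map (Rat.castHom ℚ_[p]) =
        (g ^ p - Polynomial.expand ℤ_[p] p g).map (algebraMap ℤ_[p] ℚ_[p]) := by
      rw [Polynomial.map_sub, Polynomial.map_sub, Polynomial.map_pow, Polynomial.map_pow,
        Polynomial.map_expand, Polynomial.map_expand, hg]
    have h5 := congrArg (fun q => Polynomial.coeff q k) h4
    simp only [Polynomial.coeff_map, ← hz] at h5
    rw [← Polynomial.coeff_sub]
    refine Eq.trans ?_ h5.symm
    rw [map_mul, map_natCast]
    rfl
  refine ⟨((f ^ p).coeff k - (Polynomial.expand ℚ p f).coeff k) / p, ?_, ?_⟩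
  · change ‖((((f ^ p).coeff k - (Polynomial.expand ℚ p f).coeff k) / p : ℚ) : ℚ_[p])‖ ≤ 1
    rw [Rat.cast_div, ← h3, Rat.cast_natCast, mul_div_cancel_right₀ _ hp0']
    exact z.2
  · rw [mul_div_cancel₀ _ hp0]

/-- The coefficients of the Artin–Hasse exponential are `p`-integral. -/
theorem coeff_artinHasse_mem (k : ℕ) : coeff k (artinHasse p) ∈ pInt p := by
  have hp0 : (p : ℚ) ≠ 0 := Nat.cast_ne_zero.2 hp.out.ne_zero
  induction k using Nat.strong_induction_on with
  | _ k ih =>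
  rcases eq_or_ne k 0 with rfl | hk
  · rw [coeff_zero_eq_constantCoeff_apply, constantCoeff_artinHasse]
    exact one_mem _
  set E := artinHasse p with hE
  let f := trunc k E
  have hf : ∀ i, f.coeff i ∈ pInt p := fun i => by
    rw [coeff_trunc]
    split_ifs with h
    exacts [ih i h, zero_mem _]
  obtain ⟨h, hh⟩ : ∃ h : PowerSeries ℚ, E = (f : PowerSeries ℚ) + X ^ k * h := by
    have : X ^ k ∣ E - (f : PowerSeries ℚ) := by
      rw [X_pow_dvd_iff]
      intro m hm
      rw [map_sub, Polynomial.coeff_coe, coeff_trunc, if_pos hm, sub_self]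
    obtain ⟨h, hh⟩ := this
    exact ⟨h, by rw [← hh, add_sub_cancel]⟩
  have hh0 : constantCoeff h = coeff k E := by
    conv_rhs => rw [hh]
    rw [map_add, Polynomial.coeff_coe, coeff_trunc, if_neg (lt_irrefl _), zero_add,
      coeff_X_pow_mul', if_pos le_rfl, Nat.sub_self, coeff_zero_eq_constantCoeff_apply]
  -- the coefficient of `X ^ k` in `E ^ p`
  have hl : coeff k (E ^ p) = (f ^ p).coeff k + p * coeff k E := by
    obtain ⟨w, hw⟩ := Polynomial.powAddExpansion (f : PowerSeries ℚ) (X ^ k * h) p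
    rw [hh, hw, map_add, map_add, ← hh]
    have e1 : coeff k (w * (X ^ k * h) ^ 2) = 0 := by
      have : w * (X ^ k * h) ^ 2 = X ^ (2 * k) * (w * h ^ 2) := by ring
      rw [this, coeff_X_pow_mul', if_neg (by omega)]
    have e2 : coeff k ((p : PowerSeries ℚ) * (f : PowerSeries ℚ) ^ (p - 1) * (X ^ k * h)) =
        p * coeff k E := by
      have : (p : PowerSeries ℚ) * (f : PowerSeries ℚ) ^ (p - 1) * (X ^ k * h) =
          X ^ k * ((p : PowerSeries ℚ) * ((f : PowerSeries ℚ) ^ (p - 1) * h)) := by ring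
      rw [this, coeff_X_pow_mul', if_pos le_rfl, Nat.sub_self, coeff_zero_eq_constantCoeff_apply,
        map_mul, map_mul, map_pow, hh0]
      have hf0 : constantCoeff (f : PowerSeries ℚ) = 1 := by
        rw [← coeff_zero_eq_constantCoeff_apply, Polynomial.coeff_coe, coeff_trunc,
          if_pos (Nat.pos_of_ne_zero hk), coeff_zero_eq_constantCoeff_apply,
          constantCoeff_artinHasse]
      rw [hf0, map_natCast]
      ring
    rw [e1, e2, add_zero, ← Polynomial.coe_pow, Polynomial.coeff_coe]
  -- the coefficient of `X ^ k` in `E(X ^ p) * exp (p X)`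
  have hexp : ∀ i ≤ k, coeff i (expand p hp.out.ne_zero E) = (Polynomial.expand ℚ p f).coeff i := by
    intro i hi
    rw [coeff_expand, Polynomial.coeff_expand hp.out.pos]
    split_ifs with h
    · rw [coeff_trunc, if_pos]
      rcases Nat.eq_zero_or_pos i with rfl | hi0
      · simpa using Nat.pos_of_ne_zero hk
      · exact (Nat.div_lt_self hi0 hp.out.one_lt).trans_le hi
    · rfl
  have hexp' : ∀ i, (Polynomial.expand ℚ p f).coeff i ∈ pInt p := fun i => by
    rw [Polynomial.coeff_expand hp.out.pos]
    split_ifs with h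
    exacts [hf _, zero_mem _]
  have hr : ∃ z ∈ pInt p, coeff k (E ^ p) = (Polynomial.expand ℚ p f).coeff k + p * z := by
    choose! e he he' using coeff_exp_pow p
    refine ⟨∑ ij ∈ (Finset.HasAntidiagonal.antidiagonal k).erase (k, 0),
      (Polynomial.expand ℚ p f).coeff ij.1 * e ij.2, ?_, ?_⟩
    · refine sum_mem fun ij hij => mul_mem (hexp' _) (he _ ?_)
      rintro h0
      have h1 := Finset.mem_erase.1 hij
      have h2 := Finset.HasAntidiagonal.mem_antidiagonal.1 h1.2
      exact h1.1 (Prod.ext (by simp only; omega) h0)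
    · rw [artinHasse_pow, coeff_mul, ← Finset.add_sum_erase _ _ (a := (k, 0)) (by simp)]
      congr 1
      · rw [hexp k le_rfl]
        simp
      · rw [Finset.mul_sum]
        refine Finset.sum_congr rfl fun ij hij => ?_
        have h1 := Finset.mem_erase.1 hij
        have h2 := Finset.HasAntidiagonal.mem_antidiagonal.1 h1.2
        rw [hexp _ (by omega), he' ij.2 (fun h0 => h1.1 (Prod.ext (by simp only; omega) h0))]
        ring
  obtain ⟨z, hz, hz'⟩ := hr
  obtain ⟨y, hy, hy'⟩ := coeff_pow_sub_coeff_expand p f hf k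
  have : coeff k E = z - y := by
    have : (p : ℚ) * coeff k E = p * (z - y) := by linear_combination hz' - hl - hy'
    exact mul_left_cancel₀ hp0 this
  rw [this]
  exact sub_mem hz hy

/-- The coefficients of the Artin–Hasse exponential, as `p`-adic integers. -/
noncomputable def ahCoeff (k : ℕ) : ℤ_[p] :=
  toPadicInt (coeff k (artinHasse p)) (coeff_artinHasse_mem p k)

end artinHasse

section pairing

variable (p : ℕ) [Fact p.Prime] {T : Type u} [CommRing T]

/-- The canonical character `λ : Ŵ(T) → Tˣ`, `x ↦ ∏ᵢ E(xᵢ)`, where `T` is an `𝔽_p`-algebra and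
`E` is the Artin–Hasse exponential, whose coefficients are reduced modulo `p`. It is induced by the
character `f ↦ f(1)` of the big formal Witt group via `x ↦ ∏ᵢ E(xᵢ t ^ (p ^ i))`. The sums and the
product below are finite for `z ∈ Ŵ(T)`: the components of `z` are nilpotent, and almost all of them
are zero. -/
noncomputable def hatCharacter (z : WittVector p T) : T :=
  ∏ᶠ i : ℕ, ∑ᶠ k : ℕ, ((PadicInt.toZMod (ahCoeff p k)).val : T) * z.coeff i ^ k

variable {p} {n : ℕ}

/-- The canonical pairing `⟨a, y⟩ = λ(a y)` between `Ŵ^(Fⁿ)(T)` and `W_n(T)`. -/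
noncomputable def pairing (a : HatW p n T) (y : TruncatedWittVector p n T) : T :=
  hatCharacter p (hatSMul y a : HatW p n T)

end pairing

namespace Semidisplay

variable {p : ℕ} [Fact p.Prime] {n : ℕ} [NeZero n] {R : Type u} [CommRing R] [Algebra (ZMod p) R]
  {P : Type v} [AddCommGroup P] [Module (TruncatedWittVector p n R) P]
  (D : Semidisplay p n R P) (R' : Type w) [CommRing R'] [Algebra R R']

/-- The group of `W_n(R)`-linear maps `η : P → W_n(R')`. -/
abbrev LinearForms (_ : Semidisplay p n R P) (R' : Type w) [CommRing R'] [Algebra R R'] :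
    Type (max v w) :=
  P →ₛₗ[truncMap p n (algebraMap R R')] TruncatedWittVector p n R'

/-- The group of `R'`-points of `Hom(𝒫, 𝟏)`, where `𝟏` is the unit semidisplay: the
`W_n(R)`-linear maps `η : P → W_n(R')` such that `η(F(x)) = F(η(x))` for `x ∈ P` and
`η(y) = V(η(F₁(y)))` for `y ∈ Q`. Here `η(F₁(y)) ∈ W_{n-1}(R')` is the restriction of `η(z)`, for any
representative `z ∈ P` of `F₁(y)`. -/
def homToUnit : AddSubgroup (D.LinearForms R') where
  carrier := {η | (∀ x : P, η (D.F x) = truncF (η x)) ∧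
    ∀ (y : D.Q) (z : P), Submodule.Quotient.mk z = D.F₁ y →
      η y = truncV (truncRestrict p n R' (η z))}
  add_mem' := fun {η θ} hη hθ => by
    refine ⟨fun x => ?_, fun y z h => ?_⟩
    · rw [LinearMap.add_apply, LinearMap.add_apply, truncF_add (natCast_eq_zero p R R'), hη.1,
        hθ.1]
    · rw [LinearMap.add_apply, LinearMap.add_apply, map_add, truncV_add, hη.2 y z h, hθ.2 y z h]
  zero_mem' := by
    have hF : truncF (0 : TruncatedWittVector p n R') = 0 := by
      rw [← map_zero (WittVector.truncate n), truncF_truncate (natCast_eq_zero p R R'), map_zero]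
    have hV : truncV (n := n) (0 : TruncatedWittVector p (n - 1) R') = 0 := by
      rw [← map_zero (WittVector.truncate (n - 1)), truncV_truncate, map_zero, map_zero]
    exact ⟨fun x => hF.symm, fun y z _ => by simp [hV]⟩
  neg_mem' := fun {η} hη => by
    have hF : ∀ x : TruncatedWittVector p n R', truncF (-x) = -truncF x := fun x => by
      obtain ⟨a, rfl⟩ := WittVector.truncate_surjective p n R' x
      rw [← map_neg, truncF_truncate (natCast_eq_zero p R R'),
        truncF_truncate (natCast_eq_zero p R R'), map_neg, map_neg]
    have hV : ∀ x : TruncatedWittVector p (n - 1) R', truncV (n := n) (-x) = -truncV x := fun x => by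
      obtain ⟨a, rfl⟩ := WittVector.truncate_surjective p (n - 1) R' x
      rw [← map_neg, truncV_truncate, truncV_truncate, map_neg, map_neg]
    refine ⟨fun x => ?_, fun y z h => ?_⟩
    · rw [LinearMap.neg_apply, LinearMap.neg_apply, hF, hη.1]
    · rw [LinearMap.neg_apply, LinearMap.neg_apply, map_neg, hV, hη.2 y z h]

end Semidisplay

end ZinkDual

/-! The functor `𝔷` is an objectwise cokernel, so `C⁰ → 𝔷` is surjective on points and `𝔷*` consists
exactly of the characters of `C⁰` with `χ = χ ∘ Φ` on `C⁻¹`. Two facts remain: the duality between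
`Ŵ^(Fⁿ)` and `W_n`, and the translation of invariance under `Φ` into conditions on `η`.

Given the duality, a character `χ` of `C⁰` yields, for each `x ∈ P`, the character `a ↦ χ(a ⊗ x)` of
`Ŵ^(Fⁿ)`, which is `⟨·, η(x)⟩` for a unique `η(x)`; uniqueness makes `η` linear. Invariance under
`Φ` need only be tested on the generators `V(a) ⊗ x` and `a ⊗ y` of `C⁻¹`. There the adjunctions
`⟨V(a), y⟩ = ⟨a, F(y)⟩` and `⟨F(a), y⟩ = ⟨a, V(y)⟩` turn it into `η(F(x)) = F(η(x))` and `η(y) =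
V(η(F₁(y)))` (`formCharacter_mem_range`). Both adjunctions come from `V(F(a)b) = aV(b)` and `λ ∘ V =
λ`.

The pairing is bimultiplicative because `λ` is additive (`hatCharacter_add`): applying `X d/dX` to
the logarithm of `∏ E(zᵢ X ^ (p ^ i))` gives the series whose coefficient at `X ^ (p ^ K)` is the
`K`-th ghost component of `z`, which is additive in `z`. In a universal domain of characteristic
zero this determines the product; specialization and evaluation at `X = 1` give the claim.

Every character is a pairing (`HatChar.exists_eq_hatCharacter`), by induction on `n`. A character
`χ` of `Ŵ^(Fⁿ⁺¹)` is determined by the polynomials `fᵢ` with `χ(Vⁱ[t]) = fᵢ(t)`. A twist by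
`λ(a[c])` makes the linear coefficient of `f₀` vanish. For `xᵖ = 0 = y²` the relation `[x] + [y] =
[x + y] + V[-xᵖ⁻¹y]` becomes a differential equation for `fᵢ` modulo `Xᵖ`, which forces all linear
coefficients to vanish and `fᵢ ≡ 1` modulo `Xᵖ`. Thus `χ` is trivial on `Ŵ^(F)`, every `fᵢ` is a
polynomial in `Xᵖ`, and `χ` factors through `F : Ŵ^(Fⁿ⁺¹) → Ŵ^(Fⁿ)`. If the factor is `b ↦ λ(bw)`,
then `λ(F(a)w) = λ(aV(w))` concludes. Uniqueness (`coeff_eq_zero_of_hatCharacter_eq_one`) is seen on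
a single Teichmüller element, where the first nonzero component of `w` shows up. -/

namespace ZinkDual

/-! ### The logarithmic derivative of the Artin–Hasse exponential -/

section artinHasse

open PowerSeries

variable (p : ℕ) [hp : Fact p.Prime]

/-- The Artin–Hasse exponential as a power series with `p`-adic integral coefficients. -/
noncomputable def ahSeries : PowerSeries ℤ_[p] := PowerSeries.mk (ahCoeff p)

open Classical in
/-- The power series `∑_{j ≥ 0} X ^ (p ^ j)`. -/
noncomputable def ahLog (T : Type u) [CommRing T] : PowerSeries T :=
  PowerSeries.mk fun k => if ∃ j, k = p ^ j then 1 else 0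

theorem map_ahLog {S : Type u} {T : Type v} [CommRing S] [CommRing T] (f : S →+* T) :
    PowerSeries.map f (ahLog p S) = ahLog p T := by
  ext k
  simp only [ahLog, coeff_map, coeff_mk]
  split_ifs <;> simp

theorem coeff_X_mul_derivative {T : Type u} [CommRing T] (f : PowerSeries T) (k : ℕ) :
    coeff k (X * d⁄dX T f) = k * coeff k f := by
  cases k with
  | zero => simp
  | succ k => rw [coeff_succ_X_mul, coeff_derivative, mul_comm]; push_cast; rfl

theorem map_X_mul_derivative {S : Type u} {T : Type v} [CommRing S] [CommRing T] (f : S →+* T)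
    (g : PowerSeries S) :
    PowerSeries.map f (X * d⁄dX S g) = X * d⁄dX T (PowerSeries.map f g) := by
  ext k
  rw [coeff_X_mul_derivative, coeff_map, coeff_X_mul_derivative, coeff_map, map_mul, map_natCast]

/-- The operator `X d/dX` sends `X ^ (p ^ j) / p ^ j` to `X ^ (p ^ j)`. The denominators disappear,
so this form of the differential equation makes sense over `ℤ_[p]` and over every ring below it. -/
theorem X_mul_derivative_artinHasse :
    X * d⁄dX ℚ (artinHasse p) = artinHasse p * ahLog p ℚ := by
  rw [derivative_artinHasse, mul_left_comm]
  congr 1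
  ext k
  rw [coeff_X_mul_derivative, ahExponent, ahLog, coeff_mk, coeff_mk]
  split_ifs with h
  · obtain ⟨j, rfl⟩ := h
    exact mul_inv_cancel₀ (Nat.cast_ne_zero.2 (pow_ne_zero _ hp.out.ne_zero))
  · simp

theorem map_ahSeries : PowerSeries.map (algebraMap ℤ_[p] ℚ_[p]) (ahSeries p) =
    PowerSeries.map (Rat.castHom ℚ_[p]) (artinHasse p) := by
  ext k
  rw [coeff_map, coeff_map, ahSeries, coeff_mk, ahCoeff, algebraMap_toPadicInt]

theorem X_mul_derivative_ahSeries :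
    X * d⁄dX ℤ_[p] (ahSeries p) = ahSeries p * ahLog p ℤ_[p] := by
  apply PowerSeries.map_injective (algebraMap ℤ_[p] ℚ_[p]) (FaithfulSMul.algebraMap_injective _ _)
  rw [map_X_mul_derivative, map_mul, map_ahLog, map_ahSeries, ← map_X_mul_derivative,
    X_mul_derivative_artinHasse, map_mul, map_ahLog]

variable {p}
variable {T : Type u} [CommRing T]

/-- The operator `X d/dX` commutes with `X ↦ aX` and picks up the factor `m` under `X ↦ X ^ m`. For
`m = p ^ i` this factor is the power of `p` in the Witt polynomials. -/
theorem X_mul_derivative_expand_rescale {m : ℕ} (hm : m ≠ 0) (a : T) {e l : PowerSeries T}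
    (h : X * d⁄dX T e = e * l) :
    X * d⁄dX T (expand m hm (rescale a e)) =
      expand m hm (rescale a e) * ((m : PowerSeries T) * expand m hm (rescale a l)) := by
  have h1 : X * d⁄dX T (expand m hm (rescale a e)) =
      (m : PowerSeries T) * expand m hm (rescale a (X * d⁄dX T e)) := by
    ext k
    rw [coeff_X_mul_derivative, ← map_natCast (C (R := T)), coeff_C_mul, coeff_expand, coeff_expand]
    split_ifs with hk
    · obtain ⟨j, rfl⟩ := hk
      rw [Nat.mul_div_cancel_left _ (Nat.pos_of_ne_zero hm), coeff_rescale, coeff_rescale,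
        coeff_X_mul_derivative]
      push_cast
      ring
    · simp
  rw [h1, h, map_mul, map_mul]
  ring

theorem X_mul_derivative_prod {ι : Type v} (s : Finset ι) (g l : ι → PowerSeries T)
    (h : ∀ i ∈ s, X * d⁄dX T (g i) = g i * l i) :
    X * d⁄dX T (∏ i ∈ s, g i) = (∏ i ∈ s, g i) * ∑ i ∈ s, l i := by
  classical
  induction s using Finset.induction_on with
  | empty => simp
  | insert i s hi ih =>
    have h1 := h i (Finset.mem_insert_self _ _)
    have h2 := ih fun j hj => h j (Finset.mem_insert_of_mem hj)
    rw [Finset.prod_insert hi, Finset.sum_insert hi, Derivation.leibniz, smul_eq_mul, smul_eq_mul]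
    linear_combination (∏ i ∈ s, g i) * h1 + g i * h2

/-- The equation is a recursion `k gₖ = ∑ gᵢ lⱼ` over `i + j = k`, `j > 0`, because `l₀ = 0`; in a
domain of characteristic zero one divides by `k`. Only coefficients of degree at most `k` enter, so
agreement below `M` is inherited by the solutions. -/
theorem coeff_eq_of_X_mul_derivative [IsDomain T] [CharZero T] {G₁ G₂ L₁ L₂ : PowerSeries T}
    {M : ℕ} (h₁ : X * d⁄dX T G₁ = G₁ * L₁) (h₂ : X * d⁄dX T G₂ = G₂ * L₂)
    (h0 : coeff 0 G₁ = coeff 0 G₂) (hL0 : coeff 0 L₁ = 0)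
    (hL : ∀ k < M, coeff k L₁ = coeff k L₂) : ∀ k < M, coeff k G₁ = coeff k G₂ := by
  intro k
  induction k using Nat.strong_induction_on with
  | _ k ih =>
    intro hk
    rcases eq_or_ne k 0 with rfl | hk0
    · exact h0
    have e₁ := congrArg (coeff k) h₁
    have e₂ := congrArg (coeff k) h₂
    rw [coeff_X_mul_derivative, coeff_mul] at e₁ e₂
    have hk1 : (k : T) ≠ 0 := Nat.cast_ne_zero.2 hk0
    apply mul_left_cancel₀ hk1
    rw [e₁, e₂]
    refine Finset.sum_congr rfl fun ij hij => ?_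
    have h3 := Finset.HasAntidiagonal.mem_antidiagonal.1 hij
    rcases Nat.eq_zero_or_pos ij.2 with h4 | h4
    · rw [h4, ← hL 0 (by omega), hL0, mul_zero, mul_zero]
    · rw [ih ij.1 (by omega) (by omega), hL ij.2 (by omega)]

/-! ### Products of Artin–Hasse factors and ghost components -/

/-- The power series `∏_{i < N} e(zᵢ X ^ (p ^ i))`. -/
noncomputable def ghostProd (e : PowerSeries T) (z : WittVector p T) (N : ℕ) : PowerSeries T :=
  ∏ i ∈ Finset.range N, expand (p ^ i) (pow_ne_zero i hp.out.ne_zero) (rescale (z.coeff i) e)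

theorem map_ghostProd {S : Type v} [CommRing S] (f : T →+* S) (e : PowerSeries T)
    (z : WittVector p T) (N : ℕ) : PowerSeries.map f (ghostProd e z N) =
      ghostProd (PowerSeries.map f e) (WittVector.map f z) N := by
  rw [ghostProd, ghostProd, map_prod]
  refine Finset.prod_congr rfl fun i _ => ?_
  rw [map_expand, ← rescale_map, WittVector.map_coeff]

/-- The logarithmic derivative of `ghostProd`. -/
noncomputable def ghostSum (z : WittVector p T) (N : ℕ) : PowerSeries T :=
  ∑ i ∈ Finset.range N, ((p ^ i : ℕ) : PowerSeries T) *
    expand (p ^ i) (pow_ne_zero i hp.out.ne_zero) (rescale (z.coeff i) (ahLog p T))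

theorem X_mul_derivative_ghostProd {e : PowerSeries T} (h : X * d⁄dX T e = e * ahLog p T)
    (z : WittVector p T) (N : ℕ) :
    X * d⁄dX T (ghostProd e z N) = ghostProd e z N * ghostSum z N :=
  X_mul_derivative_prod _ _ _ fun _ _ => X_mul_derivative_expand_rescale _ _ h

open Classical in
theorem coeff_ghostSum (z : WittVector p T) (N k : ℕ) :
    coeff k (ghostSum z N) = ∑ i ∈ Finset.range N,
      if ∃ j, k = p ^ (i + j) then (p : T) ^ i * z.coeff i ^ (k / p ^ i) else 0 := by
  rw [ghostSum, map_sum]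
  refine Finset.sum_congr rfl fun i _ => ?_
  rw [← map_natCast (C (R := T)), coeff_C_mul, coeff_expand]
  have hpos : 0 < p ^ i := pow_pos hp.out.pos i
  by_cases hk : p ^ i ∣ k
  · obtain ⟨m, rfl⟩ := hk
    rw [if_pos (dvd_mul_right _ _), Nat.mul_div_cancel_left _ hpos, coeff_rescale, ahLog, coeff_mk]
    have h : (∃ j, p ^ i * m = p ^ (i + j)) ↔ ∃ j, m = p ^ j := by
      simp only [pow_add, Nat.mul_right_inj hpos.ne']
    by_cases h' : ∃ j, m = p ^ j
    · rw [if_pos h', if_pos (h.2 h')]; push_cast; ring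
    · rw [if_neg h', if_neg fun h'' => h' (h.1 h'')]; ring
  · rw [if_neg hk, if_neg, mul_zero]
    rintro ⟨j, rfl⟩
    exact hk (Dvd.intro _ (pow_add p i j).symm)

/-- The `i`-th factor contributes `p ^ i * zᵢ ^ (p ^ (K - i))` for `i ≤ K` and nothing for `i > K`,
and these are the terms of the `K`-th Witt polynomial. The bound `K < N` ensures that none of them
is cut off. -/
theorem coeff_ghostSum_pow (z : WittVector p T) {N K : ℕ} (hK : K < N) :
    coeff (p ^ K) (ghostSum z N) = WittVector.ghostComponent K z := by
  rw [coeff_ghostSum, WittVector.ghostComponent_apply, aeval_wittPolynomial,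
    ← Finset.sum_subset (Finset.range_subset_range.2 (Nat.succ_le_of_lt hK))]
  · refine Finset.sum_congr rfl fun i hi => ?_
    have hi' : i ≤ K := Nat.lt_succ_iff.1 (Finset.mem_range.1 hi)
    have h : ∃ j, p ^ K = p ^ (i + j) := ⟨K - i, by rw [Nat.add_sub_cancel' hi']⟩
    rw [if_pos h, Nat.pow_div hi' hp.out.pos]
  · intro i _ hi
    rw [if_neg]
    rintro ⟨j, hj⟩
    have := Nat.pow_right_injective hp.out.two_le hj
    exact hi (Finset.mem_range.2 (by omega))

/-- Below degree `p ^ N` only the ghost components of index less than `N` occur, and ghost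
components are additive. In degrees that are not powers of `p` everything vanishes. -/
theorem coeff_ghostSum_add (z y : WittVector p T) {N k : ℕ} (hk : k < p ^ N) :
    coeff k (ghostSum z N + ghostSum y N) = coeff k (ghostSum (z + y) N) := by
  by_cases h : ∃ K, k = p ^ K
  · obtain ⟨K, rfl⟩ := h
    have hK : K < N := (Nat.pow_lt_pow_iff_right hp.out.one_lt).1 hk
    rw [map_add, coeff_ghostSum_pow z hK, coeff_ghostSum_pow y hK, coeff_ghostSum_pow _ hK, map_add]
  · have h0 : ∀ x : WittVector p T, coeff k (ghostSum x N) = 0 := fun x => by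
      rw [coeff_ghostSum]
      refine Finset.sum_eq_zero fun i _ => if_neg ?_
      rintro ⟨j, hj⟩
      exact h ⟨_, hj⟩
    rw [map_add, h0, h0, h0, add_zero]

theorem coeff_zero_ghostSum (z : WittVector p T) (N : ℕ) : coeff 0 (ghostSum z N) = 0 := by
  rw [coeff_ghostSum]
  refine Finset.sum_eq_zero fun i _ => if_neg ?_
  rintro ⟨j, hj⟩
  exact pow_ne_zero _ hp.out.ne_zero hj.symm

theorem coeff_zero_ghostProd {e : PowerSeries T} (h : coeff 0 e = 1) (z : WittVector p T) (N : ℕ) :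
    coeff 0 (ghostProd e z N) = 1 := by
  rw [coeff_zero_eq_constantCoeff_apply, ghostProd, map_prod]
  refine Finset.prod_eq_one fun i _ => ?_
  rw [constantCoeff_expand, ← coeff_zero_eq_constantCoeff_apply, coeff_rescale, h]
  simp

theorem ahCoeff_zero : ahCoeff p 0 = 1 := by
  apply FaithfulSMul.algebraMap_injective ℤ_[p] ℚ_[p]
  rw [ahCoeff, algebraMap_toPadicInt, coeff_zero_eq_constantCoeff_apply, constantCoeff_artinHasse,
    map_one, map_one]

theorem ahCoeff_one : ahCoeff p 1 = 1 := by
  have h := congrArg (coeff 1) (X_mul_derivative_ahSeries p)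
  rw [coeff_X_mul_derivative, coeff_mul, ahSeries, ahLog] at h
  have h0 : ¬ ∃ j, 0 = p ^ j := by rintro ⟨j, hj⟩; exact pow_ne_zero _ hp.out.ne_zero hj.symm
  have h1 : ∃ j, 1 = p ^ j := ⟨0, (pow_zero p).symm⟩
  simpa [Finset.Nat.antidiagonal_succ, h0, h1, ahCoeff_zero] using h

/-- Over the polynomial ring on the components of two generic Witt vectors, a domain of
characteristic zero, both sides have constant term `1` and logarithmic derivatives that agree below
degree `p ^ N`. The general case is a specialization; `T` itself may have characteristic `p`. -/
theorem coeff_ghostProd_mul (φ : ℤ_[p] →+* T) (z y : WittVector p T) {N k : ℕ} (hk : k < p ^ N) :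
    coeff k (ghostProd (PowerSeries.map φ (ahSeries p)) z N *
      ghostProd (PowerSeries.map φ (ahSeries p)) y N) =
    coeff k (ghostProd (PowerSeries.map φ (ahSeries p)) (z + y) N) := by
  let B := MvPolynomial (Bool × ℕ) ℤ_[p]
  let e : PowerSeries B := PowerSeries.map MvPolynomial.C (ahSeries p)
  let Z : WittVector p B := WittVector.mk p fun i => MvPolynomial.X (false, i)
  let Y : WittVector p B := WittVector.mk p fun i => MvPolynomial.X (true, i)
  let f : B →+* T := MvPolynomial.eval₂Hom φ fun bi => cond bi.1 (y.coeff bi.2) (z.coeff bi.2)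
  have he : PowerSeries.map f e = PowerSeries.map φ (ahSeries p) := by
    ext k
    rw [coeff_map, coeff_map, coeff_map]
    exact MvPolynomial.eval₂Hom_C _ _ _
  have hZ : WittVector.map f Z = z := by ext i; exact MvPolynomial.eval₂Hom_X' _ _ _
  have hY : WittVector.map f Y = y := by ext i; exact MvPolynomial.eval₂Hom_X' _ _ _
  have hde : X * d⁄dX B e = e * ahLog p B := by
    rw [← map_X_mul_derivative, X_mul_derivative_ahSeries, map_mul, map_ahLog]
  have he0 : coeff 0 e = 1 := by
    rw [coeff_map, ahSeries, coeff_mk, ahCoeff_zero, map_one]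
  have key := coeff_eq_of_X_mul_derivative (M := p ^ N)
    (G₁ := ghostProd e Z N * ghostProd e Y N) (G₂ := ghostProd e (Z + Y) N)
    (L₁ := ghostSum Z N + ghostSum Y N) (L₂ := ghostSum (Z + Y) N) (by
      rw [Derivation.leibniz, smul_eq_mul, smul_eq_mul]
      linear_combination ghostProd e Y N * X_mul_derivative_ghostProd hde Z N +
        ghostProd e Z N * X_mul_derivative_ghostProd hde Y N)
    (X_mul_derivative_ghostProd hde _ N)
    (by
      rw [coeff_zero_eq_constantCoeff_apply, map_mul, ← coeff_zero_eq_constantCoeff_apply,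
        ← coeff_zero_eq_constantCoeff_apply, coeff_zero_ghostProd he0, coeff_zero_ghostProd he0,
        coeff_zero_ghostProd he0, mul_one])
    (by rw [map_add, coeff_zero_ghostSum, coeff_zero_ghostSum, add_zero])
    (fun k hk => coeff_ghostSum_add Z Y hk) k hk
  have h := congrArg f key
  rw [← coeff_map, ← coeff_map, map_mul, map_ghostProd, map_ghostProd, map_ghostProd, he, map_add,
    hZ, hY] at h
  exact h

end artinHasse

/-! ### The canonical character `λ` on the formal Witt group -/

section character

variable {p : ℕ} [hp : Fact p.Prime] {T : Type u} [CommRing T]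

/-- The characteristic of `T` is only known to divide `p`, since `T` may be the zero ring. -/
theorem exists_zmodHom (hT : (p : T) = 0) : Nonempty (ZMod p →+* T) := by
  obtain ⟨c, hc⟩ := CharP.exists T
  exact ⟨ZMod.castHom ((CharP.cast_eq_zero_iff T c p).1 hT) T⟩

variable (p) in
/-- The value `E(t)` of the Artin–Hasse exponential at a nilpotent element `t`. -/
noncomputable def ahEval (t : T) : T :=
  ∑ᶠ k : ℕ, ((PadicInt.toZMod (ahCoeff p k)).val : T) * t ^ k

theorem zmodHom_apply (ψ : ZMod p →+* T) (c : ZMod p) : ψ c = (c.val : T) := by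
  rw [← map_natCast ψ, ZMod.natCast_zmod_val]

theorem ahEval_eq_sum {t : T} {m : ℕ} (h : t ^ m = 0) :
    ahEval p t = ∑ k ∈ Finset.range m, ((PadicInt.toZMod (ahCoeff p k)).val : T) * t ^ k := by
  refine finsum_eq_sum_of_support_subset _ fun k hk => ?_
  by_contra h1
  have h2 : m ≤ k := by simpa using h1
  exact hk (by simp only [pow_eq_zero_of_le h2 h, mul_zero])

theorem ahEval_of_sq_eq_zero (hT : (p : T) = 0) {t : T} (h : t ^ 2 = 0) : ahEval p t = 1 + t := by
  obtain ⟨ψ⟩ := exists_zmodHom hT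
  rw [ahEval_eq_sum h, Finset.sum_range_succ, Finset.sum_range_one, ahCoeff_zero, ahCoeff_one,
    ← zmodHom_apply ψ]
  simp

theorem ahEval_zero (hT : (p : T) = 0) : ahEval p (0 : T) = 1 := by
  rw [ahEval_of_sq_eq_zero hT (by simp), add_zero]

theorem map_ahEval {S : Type v} [CommRing S] (f : T →+* S) {t : T} (ht : IsNilpotent t) :
    f (ahEval p t) = ahEval p (f t) := by
  obtain ⟨m, hm⟩ := ht
  rw [ahEval_eq_sum hm, ahEval_eq_sum (t := f t) (m := m) (by rw [← map_pow, hm, map_zero]),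
    map_sum]
  simp

theorem hatCharacter_eq_prod (hT : (p : T) = 0) {z : WittVector p T} {s : Finset ℕ}
    (h : ∀ i ∉ s, z.coeff i = 0) : hatCharacter p z = ∏ i ∈ s, ahEval p (z.coeff i) := by
  refine finprod_eq_prod_of_mulSupport_subset _ fun i hi => ?_
  by_contra h1
  exact hi ((congrArg (ahEval p) (h i h1)).trans (ahEval_zero hT))

theorem IsFormal.exists_bound {z : WittVector p T} (hz : IsFormal z) :
    ∃ N, ∀ i, N ≤ i → z.coeff i = 0 := by
  obtain ⟨N, hN⟩ := hz.2.bddAbove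
  refine ⟨N + 1, fun i hi => ?_⟩
  by_contra h
  exact absurd (hN h) (by omega)

theorem hatCharacter_eq_prod_range (hT : (p : T) = 0) {z : WittVector p T} {N : ℕ}
    (h : ∀ i, N ≤ i → z.coeff i = 0) :
    hatCharacter p z = ∏ i ∈ Finset.range N, ahEval p (z.coeff i) :=
  hatCharacter_eq_prod hT fun i hi => h i (by simpa using hi)

open Polynomial in
theorem exists_polynomial_ahEval (ψ : ZMod p →+* T) {t : T} (ht : IsNilpotent t) :
    ∃ g : T[X], (g : PowerSeries T) =
      PowerSeries.rescale t (PowerSeries.map (ψ.comp PadicInt.toZMod) (ahSeries p)) ∧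
      g.eval 1 = ahEval p t := by
  obtain ⟨m, hm⟩ := ht
  refine ⟨∑ k ∈ Finset.range m,
    monomial k (((PadicInt.toZMod (ahCoeff p k)).val : T) * t ^ k), ?_, ?_⟩
  · ext k
    rw [Polynomial.coeff_coe, Polynomial.finsetSum_coeff, PowerSeries.coeff_rescale,
      PowerSeries.coeff_map, ahSeries, PowerSeries.coeff_mk, RingHom.comp_apply, zmodHom_apply]
    simp only [Polynomial.coeff_monomial, Finset.sum_ite_eq', Finset.mem_range]
    split_ifs with h
    · rw [mul_comm]
    · rw [pow_eq_zero_of_le (not_lt.1 h) hm, zero_mul]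
  · rw [ahEval_eq_sum hm, Polynomial.eval_finsetSum]
    simp

open Polynomial in
-- For nilpotent `zᵢ` each factor `E(zᵢ X ^ (p ^ i))` is a polynomial, and it is `1` once `zᵢ = 0`.
-- The product can therefore be evaluated at `X = 1`, which is impossible for a general power
-- series, and it is the same for all large `N`.
theorem IsFormal.exists_polynomial (ψ : ZMod p →+* T) (hT : (p : T) = 0) {z : WittVector p T}
    (hz : IsFormal z) : ∃ g : T[X], g.eval 1 = hatCharacter p z ∧ ∃ N₀, ∀ N, N₀ ≤ N →
      (g : PowerSeries T) =
        ghostProd (PowerSeries.map (ψ.comp PadicInt.toZMod) (ahSeries p)) z N := by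
  obtain ⟨N₀, hN₀⟩ := hz.exists_bound
  choose g hg hg' using fun i => exists_polynomial_ahEval ψ (hz.1 i)
  refine ⟨∏ i ∈ Finset.range N₀, expand T (p ^ i) (g i), ?_, N₀, fun N hN => ?_⟩
  · rw [hatCharacter_eq_prod_range hT hN₀, eval_prod]
    simp [hg', expand_eval]
  · have h1 : ∀ i, ((expand T (p ^ i) (g i) : T[X]) : PowerSeries T) =
        PowerSeries.expand (p ^ i) (pow_ne_zero i hp.out.ne_zero) (PowerSeries.rescale (z.coeff i)
          (PowerSeries.map (ψ.comp PadicInt.toZMod) (ahSeries p))) := fun i => by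
      rw [← hg]
      ext k
      rw [Polynomial.coeff_coe, Polynomial.coeff_expand (pow_pos hp.out.pos i),
        PowerSeries.coeff_expand]
      simp only [Polynomial.coeff_coe]
    rw [ghostProd, ← Finset.prod_subset (Finset.range_subset_range.2 hN)]
    · rw [← Polynomial.coeToPowerSeries.ringHom_apply, map_prod]
      exact Finset.prod_congr rfl fun i _ => h1 i
    · intro i _ hi
      rw [hN₀ i (by simpa using hi), PowerSeries.rescale_zero_apply,
        ← PowerSeries.coeff_zero_eq_constantCoeff_apply, PowerSeries.coeff_map, ahSeries,
        PowerSeries.coeff_mk, ahCoeff_zero]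
      simp

/-- The canonical character is additive on the formal Witt group. -/
theorem hatCharacter_add (hT : (p : T) = 0) {z y : WittVector p T} (hz : IsFormal z)
    (hy : IsFormal y) : hatCharacter p (z + y) = hatCharacter p z * hatCharacter p y := by
  obtain ⟨ψ⟩ := exists_zmodHom hT
  obtain ⟨g₁, h₁, N₁, hN₁⟩ := hz.exists_polynomial ψ hT
  obtain ⟨g₂, h₂, N₂, hN₂⟩ := hy.exists_polynomial ψ hT
  obtain ⟨g₃, h₃, N₃, hN₃⟩ := (hz.add hy).exists_polynomial ψ hT
  have h : g₁ * g₂ = g₃ := by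
    ext k
    -- The truncation index depends on the degree: it puts `k` in the range where the series
    -- identity holds, and it exceeds the three bounds beyond which the products are the polynomials
    -- `g₁`, `g₂`, `g₃`.
    have hk : k < p ^ (k + N₁ + N₂ + N₃) :=
      (Nat.lt_pow_self hp.out.one_lt).trans_le (Nat.pow_le_pow_right hp.out.pos (by omega))
    have := coeff_ghostProd_mul (ψ.comp PadicInt.toZMod) z y hk
    rw [← hN₁ _ (by omega), ← hN₂ _ (by omega), ← hN₃ _ (by omega), ← Polynomial.coe_mul,
      Polynomial.coeff_coe, Polynomial.coeff_coe] at this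
    exact this
  rw [← h₁, ← h₂, ← h₃, ← h, Polynomial.eval_mul]

theorem hatCharacter_zero (hT : (p : T) = 0) : hatCharacter p (0 : WittVector p T) = 1 := by
  rw [hatCharacter_eq_prod hT (s := ∅) fun i _ => WittVector.zero_coeff p T i, Finset.prod_empty]

/-- The shift only inserts the factor `E(0) = 1`. This invariance is the source of both adjunctions
between `F` and `V`. -/
theorem hatCharacter_verschiebung (hT : (p : T) = 0) {z : WittVector p T} (hz : IsFormal z) :
    hatCharacter p (WittVector.verschiebung z) = hatCharacter p z := by
  obtain ⟨N, hN⟩ := hz.exists_bound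
  rw [hatCharacter_eq_prod_range hT hN, hatCharacter_eq_prod_range hT (N := N + 1),
    Finset.prod_range_succ', WittVector.verschiebung_coeff_zero, ahEval_zero hT, mul_one]
  · rfl
  · intro i hi
    obtain ⟨i, rfl⟩ := Nat.exists_eq_succ_of_ne_zero (by omega : i ≠ 0)
    exact hN i (by omega)

theorem map_hatCharacter (hT : (p : T) = 0) {S : Type v} [CommRing S] (f : T →+* S)
    {z : WittVector p T} (hz : IsFormal z) :
    f (hatCharacter p z) = hatCharacter p (WittVector.map f z) := by
  have hS : (p : S) = 0 := by rw [← map_natCast f, hT, map_zero]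
  obtain ⟨N, hN⟩ := hz.exists_bound
  rw [hatCharacter_eq_prod_range hT hN, hatCharacter_eq_prod_range hS (N := N), map_prod]
  · exact Finset.prod_congr rfl fun i _ => by rw [map_ahEval f (hz.1 i), WittVector.map_coeff]
  · intro i hi
    rw [WittVector.map_coeff, hN i hi, map_zero]

theorem hatCharacter_teichmuller (hT : (p : T) = 0) (t : T) :
    hatCharacter p (WittVector.teichmuller p t) = ahEval p t := by
  rw [hatCharacter_eq_prod_range hT (N := 1), Finset.prod_range_one,
    WittVector.teichmuller_coeff_zero]
  exact fun i hi => WittVector.teichmuller_coeff_pos p _ _ hi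

end character

/-! ### Sums of Teichmüller representatives and adjunction of `p`-th roots -/

section witt

variable {p : ℕ} [hp : Fact p.Prime] {T : Type u} [CommRing T]

theorem coeff_iterate_verschiebung_teichmuller (i j : ℕ) (t : T) :
    (WittVector.verschiebung^[i] (WittVector.teichmuller p t)).coeff j = if j = i then t else 0 := by
  rcases lt_trichotomy j i with h | rfl | h
  · rw [WittVector.iterate_verschiebung_coeff_eq_zero _ h, if_neg h.ne]
  · have := WittVector.iterate_verschiebung_coeff (WittVector.teichmuller p t) j 0
    rw [zero_add] at this
    rw [this, WittVector.teichmuller_coeff_zero, if_pos rfl]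
  · obtain ⟨k, rfl⟩ := Nat.exists_eq_add_of_lt h
    rw [show i + k + 1 = (k + 1) + i by omega, WittVector.iterate_verschiebung_coeff,
      WittVector.teichmuller_coeff_pos p _ _ k.succ_pos, if_neg (by omega)]

/-- A Witt vector with finitely many nonzero components is a finite sum of shifted Teichmüller
representatives. -/
theorem eq_sum_verschiebung_teichmuller {x : WittVector p T} {N : ℕ}
    (h : ∀ i, N ≤ i → x.coeff i = 0) :
    x = ∑ i ∈ Finset.range N, WittVector.verschiebung^[i] (WittVector.teichmuller p (x.coeff i)) := by
  -- The partial sum lives in components below `m` and the next summand in component `m`. For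
  -- disjoint supports Witt vector addition is addition of components, without carries.
  have key : ∀ m j, (∑ i ∈ Finset.range m,
      WittVector.verschiebung^[i] (WittVector.teichmuller p (x.coeff i))).coeff j =
        if j < m then x.coeff j else 0 := by
    intro m
    induction m with
    | zero => simp
    | succ m ih =>
      intro j
      rw [Finset.sum_range_succ, WittVector.coeff_add_of_disjoint, ih,
        coeff_iterate_verschiebung_teichmuller]
      · rcases lt_trichotomy j m with hj | rfl | hj
        · rw [if_pos hj, if_neg hj.ne, if_pos (by omega), add_zero]
        · rw [if_neg (lt_irrefl _), if_pos rfl, if_pos (by omega), zero_add]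
        · rw [if_neg (by omega), if_neg (by omega), if_neg (by omega), add_zero]
      · intro k
        rw [ih, coeff_iterate_verschiebung_teichmuller]
        by_cases hk : k = m
        · exact Or.inl (if_neg (by omega))
        · exact Or.inr (if_neg hk)
  ext j
  rw [key]
  split_ifs with hj
  exacts [rfl, h j (not_lt.1 hj)]

open Polynomial in
/-- Addition of Witt vectors is homogeneous, where the `i`-th component has degree `p ^ i`. -/
theorem add_coeff_mem_pow (I : Ideal T) {a b : WittVector p T} (ha : ∀ i, a.coeff i ∈ I ^ p ^ i)
    (hb : ∀ i, b.coeff i ∈ I ^ p ^ i) (i : ℕ) : (a + b).coeff i ∈ I ^ p ^ i := by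
  -- Multiplication by `[X]` replaces the `i`-th component `zᵢ` by `zᵢ X ^ (p ^ i)`, and `zᵢ ∈ I ^
  -- (p ^ i)` says that this lies in the Rees algebra. As a subring, the Rees algebra is stable
  -- under the addition polynomials.
  have h : C ((a + b).coeff i) * X ^ p ^ i ∈ reesAlgebra I := by
    rw [← coeff_map_C_mul, map_add, add_mul, WittVector.add_coeff]
    apply peval_mem
    intro k j
    fin_cases k
    · simpa [coeff_map_C_mul, C_mul_X_pow_eq_monomial] using reesAlgebra.monomial_mem.2 (ha j)
    · simpa [coeff_map_C_mul, C_mul_X_pow_eq_monomial] using reesAlgebra.monomial_mem.2 (hb j)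
  rwa [C_mul_X_pow_eq_monomial, reesAlgebra.monomial_mem] at h

open Polynomial in
-- In `ℤ[x][y]` the ghost component of index `1` gives `xᵖ + yᵖ = (x + y)ᵖ + p s` for the component
-- `s` in question. Modulo `y²`, where `yᵖ` vanishes since `p ≥ 2`, this reads `p (s + xᵖ⁻¹y) = 0`,
-- and `p` cancels coefficientwise before specializing.
theorem teichmuller_add_coeff_one {x y : T} (hy : y ^ 2 = 0) :
    (WittVector.teichmuller p x + WittVector.teichmuller p y).coeff 1 = -(x ^ (p - 1) * y) := by
  let U := Polynomial (Polynomial ℤ)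
  let x₀ : U := C X
  let y₀ : U := X
  have key : X ^ 2 ∣ (WittVector.teichmuller p x₀ + WittVector.teichmuller p y₀).coeff 1 +
      x₀ ^ (p - 1) * y₀ := by
    have h := map_add (WittVector.ghostComponent (p := p) (R := U) 1) (WittVector.teichmuller p x₀)
      (WittVector.teichmuller p y₀)
    rw [WittVector.ghostComponent_teichmuller, WittVector.ghostComponent_teichmuller,
      WittVector.ghostComponent_apply, aeval_wittPolynomial, Finset.sum_range_succ,
      Finset.sum_range_one, WittVector.add_coeff_zero, WittVector.teichmuller_coeff_zero,
      WittVector.teichmuller_coeff_zero] at h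
    obtain ⟨W, hW⟩ := Polynomial.powAddExpansion x₀ y₀ p
    have hp2 : y₀ ^ p = X ^ 2 * X ^ (p - 2) := by
      rw [← pow_add, Nat.add_sub_cancel' hp.out.two_le]
    have h2 : (p : U) * ((WittVector.teichmuller p x₀ + WittVector.teichmuller p y₀).coeff 1 +
        x₀ ^ (p - 1) * y₀) = X ^ 2 * (X ^ (p - 2) - W) := by
      simp only [pow_zero, Nat.sub_zero, pow_one, Nat.sub_self, one_mul] at h
      rw [hW] at h
      linear_combination h + hp2
    rw [X_pow_dvd_iff]
    intro d hd
    have h3 : ((p : U) * ((WittVector.teichmuller p x₀ + WittVector.teichmuller p y₀).coeff 1 +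
        x₀ ^ (p - 1) * y₀)).coeff d = 0 := by
      rw [h2, coeff_X_pow_mul', if_neg (by omega)]
    rw [← C_eq_natCast, coeff_C_mul] at h3
    exact (mul_eq_zero.1 h3).resolve_left (Nat.cast_ne_zero.2 hp.out.ne_zero)
  obtain ⟨W, hW⟩ := key
  let f : U →+* T := eval₂RingHom (eval₂RingHom (Int.castRingHom T) x) y
  have hx : f x₀ = x := (eval₂_C _ _).trans (eval₂_X _ _)
  have hy' : f y₀ = y := eval₂_X _ _
  have h := congrArg f hW
  rw [map_add, map_mul, map_mul, map_pow, map_pow, hx, hy', hy, zero_mul,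
    ← WittVector.map_coeff, map_add, WittVector.map_teichmuller, WittVector.map_teichmuller, hx,
    hy'] at h
  exact eq_neg_of_add_eq_zero_left h

/-- If `xᵖ = 0` and `y² = 0`, then `[x] + [y] = [x + y] + V[-xᵖ⁻¹y]`. -/
theorem teichmuller_add {x y : T} (hx : x ^ p = 0) (hy : y ^ 2 = 0) :
    WittVector.teichmuller p x + WittVector.teichmuller p y = WittVector.teichmuller p (x + y) +
      WittVector.verschiebung (WittVector.teichmuller p (-(x ^ (p - 1) * y))) := by
  ext k
  -- On the right-hand side the first summand has only component `0` and the second only component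
  -- `1`, so their sum is componentwise.
  rw [WittVector.coeff_add_of_disjoint k (WittVector.teichmuller p (x + y))]
  · match k with
    | 0 =>
      rw [WittVector.add_coeff_zero, WittVector.verschiebung_coeff_zero]
      simp only [WittVector.teichmuller_coeff_zero, add_zero]
    | 1 =>
      rw [teichmuller_add_coeff_one hy, WittVector.teichmuller_coeff_pos p _ _ one_pos, zero_add,
        show (1 : ℕ) = 0 + 1 from rfl, WittVector.verschiebung_coeff_add_one,
        WittVector.teichmuller_coeff_zero]
    | k + 2 =>
      rw [WittVector.teichmuller_coeff_pos p _ _ (by omega), zero_add,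
        show k + 2 = (k + 1) + 1 from rfl, WittVector.verschiebung_coeff_add_one,
        WittVector.teichmuller_coeff_pos p _ _ (by omega)]
      -- Components of index at least `2` vanish by homogeneity: they lie in `(x, y) ^ (p ^ (k +
      -- 2))`, and `p + 2 ≤ p²` puts this inside `(xᵖ) + (y²) = 0`.
      have h : ∀ z ∈ Ideal.span {x} ⊔ Ideal.span {y}, ∀ i, (WittVector.teichmuller p z).coeff i ∈
          (Ideal.span {x} ⊔ Ideal.span {y}) ^ p ^ i := by
        intro z hz i
        cases i with
        | zero => simpa using hz
        | succ i => rw [WittVector.teichmuller_coeff_pos p _ _ i.succ_pos]; exact zero_mem _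
      have h1 := add_coeff_mem_pow _
        (h x (Ideal.mem_sup_left (Ideal.mem_span_singleton_self x)))
        (h y (Ideal.mem_sup_right (Ideal.mem_span_singleton_self y))) (k + 2)
      have h2 : p + 2 ≤ p ^ (k + 1 + 1) := by
        have h3 := hp.out.two_le
        have h4 : p ^ 2 ≤ p ^ (k + 2) := Nat.pow_le_pow_right hp.out.pos (by omega)
        nlinarith
      have h5 := Ideal.sup_pow_add_le_pow_sup_pow (Ideal.pow_le_pow_right h2 h1)
      rw [Ideal.span_singleton_pow, Ideal.span_singleton_pow, hx, hy] at h5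
      simpa using h5
  · intro j
    cases j with
    | zero => exact Or.inr (WittVector.verschiebung_coeff_zero _)
    | succ j => exact Or.inl (WittVector.teichmuller_coeff_pos p _ _ j.succ_pos)

theorem add_pow_of_sq_eq_zero (hT : (p : T) = 0) {x y : T} (hy : y ^ 2 = 0) :
    (x + y) ^ p = x ^ p := by
  obtain ⟨W, hW⟩ := Polynomial.powAddExpansion x y p
  rw [hW, hT, hy]
  ring

theorem eq_zero_of_natCast_mul (hT : (p : T) = 0) {m : ℕ} (hm : ¬ p ∣ m) {a : T}
    (h : (m : T) * a = 0) : a = 0 := by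
  obtain ⟨r, s, hrs⟩ := Nat.isCoprime_iff_coprime.2 ((hp.out.coprime_iff_not_dvd).2 hm)
  have h1 := congrArg (Int.cast : ℤ → T) hrs
  push_cast at h1
  rw [hT] at h1
  linear_combination s * h - a * h1

open Polynomial in
/-- Finitely many elements of an algebra become `p`-th powers in some larger algebra. -/
theorem exists_pow_eq (p : ℕ) [hp : Fact p.Prime] (A : Type u) [CommRing A] (l : List T)
    [Algebra A T] : ∃ (T' : Type u) (_ : CommRing T') (_ : Algebra A T') (f : T →ₐ[A] T'),
      Function.Injective f ∧ ∀ t ∈ l, ∃ s, s ^ p = f t := by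
  induction l with
  | nil => exact ⟨T, inferInstance, inferInstance, AlgHom.id A T, fun _ _ h => h, by simp⟩
  | cons t l ih =>
    obtain ⟨T', _, _, f, hf, h⟩ := ih
    have hmon : (X ^ p - C (f t)).Monic := monic_X_pow_sub_C _ hp.out.ne_zero
    refine ⟨AdjoinRoot (X ^ p - C (f t)), inferInstance, inferInstance,
      (AdjoinRoot.ofAlgHom A _).comp f, ?_, ?_⟩
    · refine Function.Injective.comp (g := AdjoinRoot.ofAlgHom A (X ^ p - C (f t))) ?_ hf
      rw [injective_iff_map_eq_zero]
      intro a ha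
      by_contra ha0
      -- A nonzero constant is not divisible by a monic polynomial of positive degree; hence
      -- adjoining a `p`-th root is an injective extension.
      have h1 : X ^ p - C (f t) ∣ C a := AdjoinRoot.mk_eq_zero.1 ha
      rcases subsingleton_or_nontrivial T' with hs | hs
      · exact ha0 (Subsingleton.elim _ _)
      refine hmon.not_dvd_of_natDegree_lt (C_ne_zero.2 ha0) ?_ h1
      rw [natDegree_C, natDegree_X_pow_sub_C]
      exact hp.out.pos
    · intro s hs
      rcases List.mem_cons.1 hs with rfl | hs
      · refine ⟨AdjoinRoot.root _, ?_⟩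
        have := AdjoinRoot.eval₂_root (X ^ p - C (f s))
        rw [eval₂_sub, eval₂_pow, eval₂_X, eval₂_C, sub_eq_zero] at this
        exact this
      · obtain ⟨r, hr⟩ := h s hs
        exact ⟨AdjoinRoot.of _ r, by rw [← map_pow, hr]; rfl⟩

end witt

/-! ### Characters of `Ŵ^(Fⁿ)` and the polynomials describing them -/

section duality

variable {p : ℕ} [hp : Fact p.Prime] {n : ℕ} {A : Type u} [CommRing A]

variable (p n A) in
/-- A homomorphism `Ŵ^(Fⁿ) → 𝔾_m` over `A`. -/
structure HatChar where
  /-- The homomorphism on `T`-points. -/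
  toFun : ∀ (T : Type u) [CommRing T] [Algebra A T], HatW p n T → T
  map_zero : ∀ (T : Type u) [CommRing T] [Algebra A T], toFun T 0 = 1
  map_add : ∀ (T : Type u) [CommRing T] [Algebra A T] (a b : HatW p n T),
    toFun T (a + b) = toFun T a * toFun T b
  natural : ∀ (T T' : Type u) [CommRing T] [Algebra A T] [CommRing T'] [Algebra A T']
    (f : T →ₐ[A] T') (a : HatW p n T), toFun T' (hatMap f a) = f (toFun T a)

theorem natCast_eq_zero_of_algebra (hA : (p : A) = 0) (T : Type v) [CommRing T] [Algebra A T] :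
    (p : T) = 0 := by
  rw [← map_natCast (algebraMap A T), hA, map_zero]

theorem isFormal_mul_map {T : Type u} [CommRing T] [Algebra A T] (a : HatW p n T)
    (w : WittVector p A) :
    IsFormal ((a : WittVector p T) * WittVector.map (algebraMap A T) w) := by
  rw [mul_comm]
  exact a.2.1.mul _

theorem map_algebraMap_comp {T T' : Type u} [CommRing T] [Algebra A T] [CommRing T'] [Algebra A T']
    (f : T →ₐ[A] T') (w : WittVector p A) :
    WittVector.map (f : T →+* T') (WittVector.map (algebraMap A T) w) =
      WittVector.map (algebraMap A T') w := by
  ext i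
  simp [WittVector.map_coeff]

theorem map_hatCharacter_mul (hA : (p : A) = 0) (w : WittVector p A) {T T' : Type u} [CommRing T]
    [Algebra A T] [CommRing T'] [Algebra A T'] (f : T →ₐ[A] T') (a : HatW p n T) :
    hatCharacter p (((hatMap f a : HatW p n T') : WittVector p T') * WittVector.map (algebraMap A T') w) =
      f (hatCharacter p ((a : WittVector p T) * WittVector.map (algebraMap A T) w)) := by
  have h := map_hatCharacter (natCast_eq_zero_of_algebra hA T) (f : T →+* T')
    (isFormal_mul_map a w)
  rw [map_mul, map_algebraMap_comp] at h
  exact h.symm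

/-- The character `a ↦ χ(a) λ(a w)`. -/
noncomputable def HatChar.twist (χ : HatChar p n A) (hA : (p : A) = 0) (w : WittVector p A) :
    HatChar p n A where
  toFun T _ _ a := χ.toFun T a * hatCharacter p ((a : WittVector p T) * WittVector.map (algebraMap A T) w)
  map_zero T _ _ := by
    rw [χ.map_zero, one_mul]
    refine (congrArg (hatCharacter p) ?_).trans
      (hatCharacter_zero (natCast_eq_zero_of_algebra hA T))
    exact zero_mul _
  map_add T _ _ a b := by
    rw [χ.map_add, mul_mul_mul_comm, ← hatCharacter_add (natCast_eq_zero_of_algebra hA T)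
      (isFormal_mul_map a w) (isFormal_mul_map b w), ← add_mul]
    rfl
  natural T T' _ _ _ _ f a := by
    rw [χ.natural, map_mul, map_hatCharacter_mul hA]

theorem HatChar.map_sum (χ : HatChar p n A) (T : Type u) [CommRing T] [Algebra A T]
    {ι : Type v} (s : Finset ι) (a : ι → HatW p n T) :
    χ.toFun T (∑ i ∈ s, a i) = ∏ i ∈ s, χ.toFun T (a i) := by
  classical
  induction s using Finset.induction_on with
  | empty => exact χ.map_zero T
  | insert i s hi ih => rw [Finset.sum_insert hi, Finset.prod_insert hi, χ.map_add, ih]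

/-- The element `Vⁱ[t]` of `Ŵ^(Fⁿ)(T)`, where `t ^ pⁿ = 0`. -/
noncomputable def hatSingle {T : Type u} [CommRing T] (hT : (p : T) = 0) (i : ℕ) (t : T)
    (ht : t ^ p ^ n = 0) : HatW p n T :=
  ⟨WittVector.verschiebung^[i] (WittVector.teichmuller p t), ⟨fun j => by
      rw [coeff_iterate_verschiebung_teichmuller]
      split_ifs
      exacts [⟨_, ht⟩, IsNilpotent.zero],
    (Set.finite_singleton i).subset fun j hj => by
      rw [Set.mem_ofPred_eq, coeff_iterate_verschiebung_teichmuller] at hj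
      by_contra h
      exact hj (if_neg h)⟩, by
    ext j
    rw [coeff_iterate_frobenius hT, coeff_iterate_verschiebung_teichmuller, WittVector.zero_coeff]
    split_ifs
    exacts [ht, zero_pow (pow_ne_zero _ hp.out.ne_zero)]⟩

theorem hatMap_hatSingle {T T' : Type u} [CommRing T] [Algebra A T] [CommRing T'] [Algebra A T']
    (f : T →ₐ[A] T') (hT : (p : T) = 0) (hT' : (p : T') = 0) (i : ℕ) {t : T} (ht : t ^ p ^ n = 0)
    {t' : T'} (ht' : t' ^ p ^ n = 0) (h : f t = t') :
    hatMap f (hatSingle hT i t ht) = hatSingle hT' i t' ht' := by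
  refine Subtype.ext (WittVector.ext fun j => ?_)
  change f ((WittVector.verschiebung^[i] (WittVector.teichmuller p t)).coeff j) =
    (WittVector.verschiebung^[i] (WittVector.teichmuller p t')).coeff j
  rw [coeff_iterate_verschiebung_teichmuller, coeff_iterate_verschiebung_teichmuller]
  split_ifs
  exacts [h, _root_.map_zero f]

theorem HatW.coeff_pow {T : Type u} [CommRing T] (hT : (p : T) = 0) (a : HatW p n T) (i : ℕ) :
    (a : WittVector p T).coeff i ^ p ^ n = 0 := by
  rw [← coeff_iterate_frobenius hT, a.2.2, WittVector.zero_coeff]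

theorem HatW.eq_sum {T : Type u} [CommRing T] (hT : (p : T) = 0) (a : HatW p n T) {N : ℕ}
    (h : ∀ i, N ≤ i → (a : WittVector p T).coeff i = 0) :
    a = ∑ i ∈ Finset.range N, hatSingle hT i ((a : WittVector p T).coeff i) (a.coeff_pow hT i) := by
  refine Subtype.ext ((eq_sum_verschiebung_teichmuller h).trans ?_)
  exact (map_sum (hatWIdeal p n T).subtype (fun i =>
    hatSingle hT i ((a : WittVector p T).coeff i) (a.coeff_pow hT i)) (Finset.range N)).symm

open Polynomial

/-- The family of polynomials `fᵢ` describes the character `χ` if `χ(Vⁱ[t]) = fᵢ(t)`. -/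
structure HatChar.IsDescribed (χ : HatChar p n A) (hA : (p : A) = 0) (f : ℕ → A[X]) : Prop where
  eq_aeval : ∀ (i : ℕ) (T : Type u) [CommRing T] [Algebra A T] (t : T) (ht : t ^ p ^ n = 0),
    χ.toFun T (hatSingle (natCast_eq_zero_of_algebra hA T) i t ht) = aeval t (f i)
  coeff_eq_zero : ∀ i k, p ^ n ≤ k → (f i).coeff k = 0

/-- This is Yoneda's lemma: elements with `t ^ (p ^ n) = 0` are represented by `A[X]/(X ^ (p ^ n))`,
and `fᵢ` is the value of the character at `Vⁱ` of the universal Teichmüller element. Reduction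
modulo the monic `X ^ (p ^ n)` supplies the degree bound. -/
theorem HatChar.exists_isDescribed (χ : HatChar p n A) (hA : (p : A) = 0) :
    ∃ f, χ.IsDescribed hA f := by
  let g : A[X] := X ^ p ^ n
  have hg : g.Monic := monic_X_pow _
  have hroot : (AdjoinRoot.root g) ^ p ^ n = 0 := by
    have := AdjoinRoot.eval₂_root g
    rwa [eval₂_X_pow] at this
  choose f hf using fun i => AdjoinRoot.mk_surjective (χ.toFun (AdjoinRoot g)
    (hatSingle (natCast_eq_zero_of_algebra hA _) i (AdjoinRoot.root g) hroot))
  refine ⟨fun i => f i %ₘ g, ⟨fun i T _ _ t ht => ?_, fun i k hk => ?_⟩⟩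
  · let φ : AdjoinRoot g →ₐ[A] T := AdjoinRoot.liftAlgHom g (Algebra.ofId A T) t (by
      rw [eval₂_X_pow, ht])
    have hφ : φ (AdjoinRoot.root g) = t := AdjoinRoot.liftAlgHom_root _ _ _ _
    rw [← hatMap_hatSingle φ (natCast_eq_zero_of_algebra hA _) _ i hroot ht hφ, χ.natural, ← hf]
    change eval₂ (algebraMap A T) t (f i) = _
    conv_lhs => rw [← modByMonic_add_div (f i) g]
    rw [← aeval_def, _root_.map_add, map_mul]
    simp [g, ht]
  · rcases subsingleton_or_nontrivial A with h | h
    · exact Subsingleton.elim _ _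
    · refine coeff_eq_zero_of_degree_lt ((degree_modByMonic_lt _ hg).trans_le ?_)
      rw [degree_X_pow]
      exact_mod_cast hk

namespace HatChar.IsDescribed

variable {χ : HatChar p n A} {hA : (p : A) = 0} {f : ℕ → A[X]}

theorem eq_prod (hf : χ.IsDescribed hA f) {T : Type u} [CommRing T] [Algebra A T] (a : HatW p n T)
    {N : ℕ} (h : ∀ i, N ≤ i → (a : WittVector p T).coeff i = 0) :
    χ.toFun T a = ∏ i ∈ Finset.range N, aeval ((a : WittVector p T).coeff i) (f i) := by
  conv_lhs => rw [a.eq_sum (natCast_eq_zero_of_algebra hA T) h]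
  rw [χ.map_sum]
  exact Finset.prod_congr rfl fun i _ => hf.eq_aeval i T _ _

theorem coeff_zero (hf : χ.IsDescribed hA f) (i : ℕ) : (f i).coeff 0 = 1 := by
  have h0 : (0 : A) ^ p ^ n = 0 := zero_pow (pow_ne_zero _ hp.out.ne_zero)
  have h := hf.eq_aeval i A 0 h0
  have h1 : hatSingle (natCast_eq_zero_of_algebra hA A) i (0 : A) h0 = 0 := by
    refine Subtype.ext (WittVector.ext fun j => ?_)
    refine (coeff_iterate_verschiebung_teichmuller i j (0 : A)).trans ?_
    rw [ite_self]
    exact (WittVector.zero_coeff p A j).symm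
  rw [h1, χ.map_zero] at h
  simpa [coeff_zero_eq_aeval_zero] using h.symm

theorem aeval_of_sq_eq_zero (hf : χ.IsDescribed hA f) (i : ℕ) {T : Type u} [CommRing T]
    [Algebra A T] {t : T} (ht : t ^ 2 = 0) :
    aeval t (f i) = 1 + algebraMap A T ((f i).coeff 1) * t := by
  have h := aeval_add_of_sq_eq_zero (f i) (0 : T) t ht
  rw [zero_add, ← coeff_zero_eq_aeval_zero', ← coeff_zero_eq_aeval_zero', hf.coeff_zero, coeff_derivative] at h
  simpa using h

end HatChar.IsDescribed

end duality

/-! ### Characters with vanishing first tangent coefficient -/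

section duality

variable {p : ℕ} [hp : Fact p.Prime] {n : ℕ} {A : Type u} [CommRing A]

open Polynomial

variable (A) in
/-- There is an `A`-algebra with a universal element `x` such that `x ^ m = 0`. -/
theorem exists_truncated_polynomial (m : ℕ) :
    ∃ (B : Type u) (_ : CommRing B) (_ : Algebra A B) (x : B), x ^ m = 0 ∧
      ∀ f : A[X], aeval x f = 0 → ∀ k < m, f.coeff k = 0 := by
  refine ⟨AdjoinRoot (X ^ m : A[X]), inferInstance, inferInstance, AdjoinRoot.root _, ?_,
    fun f hf => ?_⟩
  · have := AdjoinRoot.eval₂_root (X ^ m : A[X])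
    rwa [eval₂_X_pow] at this
  · rwa [AdjoinRoot.aeval_eq, AdjoinRoot.mk_eq_zero, X_pow_dvd_iff] at hf

theorem dualNumber_inl_pow {B : Type u} [CommRing B] (x : B) (m : ℕ) :
    (TrivSqZeroExt.inl x : DualNumber B) ^ m = TrivSqZeroExt.inl (x ^ m) :=
  (map_pow (TrivSqZeroExt.inlHom B B) x m).symm

theorem aeval_inl {B : Type u} [CommRing B] [Algebra A B] (x : B) (f : A[X]) :
    aeval (TrivSqZeroExt.inl x : DualNumber B) f = TrivSqZeroExt.inl (aeval x f) :=
  aeval_algHom_apply (TrivSqZeroExt.inlAlgHom A B B) x f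

theorem aeval_inl_add_eps {B : Type u} [CommRing B] [Algebra A B] (x : B) (f : A[X]) :
    aeval (TrivSqZeroExt.inl x + DualNumber.eps : DualNumber B) f =
      TrivSqZeroExt.inl (aeval x f) + TrivSqZeroExt.inr (aeval x (derivative f)) := by
  rw [aeval_add_of_sq_eq_zero _ _ _ (by rw [pow_two, DualNumber.eps_mul_eps]), aeval_inl, aeval_inl]
  congr 1
  ext <;> simp

namespace HatChar.IsDescribed

variable {χ : HatChar p (n + 1) A} {hA : (p : A) = 0} {f : ℕ → A[X]}

/-- The character is applied to `Vⁱ` of the relation `[x] + [y] = [x + y] + V[-xᵖ⁻¹y]`. Because the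
exponent of `F` is `n + 1 ≥ 1`, all four terms lie in the kernel of `Fⁿ⁺¹`. -/
theorem aeval_mul_aeval (hf : χ.IsDescribed hA f) (i : ℕ) {T : Type u} [CommRing T] [Algebra A T]
    {x y : T} (hx : x ^ p = 0) (hy : y ^ 2 = 0) :
    aeval x (f i) * aeval y (f i) =
      aeval (x + y) (f i) * aeval (-(x ^ (p - 1) * y)) (f (i + 1)) := by
  have hT := natCast_eq_zero_of_algebra hA T
  have hle : p ≤ p ^ (n + 1) := Nat.le_self_pow n.succ_ne_zero p
  have hx' : x ^ p ^ (n + 1) = 0 := pow_eq_zero_of_le hle hx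
  have hy' : y ^ p ^ (n + 1) = 0 := pow_eq_zero_of_le (hp.out.two_le.trans hle) hy
  have hxy : (x + y) ^ p ^ (n + 1) = 0 :=
    pow_eq_zero_of_le hle ((add_pow_of_sq_eq_zero hT hy).trans hx)
  have hz : (-(x ^ (p - 1) * y)) ^ p ^ (n + 1) = 0 := by
    refine pow_eq_zero_of_le (hp.out.two_le.trans hle) ?_
    rw [neg_sq, mul_pow, hy, mul_zero]
  rw [← hf.eq_aeval i T x hx', ← hf.eq_aeval i T y hy', ← hf.eq_aeval i T _ hxy,
    ← hf.eq_aeval (i + 1) T _ hz, ← χ.map_add, ← χ.map_add]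
  congr 1
  refine Subtype.ext ?_
  change WittVector.verschiebung^[i] _ + WittVector.verschiebung^[i] _ =
    WittVector.verschiebung^[i] _ + WittVector.verschiebung^[i + 1] _
  rw [Function.iterate_succ_apply, ← iterate_map_add, ← iterate_map_add, teichmuller_add hx hy]

/-- Take `x` universal with `xᵖ = 0` and `y = ε`. Since `fᵢ(ε) = 1`, the relation reads `fᵢ(x) =
(fᵢ(x) + fᵢ'(x) ε)(1 - c xᵖ⁻¹ ε)` with `c` the linear coefficient of `fᵢ₊₁`, and its `ε`-part is the
differential equation `fᵢ' = c Xᵖ⁻¹ fᵢ` modulo `Xᵖ`. -/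
theorem coeff_derivative_sub (hf : χ.IsDescribed hA f) {i : ℕ} (hi : (f i).coeff 1 = 0) :
    ∀ k < p, (derivative (f i) - C ((f (i + 1)).coeff 1) * X ^ (p - 1) * f i).coeff k = 0 := by
  obtain ⟨B, _, _, x, hx, hB⟩ := exists_truncated_polynomial A p
  have hε : (DualNumber.eps : DualNumber B) ^ 2 = 0 := by rw [pow_two, DualNumber.eps_mul_eps]
  have h := hf.aeval_mul_aeval i (T := DualNumber B) (x := TrivSqZeroExt.inl x)
    (by rw [dualNumber_inl_pow, hx, TrivSqZeroExt.inl_zero]) hε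
  rw [aeval_inl_add_eps, aeval_inl, hf.aeval_of_sq_eq_zero i hε, hi, _root_.map_zero, zero_mul,
    add_zero, mul_one, hf.aeval_of_sq_eq_zero (i + 1) (by rw [neg_sq, mul_pow, hε, mul_zero])] at h
  have h2 := congrArg TrivSqZeroExt.snd h
  rw [dualNumber_inl_pow, TrivSqZeroExt.algebraMap_eq_inl'] at h2
  simp only [DualNumber.snd_mul, TrivSqZeroExt.snd_inl, TrivSqZeroExt.fst_add,
    TrivSqZeroExt.snd_add, TrivSqZeroExt.fst_inl, TrivSqZeroExt.fst_inr, TrivSqZeroExt.snd_inr,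
    TrivSqZeroExt.fst_one, TrivSqZeroExt.snd_one, TrivSqZeroExt.snd_neg, TrivSqZeroExt.fst_neg,
    TrivSqZeroExt.fst_mul, DualNumber.fst_eps, DualNumber.snd_eps] at h2
  apply hB
  rw [map_sub, map_mul, map_mul, aeval_C, map_pow, aeval_X]
  linear_combination -h2

/-- In degree `p - 1` the derivative contributes `p` times a coefficient, that is `0`, and the other
term contributes the linear coefficient of `fᵢ₊₁`. In lower degrees only `(k + 1)` times the
coefficient at `k + 1` remains, with `k + 1` prime to `p`. The first conclusion passes the
hypothesis on to `i + 1`. -/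
theorem coeff_eq_zero_of_coeff_one (hf : χ.IsDescribed hA f) {i : ℕ} (hi : (f i).coeff 1 = 0) :
    (f (i + 1)).coeff 1 = 0 ∧ ∀ k, 0 < k → k < p → (f i).coeff k = 0 := by
  have h := hf.coeff_derivative_sub hi
  have hc : ∀ k, (C ((f (i + 1)).coeff 1) * X ^ (p - 1) * f i).coeff k =
      if p - 1 ≤ k then (f (i + 1)).coeff 1 * (f i).coeff (k - (p - 1)) else 0 := fun k => by
    rw [mul_assoc, coeff_C_mul, coeff_X_pow_mul']
    split_ifs
    exacts [rfl, mul_zero _]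
  have hpos := hp.out.pos
  constructor
  · have h1 := h (p - 1) (by omega)
    rw [coeff_sub, hc, if_pos le_rfl, Nat.sub_self, hf.coeff_zero, mul_one, coeff_derivative,
      ← Nat.cast_succ, Nat.succ_eq_add_one, Nat.sub_add_cancel hpos, hA, mul_zero, zero_sub,
      neg_eq_zero] at h1
    exact h1
  · intro k hk hkp
    obtain ⟨k, rfl⟩ := Nat.exists_eq_succ_of_ne_zero hk.ne'
    have h1 := h k (by omega)
    rw [coeff_sub, hc, if_neg (by omega), coeff_derivative, sub_zero, ← Nat.cast_succ, mul_comm]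
      at h1
    exact eq_zero_of_natCast_mul hA (Nat.not_dvd_of_pos_of_lt hk hkp) h1

theorem coeff_eq_zero_of_lt (hf : χ.IsDescribed hA f) (h0 : (f 0).coeff 1 = 0) (i k : ℕ)
    (hk : 0 < k) (hkp : k < p) : (f i).coeff k = 0 := by
  have h1 : ∀ i, (f i).coeff 1 = 0 := fun i => by
    induction i with
    | zero => exact h0
    | succ i ih => exact (hf.coeff_eq_zero_of_coeff_one ih).1
  exact (hf.coeff_eq_zero_of_coeff_one (h1 i)).2 k hk hkp

theorem aeval_eq_one (hf : χ.IsDescribed hA f) (h0 : (f 0).coeff 1 = 0) (i : ℕ) {T : Type u}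
    [CommRing T] [Algebra A T] {t : T} (ht : t ^ p = 0) : aeval t (f i) = 1 := by
  have h : X ^ p ∣ f i - 1 := by
    rw [X_pow_dvd_iff]
    intro k hk
    rcases Nat.eq_zero_or_pos k with rfl | hk0
    · rw [coeff_sub, hf.coeff_zero, coeff_one_zero, sub_self]
    · rw [coeff_sub, hf.coeff_eq_zero_of_lt h0 i k hk0 hk, coeff_one, if_neg hk0.ne', sub_zero]
  obtain ⟨g, hg⟩ := h
  rw [sub_eq_iff_eq_add.1 hg, _root_.map_add, map_mul, map_pow, aeval_X, ht, zero_mul, zero_add,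
    map_one]

/-- If `χ` is trivial on the tangent space of the first coordinate, it is trivial on `Ŵ^(F)`. -/
theorem eq_one_of_frobenius_eq_zero (hf : χ.IsDescribed hA f) (h0 : (f 0).coeff 1 = 0) {T : Type u}
    [CommRing T] [Algebra A T] (a : HatW p (n + 1) T)
    (ha : WittVector.frobenius (a : WittVector p T) = 0) : χ.toFun T a = 1 := by
  have hT := natCast_eq_zero_of_algebra hA T
  obtain ⟨N, hN⟩ := a.2.1.exists_bound
  rw [hf.eq_prod a hN]
  refine Finset.prod_eq_one fun i _ => hf.aeval_eq_one h0 i ?_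
  rw [← coeff_frobenius hT, ha, WittVector.zero_coeff]

/-- Since `(x + ε)ᵖ = xᵖ`, the difference `Vⁱ[x + ε] - Vⁱ[x]` is killed by `F`, and the character is
trivial on it. Hence `fᵢ(x + ε) = fᵢ(x)` for the universal `x` with `x ^ (p ^ (n + 1)) = 0`. -/
theorem derivative_eq_zero (hf : χ.IsDescribed hA f) (h0 : (f 0).coeff 1 = 0) (i : ℕ) :
    derivative (f i) = 0 := by
  obtain ⟨B, _, _, x, hx, hB⟩ := exists_truncated_polynomial A (p ^ (n + 1))
  let T := DualNumber B
  have hT : (p : T) = 0 := natCast_eq_zero_of_algebra hA T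
  have hε : (DualNumber.eps : T) ^ 2 = 0 := by rw [pow_two, DualNumber.eps_mul_eps]
  have hxT : (TrivSqZeroExt.inl x : T) ^ p ^ (n + 1) = 0 := by
    rw [dualNumber_inl_pow, hx, TrivSqZeroExt.inl_zero]
  have hp1 : (TrivSqZeroExt.inl x + DualNumber.eps : T) ^ p = (TrivSqZeroExt.inl x : T) ^ p :=
    add_pow_of_sq_eq_zero hT hε
  have hxε : (TrivSqZeroExt.inl x + DualNumber.eps : T) ^ p ^ (n + 1) = 0 := by
    rw [pow_succ', pow_mul, hp1, ← pow_mul, ← pow_succ', hxT]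
  have h1 := hf.eq_one_of_frobenius_eq_zero h0
    (hatSingle hT i _ hxε - hatSingle hT i _ hxT) (by
      change WittVector.frobenius (WittVector.verschiebung^[i] _ - WittVector.verschiebung^[i] _) = 0
      rw [_root_.map_sub, sub_eq_zero]
      refine WittVector.ext fun j => ?_
      rw [coeff_frobenius hT, coeff_frobenius hT, coeff_iterate_verschiebung_teichmuller,
        coeff_iterate_verschiebung_teichmuller]
      split_ifs
      exacts [hp1, rfl])
  have h2 := χ.map_add T (hatSingle hT i _ hxε - hatSingle hT i _ hxT) (hatSingle hT i _ hxT)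
  rw [sub_add_cancel, h1, one_mul, hf.eq_aeval i T _ hxε, hf.eq_aeval i T _ hxT, aeval_inl,
    aeval_inl_add_eps] at h2
  have h3 : aeval x (derivative (f i)) = 0 := by simpa using congrArg TrivSqZeroExt.snd h2
  ext k
  rw [Polynomial.coeff_zero]
  -- The universal `x` detects coefficients only below `p ^ (n + 1)`; above, the degree bound on
  -- `fᵢ` takes over.
  by_cases hk : k < p ^ (n + 1)
  · exact hB _ h3 k hk
  · rw [coeff_derivative, hf.coeff_eq_zero i (k + 1) (by omega), zero_mul]

theorem expand_contract (hf : χ.IsDescribed hA f) (h0 : (f 0).coeff 1 = 0) (i : ℕ) :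
    expand A p (contract p (f i)) = f i := by
  ext k
  rw [coeff_expand hp.out.pos, coeff_contract hp.out.ne_zero]
  split_ifs with hk
  · rw [Nat.div_mul_cancel hk]
  · have hk0 : k ≠ 0 := by rintro rfl; exact hk (dvd_zero p)
    have h := congrArg (fun q => q.coeff (k - 1)) (hf.derivative_eq_zero h0 i)
    simp only [coeff_derivative, Polynomial.coeff_zero] at h
    rw [← Nat.cast_succ, Nat.succ_eq_add_one, Nat.sub_add_cancel (Nat.pos_of_ne_zero hk0),
      mul_comm] at h
    exact (eq_zero_of_natCast_mul hA hk h).symm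

end HatChar.IsDescribed

/-! ### Descent along the Frobenius -/

/-- The function `a ↦ ∏ᵢ gᵢ(aᵢ)`. -/
noncomputable def prodEval (g : ℕ → A[X]) {T : Type u} [CommRing T] [Algebra A T]
    (a : WittVector p T) : T :=
  ∏ᶠ i, aeval (a.coeff i) (g i)

theorem prodEval_eq {g : ℕ → A[X]} (hg : ∀ i, (g i).coeff 0 = 1) {T : Type u} [CommRing T]
    [Algebra A T] {a : WittVector p T} {N : ℕ} (h : ∀ i, N ≤ i → a.coeff i = 0) :
    prodEval g a = ∏ i ∈ Finset.range N, aeval (a.coeff i) (g i) := by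
  refine finprod_eq_prod_of_mulSupport_subset _ fun i hi => ?_
  by_contra h1
  refine hi ?_
  change aeval (a.coeff i) (g i) = 1
  rw [h i (by simpa using h1), ← coeff_zero_eq_aeval_zero', hg, map_one]

theorem prodEval_map {g : ℕ → A[X]} (hg : ∀ i, (g i).coeff 0 = 1) {T T' : Type u} [CommRing T]
    [Algebra A T] [CommRing T'] [Algebra A T'] (f : T →ₐ[A] T') {a : WittVector p T}
    (ha : IsFormal a) : prodEval g (WittVector.map (f : T →+* T') a) = f (prodEval g a) := by
  obtain ⟨N, hN⟩ := ha.exists_bound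
  rw [prodEval_eq hg hN, prodEval_eq hg (N := N), map_prod]
  · refine Finset.prod_congr rfl fun i _ => ?_
    rw [WittVector.map_coeff]
    exact aeval_algHom_apply f _ _
  · intro i hi
    rw [WittVector.map_coeff, hN i hi, map_zero]

/-- The Frobenius `Ŵ^(Fⁿ⁺¹) → Ŵ^(Fⁿ)` is surjective only after an extension. Formal vectors have
finitely many nonzero components, so it suffices to adjoin finitely many `p`-th roots; injectivity
of the extension lets identities be checked there. -/
theorem exists_frobenius_eq (hA : (p : A) = 0) {T : Type u} [CommRing T] [Algebra A T]
    (a b : HatW p n T) : ∃ (T' : Type u) (_ : CommRing T') (_ : Algebra A T') (f : T →ₐ[A] T')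
      (u v : HatW p (n + 1) T'), Function.Injective f ∧
      WittVector.frobenius (u : WittVector p T') = WittVector.map (f : T →+* T') a ∧
      WittVector.frobenius (v : WittVector p T') = WittVector.map (f : T →+* T') b := by
  have hT := natCast_eq_zero_of_algebra hA T
  obtain ⟨N, hN⟩ := a.2.1.exists_bound
  obtain ⟨M, hM⟩ := b.2.1.exists_bound
  obtain ⟨T', _, _, f, hf, h⟩ := exists_pow_eq p A
    ((List.range N).map (fun i => (a : WittVector p T).coeff i) ++
      (List.range M).map (fun i => (b : WittVector p T).coeff i))
  have hT' := natCast_eq_zero_of_algebra hA T'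
  have key : ∀ (c : HatW p n T) (K : ℕ), (∀ i, K ≤ i → (c : WittVector p T).coeff i = 0) →
      (∀ i < K, ∃ s, s ^ p = f ((c : WittVector p T).coeff i)) →
      ∃ u : HatW p (n + 1) T',
        WittVector.frobenius (u : WittVector p T') = WittVector.map (f : T →+* T') c := by
    intro c K hK hs
    choose! s hs using hs
    have h1 : ∀ i, (if i < K then s i else 0) ^ p = f ((c : WittVector p T).coeff i) := fun i => by
      split_ifs with hi
      · exact hs i hi
      · rw [hK i (not_lt.1 hi), map_zero, zero_pow hp.out.ne_zero]
    have h2 : ∀ i, (if i < K then s i else 0) ^ p ^ (n + 1) = 0 := fun i => by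
      rw [pow_succ', pow_mul, h1, ← map_pow, c.coeff_pow hT, map_zero]
    refine ⟨⟨WittVector.mk p fun i => if i < K then s i else 0, ⟨fun i => ⟨_, h2 i⟩, ?_⟩, ?_⟩, ?_⟩
    · refine (Set.finite_Iio K).subset fun i hi => ?_
      by_contra h3
      exact hi (if_neg h3)
    · ext i
      rw [coeff_iterate_frobenius hT', WittVector.zero_coeff]
      exact h2 i
    · ext i
      rw [coeff_frobenius hT', WittVector.map_coeff]
      exact h1 i
  obtain ⟨u, hu⟩ := key a N hN fun i hi => h _ (List.mem_append_left _
    (List.mem_map.2 ⟨i, List.mem_range.2 hi, rfl⟩))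
  obtain ⟨v, hv⟩ := key b M hM fun i hi => h _ (List.mem_append_right _
    (List.mem_map.2 ⟨i, List.mem_range.2 hi, rfl⟩))
  exact ⟨T', _, _, f, u, v, hf, hu, hv⟩

/-- A character of `Ŵ^(Fⁿ⁺¹)` that is trivial on the first tangent direction factors through the
Frobenius `Ŵ^(Fⁿ⁺¹) → Ŵ^(Fⁿ)`. -/
theorem HatChar.IsDescribed.exists_factor {χ : HatChar p (n + 1) A} {hA : (p : A) = 0}
    {f : ℕ → A[X]} (hf : χ.IsDescribed hA f) (h0 : (f 0).coeff 1 = 0) :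
    ∃ ψ : HatChar p n A, ∀ (T : Type u) [CommRing T] [Algebra A T] (a : HatW p (n + 1) T)
      (b : HatW p n T), (b : WittVector p T) = WittVector.frobenius (a : WittVector p T) →
        χ.toFun T a = ψ.toFun T b := by
  -- As `fᵢ(X) = gᵢ(Xᵖ)`, the product `∏ fᵢ(aᵢ)` is `∏ gᵢ(aᵢᵖ)`, a function of `F(a)`.
  let g : ℕ → A[X] := fun i => contract p (f i)
  have hg : ∀ i, (g i).coeff 0 = 1 := fun i => by
    rw [coeff_contract hp.out.ne_zero, zero_mul, hf.coeff_zero]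
  have key : ∀ (T : Type u) [CommRing T] [Algebra A T] (a : HatW p (n + 1) T),
      χ.toFun T a = prodEval g (WittVector.frobenius (a : WittVector p T)) := by
    intro T _ _ a
    have hT := natCast_eq_zero_of_algebra hA T
    obtain ⟨N, hN⟩ := a.2.1.exists_bound
    rw [hf.eq_prod a hN, prodEval_eq hg (N := N)]
    · refine Finset.prod_congr rfl fun i _ => ?_
      rw [coeff_frobenius hT, ← expand_aeval, hf.expand_contract h0]
    · intro i hi
      rw [coeff_frobenius hT, hN i hi, zero_pow hp.out.ne_zero]
  refine ⟨⟨fun T _ _ a => prodEval g (a : WittVector p T), fun T _ _ => ?_, fun T _ _ a b => ?_,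
    fun T T' _ _ _ _ f a => prodEval_map hg f a.2.1⟩, fun T _ _ a b hab => ?_⟩
  · refine (prodEval_eq hg (N := 0) fun i _ => WittVector.zero_coeff p T i).trans ?_
    rw [Finset.prod_range_zero]
  -- Additivity of `ψ` is known on Frobenius images, where it is that of `χ`; over the injective
  -- extension `T'` both arguments become such images.
  · obtain ⟨T', _, _, φ, u, v, hφ, hu, hv⟩ := exists_frobenius_eq hA a b
    apply hφ
    have h := χ.map_add T' u v
    rw [key, key, key, hu, hv] at h
    rw [map_mul, ← prodEval_map hg φ a.2.1, ← prodEval_map hg φ b.2.1, ← h,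
      ← prodEval_map hg φ (a + b).2.1]
    congr 1
    refine (_root_.map_add (WittVector.map (φ : T →+* T')) (a : WittVector p T) b).trans ?_
    rw [← hu, ← hv]
    exact (_root_.map_add WittVector.frobenius (u : WittVector p T') v).symm
  · rw [key, ← hab]

/-! ### Surjectivity and injectivity of the duality map -/

/-- Every character of `Ŵ^(Fⁿ)` is of the form `a ↦ λ(a w)`. -/
theorem HatChar.exists_eq_hatCharacter (hA : (p : A) = 0) : ∀ {n : ℕ} (χ : HatChar p n A),
    ∃ w : WittVector p A, ∀ (T : Type u) [CommRing T] [Algebra A T] (a : HatW p n T),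
      χ.toFun T a = hatCharacter p ((a : WittVector p T) * WittVector.map (algebraMap A T) w) := by
  intro n
  induction n with
  | zero =>
    intro χ
    refine ⟨0, fun T _ _ a => ?_⟩
    -- For `n = 0` the condition `Fⁿ(a) = 0` says `a = 0`.
    have h : a = 0 := Subtype.ext a.2.2
    rw [_root_.map_zero, mul_zero, hatCharacter_zero (natCast_eq_zero_of_algebra hA T), h, χ.map_zero]
  | succ n ih =>
    intro χ
    obtain ⟨f, hf⟩ := χ.exists_isDescribed hA
    -- With `c` the linear coefficient of `f₀`, one has `λ([ε][-c]) = 1 - cε`; the twist by `v`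
    -- therefore cancels it.
    let v : WittVector p A := WittVector.teichmuller p (-(f 0).coeff 1)
    let χ' := χ.twist hA v
    obtain ⟨f', hf'⟩ := χ'.exists_isDescribed hA
    have h0 : (f' 0).coeff 1 = 0 := by
      have hT : (p : DualNumber A) = 0 := natCast_eq_zero_of_algebra hA _
      have hε : (DualNumber.eps : DualNumber A) ^ 2 = 0 := by rw [pow_two, DualNumber.eps_mul_eps]
      have hε' : (DualNumber.eps : DualNumber A) ^ p ^ (n + 1) = 0 :=
        pow_eq_zero_of_le (hp.out.two_le.trans (Nat.le_self_pow n.succ_ne_zero p)) hε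
      have h := hf'.eq_aeval 0 (DualNumber A) DualNumber.eps hε'
      change χ.toFun _ _ * hatCharacter p (WittVector.teichmuller p DualNumber.eps *
        WittVector.map _ (WittVector.teichmuller p _)) = _ at h
      rw [hf.eq_aeval 0 _ _ hε', hf.aeval_of_sq_eq_zero 0 hε, hf'.aeval_of_sq_eq_zero 0 hε,
        WittVector.map_teichmuller, ← map_mul, hatCharacter_teichmuller hT,
        ahEval_of_sq_eq_zero hT (by rw [mul_pow, hε, zero_mul])] at h
      have h2 := congrArg TrivSqZeroExt.snd h
      simp only [TrivSqZeroExt.algebraMap_eq_inl, DualNumber.snd_mul, TrivSqZeroExt.fst_add,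
        TrivSqZeroExt.snd_add, TrivSqZeroExt.fst_inl, TrivSqZeroExt.snd_inl,
        TrivSqZeroExt.fst_one, TrivSqZeroExt.snd_one, TrivSqZeroExt.fst_mul,
        DualNumber.fst_eps, DualNumber.snd_eps] at h2
      linear_combination -h2
    obtain ⟨ψ, hψ⟩ := hf'.exists_factor h0
    obtain ⟨w, hw⟩ := ih ψ
    -- The twisted character is `λ(F(a)w) = λ(V(F(a)w)) = λ(aV(w))`; undoing the twist subtracts
    -- `v`.
    refine ⟨WittVector.verschiebung w - v, fun T _ _ a => ?_⟩
    have hT := natCast_eq_zero_of_algebra hA T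
    have hFa : WittVector.frobenius (a : WittVector p T) ∈ hatWIdeal p n T := by
      refine ⟨(Semidisplay.hatF hT a).2.1, ?_⟩
      rw [← Function.iterate_succ_apply]
      exact a.2.2
    have h1 := (hψ T a ⟨_, hFa⟩ rfl).trans (hw T _)
    change χ.toFun T a * hatCharacter p ((a : WittVector p T) *
      WittVector.map (algebraMap A T) v) = _ at h1
    rw [← hatCharacter_verschiebung hT (isFormal_mul_map _ w), mul_comm (WittVector.frobenius _),
      WittVector.verschiebung_mul_frobenius, ← WittVector.map_verschiebung, mul_comm _ (a : WittVector p T)]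
      at h1
    have h2 := hatCharacter_add hT (isFormal_mul_map a v) (isFormal_mul_map a (-v))
    rw [← mul_add, ← _root_.map_add, add_neg_cancel, _root_.map_zero, mul_zero, hatCharacter_zero hT] at h2
    rw [sub_eq_add_neg, _root_.map_add, mul_add, hatCharacter_add hT (isFormal_mul_map a _)
      (isFormal_mul_map a _), ← h1, mul_assoc, ← h2, mul_one]

/-- If the components below `k` vanish, then `w = Vᵏ(w')` with `w'₀ = wₖ`, and `[x] w = Vᵏ([x ^ (p ^
k)] w')`. When `x ^ (p ^ k)` has square zero, the product under `Vᵏ` is the single Teichmüller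
element `[wₖ x ^ (p ^ k)]`, and `λ` gives `1 + wₖ x ^ (p ^ k)`. -/
theorem coeff_eq_zero_of_hatCharacter_eq_one (hA : (p : A) = 0) {w : WittVector p A}
    (h : ∀ (T : Type u) [CommRing T] [Algebra A T] (a : HatW p n T),
      hatCharacter p ((a : WittVector p T) * WittVector.map (algebraMap A T) w) = 1) :
    ∀ i < n, w.coeff i = 0 := by
  intro k
  induction k using Nat.strong_induction_on with
  | _ k ih =>
  intro hk
  have hw := WittVector.eq_iterate_verschiebung fun i hi => ih i hi (hi.trans hk)
  -- The exponent `2 * p ^ k` makes `x ^ (p ^ k)` square to zero without losing the coefficient at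
  -- `X ^ (p ^ k)`, and `2 * p ^ k ≤ p ^ (k + 1) ≤ p ^ n` makes `[x]` an admissible argument.
  obtain ⟨B, _, _, x, hx, hBx⟩ := exists_truncated_polynomial A (2 * p ^ k)
  have hB : (p : B) = 0 := natCast_eq_zero_of_algebra hA B
  have hxn : x ^ p ^ n = 0 := by
    refine pow_eq_zero_of_le ?_ hx
    calc 2 * p ^ k ≤ p * p ^ k := Nat.mul_le_mul_right _ hp.out.two_le
      _ = p ^ (k + 1) := (pow_succ' p k).symm
      _ ≤ p ^ n := Nat.pow_le_pow_right hp.out.pos hk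
  have h1 := h B (hatSingle hB 0 x hxn)
  have hmap : ∀ y : WittVector p A, WittVector.map (algebraMap A B) (WittVector.verschiebung^[k] y) =
      WittVector.verschiebung^[k] (WittVector.map (algebraMap A B) y) := fun y =>
    (Function.Semiconj.iterate_right (WittVector.map_verschiebung (algebraMap A B)) k y)
  have hV : ∀ z : WittVector p B, IsFormal z →
      hatCharacter p (WittVector.verschiebung^[k] z) = hatCharacter p z := fun z hz => by
    have : ∀ m, IsFormal (WittVector.verschiebung^[m] z) ∧
        hatCharacter p (WittVector.verschiebung^[m] z) = hatCharacter p z := fun m => by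
      induction m with
      | zero => exact ⟨hz, rfl⟩
      | succ m ih =>
        rw [Function.iterate_succ_apply']
        exact ⟨Semidisplay.isFormal_verschiebung ih.1, (hatCharacter_verschiebung hB ih.1).trans ih.2⟩
    exact (this k).2
  have hF : WittVector.frobenius^[k] (WittVector.teichmuller p x) =
      WittVector.teichmuller p (x ^ p ^ k) := by
    ext i
    rw [coeff_iterate_frobenius hB]
    cases i with
    | zero => simp only [WittVector.teichmuller_coeff_zero]
    | succ i =>
      rw [WittVector.teichmuller_coeff_pos p _ _ i.succ_pos,
        WittVector.teichmuller_coeff_pos p _ _ i.succ_pos,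
        zero_pow (pow_ne_zero _ hp.out.ne_zero)]
  have hsq : (x ^ p ^ k) ^ 2 = 0 := by rw [← pow_mul, mul_comm, hx]
  have hmul : WittVector.map (algebraMap A B) (w.shift k) * WittVector.teichmuller p (x ^ p ^ k) =
      WittVector.teichmuller p (algebraMap A B (w.coeff k) * x ^ p ^ k) := by
    ext i
    rw [coeff_mul_teichmuller, WittVector.map_coeff, WittVector.shift_coeff]
    cases i with
    | zero => rw [WittVector.teichmuller_coeff_zero, pow_zero, pow_one, add_zero]
    | succ i =>
      rw [WittVector.teichmuller_coeff_pos p _ _ i.succ_pos, pow_eq_zero_of_le _ hsq, mul_zero]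
      exact hp.out.two_le.trans (Nat.le_self_pow i.succ_ne_zero p)
  have hsq' : (algebraMap A B (w.coeff k) * x ^ p ^ k) ^ 2 = 0 := by rw [mul_pow, hsq, mul_zero]
  have hform : IsFormal (WittVector.teichmuller p (algebraMap A B (w.coeff k) * x ^ p ^ k)) :=
    (hatSingle (n := n) hB 0 _
      (pow_eq_zero_of_le (hp.out.two_le.trans (Nat.le_self_pow (by omega) p)) hsq')).2.1
  change hatCharacter p (WittVector.teichmuller p x * _) = 1 at h1
  rw [hw, hmap, mul_comm, WittVector.iterate_verschiebung_mul_left, hF, hmul, hV _ hform,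
    hatCharacter_teichmuller hB, ahEval_of_sq_eq_zero hB hsq', add_eq_left] at h1
  have h2 : aeval x (C (w.coeff k) * X ^ p ^ k) = 0 := by
    rw [map_mul, aeval_C, map_pow, aeval_X]
    exact h1
  have h3 := hBx _ h2 (p ^ k) (by have := pow_pos hp.out.pos k; omega)
  rwa [coeff_C_mul_X_pow, if_pos rfl] at h3

end duality

/-! ### The pairing between `Ŵ^(Fⁿ)` and `W_n`: bilinearity, adjunctions, perfectness -/

section pairing

variable {p : ℕ} [hp : Fact p.Prime] {n : ℕ} {T : Type u} [CommRing T]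

theorem pairing_truncate (a : HatW p n T) (c : WittVector p T) :
    pairing a (WittVector.truncate n c) = hatCharacter p ((a : WittVector p T) * c) := by
  rw [pairing, hatSMul_truncate, mul_comm]
  rfl

theorem HatW.isFormal_mul (a : HatW p n T) (c : WittVector p T) :
    IsFormal ((a : WittVector p T) * c) := by
  rw [mul_comm]
  exact a.2.1.mul c

theorem pairing_add_left (hT : (p : T) = 0) (a b : HatW p n T) (y : TruncatedWittVector p n T) :
    pairing (a + b) y = pairing a y * pairing b y := by
  obtain ⟨c, rfl⟩ := WittVector.truncate_surjective p n T y
  rw [pairing_truncate, pairing_truncate, pairing_truncate,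
    ← hatCharacter_add hT (a.isFormal_mul c) (b.isFormal_mul c), ← add_mul]
  rfl

theorem pairing_add_right (hT : (p : T) = 0) (a : HatW p n T) (y z : TruncatedWittVector p n T) :
    pairing a (y + z) = pairing a y * pairing a z := by
  obtain ⟨c, rfl⟩ := WittVector.truncate_surjective p n T y
  obtain ⟨d, rfl⟩ := WittVector.truncate_surjective p n T z
  rw [← map_add, pairing_truncate, pairing_truncate, pairing_truncate,
    ← hatCharacter_add hT (a.isFormal_mul c) (a.isFormal_mul d), ← mul_add]

theorem pairing_zero_right (hT : (p : T) = 0) (a : HatW p n T) :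
    pairing a (0 : TruncatedWittVector p n T) = 1 := by
  rw [← map_zero (WittVector.truncate n), pairing_truncate, mul_zero, hatCharacter_zero hT]

theorem pairing_mul_neg (hT : (p : T) = 0) (a : HatW p n T) (y : TruncatedWittVector p n T) :
    pairing a y * pairing a (-y) = 1 := by
  rw [← pairing_add_right hT, add_neg_cancel, pairing_zero_right hT]

theorem pairing_hatSMul (a : HatW p n T) (y z : TruncatedWittVector p n T) :
    pairing (hatSMul y a) z = pairing a (y * z) := by
  obtain ⟨c, rfl⟩ := WittVector.truncate_surjective p n T y
  obtain ⟨d, rfl⟩ := WittVector.truncate_surjective p n T z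
  rw [← map_mul, pairing_truncate, pairing_truncate, hatSMul_truncate]
  congr 1
  change c * (a : WittVector p T) * d = _
  ring

/-- `⟨V(a), y⟩ = ⟨a, F(y)⟩`. -/
theorem pairing_verschiebung (hT : (p : T) = 0) (a b : HatW p n T)
    (hb : (b : WittVector p T) = WittVector.verschiebung (a : WittVector p T))
    (y : TruncatedWittVector p n T) : pairing b y = pairing a (truncF y) := by
  obtain ⟨c, rfl⟩ := WittVector.truncate_surjective p n T y
  rw [truncF_truncate hT, pairing_truncate, pairing_truncate, hb,
    ← WittVector.verschiebung_mul_frobenius, hatCharacter_verschiebung hT (a.isFormal_mul _)]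

theorem truncV_truncRestrict (c : WittVector p T) :
    truncV (truncRestrict p n T (WittVector.truncate n c)) =
      WittVector.truncate n (WittVector.verschiebung c) := by
  rw [truncRestrict, TruncatedWittVector.truncate_wittVector_truncate, truncV_truncate]

/-- `⟨F(a), y⟩ = ⟨a, V(y)⟩`. -/
theorem pairing_frobenius (hT : (p : T) = 0) (a b : HatW p n T)
    (hb : (b : WittVector p T) = WittVector.frobenius (a : WittVector p T))
    (y : TruncatedWittVector p n T) :
    pairing b y = pairing a (truncV (truncRestrict p n T y)) := by
  obtain ⟨c, rfl⟩ := WittVector.truncate_surjective p n T y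
  rw [truncV_truncRestrict, pairing_truncate, pairing_truncate, mul_comm (a : WittVector p T),
    ← WittVector.verschiebung_mul_frobenius, ← hb, mul_comm c,
    hatCharacter_verschiebung hT (b.isFormal_mul _)]

variable {A : Type u} [CommRing A]

theorem truncMap_truncF (hA : (p : A) = 0) (f : A →+* T) (y : TruncatedWittVector p n A) :
    truncMap p n f (truncF y) = truncF (truncMap p n f y) := by
  have hT : (p : T) = 0 := by rw [← map_natCast f, hA, map_zero]
  obtain ⟨c, rfl⟩ := WittVector.truncate_surjective p n A y
  rw [truncF_truncate hA, truncMap_truncate, truncMap_truncate, truncF_truncate hT]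
  exact congrArg _ (map_iterate_frobenius f 1 c)

theorem truncMap_truncV (f : A →+* T) (y : TruncatedWittVector p n A) :
    truncMap p n f (truncV (truncRestrict p n A y)) =
      truncV (truncRestrict p n T (truncMap p n f y)) := by
  obtain ⟨c, rfl⟩ := WittVector.truncate_surjective p n A y
  rw [truncV_truncRestrict, truncMap_truncate, truncMap_truncate, truncV_truncRestrict,
    WittVector.map_verschiebung]

theorem truncMap_comp {S : Type u} [CommRing S] (g : T →+* S) (f : A →+* T)
    (y : TruncatedWittVector p n A) :
    truncMap p n g (truncMap p n f y) = truncMap p n (g.comp f) y := by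
  ext i
  simp [truncMap]

variable [Algebra A T]

theorem map_pairing (hT : (p : T) = 0) {T' : Type u} [CommRing T'] [Algebra A T'] (f : T →ₐ[A] T')
    (a : HatW p n T) (y : TruncatedWittVector p n T) :
    f (pairing a y) = pairing (hatMap f a) (truncMap p n (f : T →+* T') y) := by
  obtain ⟨c, rfl⟩ := WittVector.truncate_surjective p n T y
  have h := map_hatCharacter hT (f : T →+* T') (a.isFormal_mul c)
  rw [map_mul] at h
  rw [truncMap_truncate, pairing_truncate, pairing_truncate]
  exact h

/-- The pairing between `Ŵ^(Fⁿ)` and `W_n` is nondegenerate on the right. -/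
theorem eq_of_pairing_eq (hA : (p : A) = 0) {y z : TruncatedWittVector p n A}
    (h : ∀ (T : Type u) [CommRing T] [Algebra A T] (a : HatW p n T),
      pairing a (truncMap p n (algebraMap A T) y) = pairing a (truncMap p n (algebraMap A T) z)) :
    y = z := by
  obtain ⟨c, hc⟩ := WittVector.truncate_surjective p n A (y - z)
  rw [← sub_eq_zero, ← hc, ← RingHom.mem_ker, WittVector.mem_ker_truncate]
  refine coeff_eq_zero_of_hatCharacter_eq_one hA fun T _ _ a => ?_
  have hT := natCast_eq_zero_of_algebra hA T
  rw [← pairing_truncate, ← truncMap_truncate, hc, map_sub, sub_eq_add_neg, pairing_add_right hT, h,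
    pairing_mul_neg hT]

/-- Every character of `Ŵ^(Fⁿ)` is given by the pairing with an element of `W_n`. -/
theorem HatChar.exists_eq_pairing (hA : (p : A) = 0) (χ : HatChar p n A) :
    ∃ y : TruncatedWittVector p n A, ∀ (T : Type u) [CommRing T] [Algebra A T] (a : HatW p n T),
      χ.toFun T a = pairing a (truncMap p n (algebraMap A T) y) := by
  obtain ⟨w, hw⟩ := χ.exists_eq_hatCharacter hA
  refine ⟨WittVector.truncate n w, fun T _ _ a => ?_⟩
  rw [hw, truncMap_truncate, pairing_truncate]

/-- The value of the pairing, as a unit. -/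
noncomputable def pairingUnit (hT : (p : T) = 0) (a : HatW p n T) (y : TruncatedWittVector p n T) :
    Tˣ where
  val := pairing a y
  inv := pairing a (-y)
  val_inv := pairing_mul_neg hT a y
  inv_val := by rw [mul_comm, pairing_mul_neg hT]

end pairing

/-! ### Characters of `C⁰` as linear forms on `P` -/

namespace Semidisplay

open TensorProduct

variable {p : ℕ} [Fact p.Prime] {n : ℕ} [NeZero n] {R : Type u} [CommRing R] [Algebra (ZMod p) R]
  {P : Type v} [AddCommGroup P] [Module (TruncatedWittVector p n R) P]
  (D : Semidisplay p n R P) (R' : Type u) [CommRing R'] [Algebra R R']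

theorem C0_hom_ext {T : Type u} [CommRing T] [Algebra R T] {G : Type w} [AddCommGroup G]
    {χ ψ : D.C0 T →+ G} (h : ∀ (a : HatW p n T) (x : P), χ (a ⊗ₜ x) = ψ (a ⊗ₜ x)) : χ = ψ := by
  refine AddMonoidHom.ext fun c => ?_
  induction c using TensorProduct.induction_on with
  | zero => rw [map_zero, map_zero]
  | add c d hc hd => rw [map_add, map_add, hc, hd]
  | tmul a x => exact h a x

variable {R'} in
/-- The homomorphism `a ⊗ x ↦ ⟨a, η(x)⟩`. -/
noncomputable def formApp (η : D.LinearForms R') (T : Type u) [CommRing T] [Algebra R T]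
    [Algebra R' T] [IsScalarTower R R' T] : D.C0 T →+ Additive Tˣ :=
  have hT := natCast_eq_zero p R T
  liftAddHom
    (AddMonoidHom.mk'
      (fun a => AddMonoidHom.mk' (fun x => Additive.ofMul
          (pairingUnit hT a (truncMap p n (algebraMap R' T) (η x)))) fun x y => by
        rw [map_add, map_add, ← ofMul_mul]
        exact congrArg Additive.ofMul (Units.ext (pairing_add_right hT _ _ _)))
      fun a b => by
        ext x
        exact pairing_add_left hT _ _ _)
    fun r a x => by
      refine congrArg Additive.ofMul (Units.ext ?_)
      -- The map is balanced: `⟨ra, η(x)⟩ = ⟨a, rη(x)⟩ = ⟨a, η(rx)⟩`.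
      change pairing (hatSMul (truncMap p n (algebraMap R T) r) a) _ =
        pairing a (truncMap p n (algebraMap R' T) (η (r • x)))
      rw [pairing_hatSMul, map_smulₛₗ, smul_eq_mul, map_mul, truncMap_comp,
        ← IsScalarTower.algebraMap_eq]

/-- The homomorphism from linear forms to characters of `C⁰`. -/
noncomputable def formCharacter : D.LinearForms R' →+ D.C0functor.CartierDual R' where
  toFun η := ⟨fun T => D.formApp η T, fun T T' => by
    intro _ _ _ _ _ _ _ _ f c
    have h : (D.formApp η T').comp (D.C0map (f.restrictScalars R)) =
        (MonoidHom.toAdditive (Units.map (f : T →* T'))).comp (D.formApp η T) :=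
      D.C0_hom_ext fun a x => by
        refine congrArg Additive.ofMul (Units.ext ?_)
        refine Eq.trans ?_ (map_pairing (natCast_eq_zero p R T) (f.restrictScalars R) a _).symm
        rw [truncMap_comp]
        exact congrArg (fun g => pairing _ (truncMap p n g (η x))) (AlgHom.comp_algebraMap f).symm
    exact congrArg (fun z : Additive T'ˣ => (z.toMul : T')) (DFunLike.congr_fun h c)⟩
  map_zero' := by
    ext1
    funext T _ _ _ _
    refine D.C0_hom_ext fun a x => congrArg Additive.ofMul (Units.ext ?_)
    change pairing a (truncMap p n (algebraMap R' T) ((0 : D.LinearForms R') x)) = 1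
    rw [LinearMap.zero_apply, map_zero, pairing_zero_right (natCast_eq_zero p R T)]
  map_add' η θ := by
    ext1
    funext T _ _ _ _
    refine D.C0_hom_ext fun a x => congrArg Additive.ofMul (Units.ext ?_)
    change pairing a (truncMap p n (algebraMap R' T) ((η + θ) x)) = _
    rw [LinearMap.add_apply, map_add, pairing_add_right (natCast_eq_zero p R T)]
    rfl

theorem formCharacter_app_tmul (η : D.LinearForms R') (T : Type u) [CommRing T] [Algebra R T]
    [Algebra R' T] [IsScalarTower R R' T] (a : HatW p n T) (x : P) :
    (((D.formCharacter R' η).app T (a ⊗ₜ x)).toMul : T) =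
      pairing a (truncMap p n (algebraMap R' T) (η x)) := rfl

variable {R'} in
/-- Elements of `W_n(R')` can be compared by means of the pairing over `R'`-algebras. -/
theorem eq_of_pairing_eq_of_tower {y z : TruncatedWittVector p n R'}
    (h : ∀ (T : Type u) [CommRing T] [Algebra R T] [Algebra R' T] [IsScalarTower R R' T]
      (a : HatW p n T), pairing a (truncMap p n (algebraMap R' T) y) =
        pairing a (truncMap p n (algebraMap R' T) z)) : y = z := by
  refine eq_of_pairing_eq (natCast_eq_zero p R R') fun T _ _ a => ?_
  let : Algebra R T := ((algebraMap R' T).comp (algebraMap R R')).toAlgebra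
  have : IsScalarTower R R' T := IsScalarTower.of_algebraMap_eq fun _ => rfl
  exact h T a

theorem formCharacter_injective : Function.Injective (D.formCharacter R') := by
  intro η θ h
  ext1 x
  refine eq_of_pairing_eq_of_tower (R := R) fun T _ _ _ _ a => ?_
  rw [← formCharacter_app_tmul, ← formCharacter_app_tmul, h]

/-- The character `a ↦ χ(a ⊗ x)` of `Ŵ^(Fⁿ)`. -/
noncomputable def charAt (χ : D.C0functor.CartierDual R') (x : P) : HatChar p n R' where
  toFun T _ _ a :=
    letI : Algebra R T := ((algebraMap R' T).comp (algebraMap R R')).toAlgebra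
    haveI : IsScalarTower R R' T := IsScalarTower.of_algebraMap_eq fun _ => rfl
    ((χ.app T (a ⊗ₜ x : D.C0 T)).toMul : T)
  map_zero T _ _ := by
    let : Algebra R T := ((algebraMap R' T).comp (algebraMap R R')).toAlgebra
    have : IsScalarTower R R' T := IsScalarTower.of_algebraMap_eq fun _ => rfl
    change ((χ.app T ((0 : HatW p n T) ⊗ₜ x : D.C0 T)).toMul : T) = 1
    rw [zero_tmul]
    exact congrArg (fun z : Additive Tˣ => (z.toMul : T)) (map_zero (χ.app T))
  map_add T _ _ a b := by
    let : Algebra R T := ((algebraMap R' T).comp (algebraMap R R')).toAlgebra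
    have : IsScalarTower R R' T := IsScalarTower.of_algebraMap_eq fun _ => rfl
    change ((χ.app T ((a + b) ⊗ₜ x : D.C0 T)).toMul : T) = _
    rw [add_tmul]
    exact congrArg (fun z : Additive Tˣ => (z.toMul : T)) (map_add (χ.app T) _ _)
  natural T T' _ _ _ _ f a := by
    let : Algebra R T := ((algebraMap R' T).comp (algebraMap R R')).toAlgebra
    have : IsScalarTower R R' T := IsScalarTower.of_algebraMap_eq fun _ => rfl
    let : Algebra R T' := ((algebraMap R' T').comp (algebraMap R R')).toAlgebra
    have : IsScalarTower R R' T' := IsScalarTower.of_algebraMap_eq fun _ => rfl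
    exact χ.natural T T' f (a ⊗ₜ x : D.C0 T)

/-- Characters of `C⁰` are indexed by towers `R → R' → T`, those of `Ŵ^(Fⁿ)` by `R'`-algebras alone.
The tower condition determines the `R`-structure on `T`, so nothing depends on the one installed in
`charAt`. -/
theorem charAt_apply (χ : D.C0functor.CartierDual R') (x : P) (T : Type u) [CommRing T]
    [Algebra R T] [Algebra R' T] [IsScalarTower R R' T] (a : HatW p n T) :
    (D.charAt R' χ x).toFun T a = ((χ.app T (a ⊗ₜ x : D.C0 T)).toMul : T) := by
  have h : ‹Algebra R T› = ((algebraMap R' T).comp (algebraMap R R')).toAlgebra :=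
    Algebra.algebra_ext _ _ fun r => IsScalarTower.algebraMap_apply R R' T r
  subst h
  rfl

/-- The values `η(x)` are chosen separately for each `x` by the duality; additivity and linearity
follow from nondegeneracy, since both sides of each identity pair in the same way with every `a`. -/
theorem formCharacter_surjective : Function.Surjective (D.formCharacter R') := by
  intro χ
  choose η hη using fun x => (D.charAt R' χ x).exists_eq_pairing (natCast_eq_zero p R R')
  have key : ∀ (x : P) (T : Type u) [CommRing T] [Algebra R T] [Algebra R' T] [IsScalarTower R R' T]
      (a : HatW p n T), pairing a (truncMap p n (algebraMap R' T) (η x)) =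
        ((χ.app T (a ⊗ₜ x : D.C0 T)).toMul : T) := by
    intro x T _ _ _ _ a
    rw [← hη, charAt_apply]
  let η' : D.LinearForms R' :=
    { toFun := η
      map_add' := fun x y => eq_of_pairing_eq_of_tower (R := R) fun T _ _ _ _ a => by
        rw [map_add, pairing_add_right (natCast_eq_zero p R T), key, key, key, tmul_add]
        exact congrArg (fun z : Additive Tˣ => (z.toMul : T)) (map_add (χ.app T) _ _)
      map_smul' := fun r x => eq_of_pairing_eq_of_tower (R := R) fun T _ _ _ _ a => by
        rw [smul_eq_mul, map_mul, ← pairing_hatSMul, truncMap_comp, ← IsScalarTower.algebraMap_eq,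
          key, key, ← smul_tmul]
        rfl }
  refine ⟨η', ?_⟩
  ext1
  funext T _ _ _ _
  exact D.C0_hom_ext fun a x => congrArg Additive.ofMul (Units.ext (key x T a))

/-! ### Characters of `𝔷` and invariance under `Φ` -/

theorem toZink_dual_injective : Function.Injective (D.toZink.dual R') := by
  intro χ ψ h
  ext1
  funext T _ _ _ _
  refine AddMonoidHom.ext fun c => ?_
  obtain ⟨d, rfl⟩ := QuotientAddGroup.mk_surjective c
  have h1 := congrArg (fun ω : D.C0functor.CartierDual R' => ω.app T d) h
  exact h1

/-- A character of `C⁰` comes from a character of `𝔷` if and only if it is invariant under `Φ`. -/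
theorem mem_range_toZink_dual (χ : D.C0functor.CartierDual R') :
    χ ∈ (D.toZink.dual R').range ↔ ∀ (T : Type u) [CommRing T] [Algebra R T] [Algebra R' T]
      [IsScalarTower R R' T] (c : D.Cneg1 T), χ.app T (c : D.C0 T) = χ.app T (D.phi T c) := by
  constructor
  · rintro ⟨ψ, rfl⟩ T _ _ _ _ c
    refine congrArg (ψ.app T) ?_
    exact (QuotientAddGroup.eq_iff_sub_mem (N := (D.oneSubPhi T).range)).2 ⟨c, rfl⟩
  · intro h
    -- A `Φ`-invariant character kills the image of `1 - Φ` for each `T`, and naturality of the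
    -- induced maps is inherited along the surjections `C⁰(T) → 𝔷(T)`.
    refine ⟨⟨fun T => QuotientAddGroup.lift (D.oneSubPhi T).range (χ.app T) ?_, ?_⟩, ?_⟩
    · rintro _ ⟨c, rfl⟩
      refine (map_sub (χ.app T) (c : D.C0 T) (D.phi T c)).trans ?_
      exact sub_eq_zero.2 (h T c)
    · intro T T' _ _ _ _ _ _ _ _ f c
      obtain ⟨d, rfl⟩ := QuotientAddGroup.mk_surjective c
      exact χ.natural T T' f d
    · rfl

/-- Invariance under `Φ` can be tested on generators. -/
theorem app_eq_app_phi {T : Type u} [CommRing T] [Algebra R T] {G : Type w} [AddCommGroup G]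
    (χ : D.C0 T →+ G)
    (hV : ∀ (a b : HatW p n T) (x : P),
      (b : WittVector p T) = WittVector.verschiebung (a : WittVector p T) →
        χ (b ⊗ₜ x) = χ (a ⊗ₜ D.F x))
    (hF : ∀ (a b : HatW p n T) (y : D.Q) (z : P),
      (b : WittVector p T) = WittVector.frobenius (a : WittVector p T) →
        Submodule.Quotient.mk z = D.F₁ y → χ (a ⊗ₜ (y : P)) = χ (b ⊗ₜ z))
    (c : D.Cneg1 T) : χ c = χ (D.phi T c) := by
  have hle : AddSubgroup.closure (D.gens T) ≤ D.Cneg1 T :=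
    (AddSubgroup.closure_le _).2 D.gens_subset
  -- By `ker_le_closure`, the elements `V(a) ⊗ x` and `a ⊗ y` generate `C⁻¹(T)`; on them `Φ` is
  -- given by its defining formulas.
  suffices key : ∀ (c : D.C0 T) (hc : c ∈ AddSubgroup.closure (D.gens T)),
      χ c = χ (D.phi T ⟨c, hle hc⟩) from key c (D.ker_le_closure c.1 c.2)
  intro c hc
  induction hc using AddSubgroup.closure_induction with
  | mem c hc =>
    rcases hc with ⟨a, b, x, hab, hc⟩ | ⟨a, y, hc⟩
    · rw [(D.isZinkPhi_phi T).verschiebung a b x _ hab hc, ← hV a b x hab, hc]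
    · rw [(D.isZinkPhi_phi T).frobenius a (hatF (natCast_eq_zero p R T) a) y _ _ rfl
        (D.mk_liftF₁ y) hc, ← hF a _ y _ rfl (D.mk_liftF₁ y), hc]
  | zero =>
    rw [show (⟨0, hle (zero_mem _)⟩ : D.Cneg1 T) = 0 from rfl, map_zero, map_zero, map_zero]
  | add x y hx hy h₁ h₂ =>
    refine (map_add χ x y).trans ?_
    rw [h₁, h₂, ← map_add, ← map_add]
    rfl
  | neg x hx h₁ =>
    refine (map_neg χ x).trans ?_
    rw [h₁, ← map_neg, ← map_neg]
    rfl

/-- On `V(a) ⊗ x` invariance reads `⟨V(a), η(x)⟩ = ⟨a, η(F(x))⟩`, and on `a ⊗ y` it reads `⟨a, η(y)⟩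
= ⟨F(a), η(z)⟩` with `z` representing `F₁(y)`. The adjunctions move `V` and `F` to the second
argument, and nondegeneracy over all towers removes `a`. -/
theorem formCharacter_mem_range (η : D.LinearForms R') :
    D.formCharacter R' η ∈ (D.toZink.dual R').range ↔ η ∈ D.homToUnit R' := by
  have hR' := natCast_eq_zero p R R'
  rw [mem_range_toZink_dual]
  constructor
  · intro h
    refine ⟨fun x => ?_, fun y z hyz => ?_⟩
    · refine eq_of_pairing_eq_of_tower (R := R) fun T _ _ _ _ a => ?_
      have hT := natCast_eq_zero p R T
      have h1 := h T ⟨hatV hT a ⊗ₜ x, D.gens_subset (Or.inl ⟨a, hatV hT a, x, rfl, rfl⟩)⟩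
      rw [(D.isZinkPhi_phi T).verschiebung a (hatV hT a) x _ rfl rfl] at h1
      have h2 : pairing (hatV hT a) (truncMap p n (algebraMap R' T) (η x)) =
          pairing a (truncMap p n (algebraMap R' T) (η (D.F x))) :=
        congrArg (fun z : Additive Tˣ => (z.toMul : T)) h1
      rw [← h2, pairing_verschiebung hT a _ rfl, truncMap_truncF hR']
    · refine eq_of_pairing_eq_of_tower (R := R) fun T _ _ _ _ a => ?_
      have hT := natCast_eq_zero p R T
      have h1 := h T ⟨a ⊗ₜ (y : P), D.gens_subset (Or.inr ⟨a, y, rfl⟩)⟩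
      rw [(D.isZinkPhi_phi T).frobenius a (hatF hT a) y z _ rfl hyz rfl] at h1
      have h2 : pairing a (truncMap p n (algebraMap R' T) (η y)) =
          pairing (hatF hT a) (truncMap p n (algebraMap R' T) (η z)) :=
        congrArg (fun z : Additive Tˣ => (z.toMul : T)) h1
      rw [h2, pairing_frobenius hT a _ rfl, truncMap_truncV]
  · intro h T _ _ _ _ c
    have hT := natCast_eq_zero p R T
    refine D.app_eq_app_phi (D.formApp η T) (fun a b x hab => ?_) (fun a b y z hab hyz => ?_) c
    · refine congrArg Additive.ofMul (Units.ext ?_)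
      change pairing b (truncMap p n (algebraMap R' T) (η x)) =
        pairing a (truncMap p n (algebraMap R' T) (η (D.F x)))
      rw [h.1, truncMap_truncF hR', pairing_verschiebung hT a b hab]
    · refine congrArg Additive.ofMul (Units.ext ?_)
      change pairing a (truncMap p n (algebraMap R' T) (η y)) =
        pairing b (truncMap p n (algebraMap R' T) (η z))
      rw [h.2 y z hyz, truncMap_truncV, pairing_frobenius hT a b hab]

end Semidisplay

end ZinkDual

theorem propositionp (p : ℕ) [Fact p.Prime] (n : ℕ) [NeZero n] {R : Type u} [CommRing R]
    [Algebra (ZMod p) R] {P : Type v} [AddCommGroup P] [Module (TruncatedWittVector p n R) P]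
    (D : ZinkDual.Semidisplay p n R P) (R' : Type u) [CommRing R'] [Algebra R R'] :
    Function.Injective (D.toZink.dual R') ∧
    ∃ e : D.LinearForms R' ≃+ D.C0functor.CartierDual R',
      (∀ (η : D.LinearForms R') (T : Type u) [CommRing T] [Algebra R T] [Algebra R' T]
        [IsScalarTower R R' T] (a : ZinkDual.HatW p n T) (x : P),
        (((e η).app T (TensorProduct.tmul _ a x)).toMul : T) =
          ZinkDual.pairing a (ZinkDual.truncMap p n (algebraMap R' T) (η x))) ∧
      (D.toZink.dual R').range.comap e.toAddMonoidHom = D.homToUnit R' := by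
  refine ⟨D.toZink_dual_injective R', AddEquiv.ofBijective (D.formCharacter R')
    ⟨D.formCharacter_injective R', D.formCharacter_surjective R'⟩,
    fun η T _ _ _ _ a x => D.formCharacter_app_tmul R' η T a x, ?_⟩
  ext η
  exact D.formCharacter_mem_range R' η
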